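/- **Conventions.** Let $k$ be a field of characteristic $\neq 2$; all vector spaces are finite dimensional. A *composition superalgebra* is a superalgebra $C=C_{\bar 0}\oplus C_{\bar 1}$ with a regular quadratic superform $q=(q_{\bar 0},\mathrm b)$ (a quadratic form $q_{\bar 0}$ on $C_{\bar 0}$ and a nondegenerate even supersymmetric bilinear form $\mathrm b$ on $C$ that restricts on $C_{\bar 0}$ to the polar form of $q_{\bar 0}$) with $q_{\bar 0}(x_{\bar 0}y_{\bar 0})=q_{\bar 0}(x_{\bar 0})q_{\bar 0}(y_{\bar 0})$, $\mathrm b(x_{\bar 0}y,x_{\bar 0}z)=q_{\bar 0}(x_{\bar 0})\mathrm b(y,z)=\mathrm b(yx_{\bar 0},zx_{\bar 0})$ and $\mathrm b(xy,zt)+(-1)^{xy+xz+yz}\mathrm b(zy,xt)=(-1)^{yz}\mathrm b(x,z)\mathrm b(y,t)$. It is a *Hurwitz superalgebra* if it is unital (and nonzero); then $\bar x=\mathrm b(x,1)1-x$ and the attached *para-Hurwitz superalgebra* $S=\bar C$ is $C$ with the product $x\bullet y=\bar x\bar y$ and the same form. For $S$ with product $\bullet$ and form $\mathrm b$, $\mathfrak{tri}(S)=\mathfrak{tri}(S)_{\bar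 0}\oplus\mathfrak{tri}(S)_{\bar 1}$ where $\mathfrak{tri}(S)_{\bar\imath}$ consists of the triples $(d_0,d_1,d_2)\in\mathfrak{osp}(S,q)_{\bar\imath}^3$ with $d_0(x\bullet y)=d_1(x)\bullet y+(-1)^{ix}x\bullet d_2(y)$. Put $\theta(d_0,d_1,d_2)=(d_2,d_0,d_1)$, $l_x(y)=x\bullet y$, $r_x(y)=(-1)^{xy}y\bullet x$, $\sigma_{x,y}(z)=(-1)^{yz}\mathrm b(x,z)y-(-1)^{x(y+z)}\mathrm b(y,z)x$ and $t_{x,y}=(\sigma_{x,y},\tfrac12\mathrm b(x,y)1-r_xl_y,\tfrac12\mathrm b(x,y)1-l_xr_y)\in\mathfrak{tri}(S)$. For para-Hurwitz superalgebras $S,S'$ let $\mathfrak g(S,S')=\mathfrak{tri}(S)\oplus\mathfrak{tri}(S')\oplus\bigoplus_{i=0}^2\iota_i(S\otimes S')$, with $\mathfrak{tri}(S)\oplus\mathfrak{tri}(S')$ a subalgebra and (indices modulo $3$) $[(d_j),\iota_i(x\otimes x')]=\iota_i(d_i(x)\otimes x')$, $[(d'_j),\iota_i(x\otimes x')]=(-1)^{d'_ix}\iota_i(x\otimes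 d'_i(x'))$, $[\iota_i(x\otimes x'),\iota_{i+1}(y\otimes y')]=(-1)^{x'y}\iota_{i+2}((x\bullet y)\otimes(x'\bullet y'))$, $[\iota_i(x\otimes x'),\iota_i(y\otimes y')]=(-1)^{xx'+xy'+yy'}\mathrm b'(x',y')\theta^i(t_{x,y})+(-1)^{yx'}\mathrm b(x,y)\theta'^i(t'_{x',y'})$. Let $S_1=k1$ and $S_2$ be the para-Hurwitz algebras attached to $k$ (norm $\alpha^2$) and to $k\times k$ (norm $\alpha\beta$), $1=(1,1)$, $u=(1,-1)\in S_2$, and $\sigma=\tfrac12\sigma_{1,u}$, so $\sigma(1)=u$, $\sigma(u)=1$. Let $J=H_3(C)$ be the Jordan superalgebra of hermitian $3\times3$ matrices $(a_{ij})=(\bar a_{ji})$ over $C$ with $x\circ y=\tfrac12(xy+(-1)^{xy}yx)$, let $L_x$ be the multiplication by $x$, $e_0,e_1,e_2$ the diagonal idempotents (indices $0,1,2$ modulo $3$ for rows and columns), and $\iota_i(a)\in J$ the matrix with entries $2a$ at $(i+2,i+1)$, $2\bar a$ at $(i+1,i+2)$ and $0$ elsewhere. Put $D_i(a)=2[L_{\iota_i(a)},L_{e_{i+1}}]$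 and let $D_{(d_0,d_1,d_2)}$ be the linear map with $e_i\mapsto0$, $\iota_i(a)\mapsto\iota_i(d_i(a))$. Let $\mathfrak{str}\,J$ be the subalgebra of $\mathfrak{gl}(J)$ generated by the derivations $\mathfrak{der}\,J$ and by $L_J$, and $\mathfrak{pstr}\,J=\mathfrak{str}\,J/kI$, with $I$ the identity map. **Theorem.** Let $C$ be a Hurwitz superalgebra over $k$, $S=\bar C$ and $J=H_3(C)$. Then $\mathfrak g(S_1,S)$, $\mathfrak{der}\,J$, $\mathfrak g(S_2,S)$ and $\mathfrak{pstr}\,J$ are Lie superalgebras, $\mathfrak{str}\,J=\mathfrak{der}\,J\oplus L_J$, and $\mathfrak{tri}(S_2)=\{(\alpha_0\sigma,\alpha_1\sigma,\alpha_2\sigma):\alpha_0+\alpha_1+\alpha_2=0\}$. There is an isomorphism of Lie superalgebras $\Phi:\mathfrak g(S_1,S)\to\mathfrak{der}\,J$ with $\Phi((d_0,d_1,d_2))=D_{(d_0,d_1,d_2)}$ for $(d_0,d_1,d_2)\in\mathfrak{tri}(S)$ and $\Phi(\iota_i(1\otimes a))=D_i(a)$, and it extends (through $S_1=k1\subseteq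 S_2$ and $\mathfrak{der}\,J\to\mathfrak{pstr}\,J$) to an isomorphism of Lie superalgebras $\Phi_2:\mathfrak g(S_2,S)\to\mathfrak{pstr}\,J$ such that - $\Phi_2((d_0,d_1,d_2))=D_{(d_0,d_1,d_2)}+kI$ for $(d_0,d_1,d_2)\in\mathfrak{tri}(S)$; - for $\alpha_0+\alpha_1+\alpha_2=0$, $\Phi_2((\alpha_0\sigma,\alpha_1\sigma,\alpha_2\sigma))=2L_{\alpha_2e_1-\alpha_1e_2}+kI\ \bigl(=2L_{\alpha_1e_0-\alpha_0e_1}+kI=2L_{\alpha_0e_2-\alpha_2e_0}+kI\bigr)$; - $\Phi_2(\iota_i((\alpha1+\beta u)\otimes a))=\alpha D_i(a)+\beta L_{\iota_i(a)}+kI$ for $i=0,1,2$, $\alpha,\beta\in k$, $a\in S$. -/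

import Mathlib

open scoped TensorProduct

noncomputable section

namespace Supermagic

/-! ### Superspaces -/

/-- The sign `(-1) ^ p` in the field `k`, for a parity `p`. -/
def sg (k : Type*) [Field k] (p : ZMod 2) : k := if p = 0 then 1 else -1

/-- A `ℤ/2`-graded vector space `V = V₀ ⊕ V₁`, recorded by the two projections `proj 0`, `proj 1`
onto its homogeneous components (along the other one). -/
class Superspace (k V : Type*) [Field k] [AddCommGroup V] [Module k V] where
  proj : ZMod 2 → V →ₗ[k] V
  proj_proj : ∀ p q v, proj p (proj q v) = if p = q then proj q v else 0
  proj_add : ∀ v, proj 0 v + proj 1 v = v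

/-- The projection of a superspace onto its homogeneous component of parity `p`. -/
abbrev pr (k : Type*) {V : Type*} [Field k] [AddCommGroup V] [Module k V] [Superspace k V]
    (p : ZMod 2) : V →ₗ[k] V := Superspace.proj p

/-- The homogeneous component `V_p` of a superspace. -/
def part (k V : Type*) [Field k] [AddCommGroup V] [Module k V] [Superspace k V]
    (p : ZMod 2) : Submodule k V := LinearMap.eqLocus (pr k p) LinearMap.id

section Basic

variable {k V W X : Type*} [Field k] [AddCommGroup V] [Module k V] [Superspace k V]
  [AddCommGroup W] [Module k W] [Superspace k W] [AddCommGroup X] [Module k X]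

theorem sum_parity {M : Type*} [AddCommMonoid M] (f : ZMod 2 → M) : ∑ p, f p = f 0 + f 1 :=
  Fin.sum_univ_two f

theorem parity_cases (p : ZMod 2) : p = 0 ∨ p = 1 := by
  fin_cases p
  · exact Or.inl rfl
  · exact Or.inr rfl

theorem sg_cases (k : Type*) [Field k] (p : ZMod 2) : sg k p = 1 ∨ sg k p = -1 := by
  unfold sg; split_ifs <;> simp

theorem sg_zero : sg k 0 = 1 := by simp [sg]

theorem sg_one : sg k 1 = -1 := by simp [sg]

theorem sg_add (p q : ZMod 2) : sg k (p + q) = sg k p * sg k q := by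
  rcases parity_cases p with rfl | rfl <;> rcases parity_cases q with rfl | rfl
  · simp [sg]
  · simp [sg]
  · simp [sg]
  · rw [show (1 + 1 : ZMod 2) = 0 from rfl]; simp [sg]

theorem mem_part {p : ZMod 2} {v : V} : v ∈ part k V p ↔ pr k p v = v := Iff.rfl

theorem pr_mem (p : ZMod 2) (v : V) : pr k p v ∈ part k V p := by
  rw [mem_part, Superspace.proj_proj, if_pos rfl]

theorem pr_add (v : V) : pr k 0 v + pr k 1 v = v := Superspace.proj_add v

theorem pr_of_mem {p q : ZMod 2} {v : V} (h : v ∈ part k V q) :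
    pr k p v = if p = q then v else 0 := by
  rw [mem_part] at h
  conv_lhs => rw [← h]
  rw [Superspace.proj_proj, h]

theorem hom_induction {P : V → Prop} (hadd : ∀ x y, P x → P y → P (x + y))
    (hom : ∀ p x, x ∈ part k V p → P x) (x : V) : P x := by
  rw [← pr_add (k := k) x]
  exact hadd _ _ (hom 0 _ (pr_mem _ _)) (hom 1 _ (pr_mem _ _))

/-- For a bilinear map `F` and a sign rule `ε`, the bilinear map that sends homogeneous `x`, `y`
of parities `p`, `q` to `(-1) ^ (ε p q) F(x, y)`. -/
def twist₂ (ε : ZMod 2 → ZMod 2 → ZMod 2) (F : V →ₗ[k] W →ₗ[k] X) : V →ₗ[k] W →ₗ[k] X :=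
  ∑ p, ∑ q, sg k (ε p q) • F.compl₁₂ (pr k p) (pr k q)

/-- The same for trilinear maps. -/
def twist₃ {U : Type*} [AddCommGroup U] [Module k U] [Superspace k U]
    (ε : ZMod 2 → ZMod 2 → ZMod 2 → ZMod 2)
    (F : V →ₗ[k] W →ₗ[k] U →ₗ[k] X) : V →ₗ[k] W →ₗ[k] U →ₗ[k] X :=
  ∑ p, ∑ q, ∑ r, sg k (ε p q r) •
    (F.compl₁₂ (pr k p) (pr k q)).compr₂ (LinearMap.lcomp k X (pr k r))

/-- `(x, y) ↦ (-1) ^ (x y) F(y, x)`. -/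
def superflip (F : V →ₗ[k] W →ₗ[k] X) : W →ₗ[k] V →ₗ[k] X := twist₂ (fun p q => p * q) F.flip

theorem twist₂_hom (ε : ZMod 2 → ZMod 2 → ZMod 2) (F : V →ₗ[k] W →ₗ[k] X) {p q : ZMod 2}
    {x : V} {y : W} (hx : x ∈ part k V p) (hy : y ∈ part k W q) :
    twist₂ ε F x y = sg k (ε p q) • F x y := by
  simp only [twist₂, LinearMap.sum_apply, LinearMap.smul_apply, LinearMap.compl₁₂_apply,
    pr_of_mem hx, pr_of_mem hy]
  rw [Finset.sum_eq_single p, Finset.sum_eq_single q]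
  · simp
  · intro b _ hb; simp [hb]
  · simp
  · intro b _ hb; simp [hb]
  · simp

theorem twist₃_hom {U : Type*} [AddCommGroup U] [Module k U] [Superspace k U]
    (ε : ZMod 2 → ZMod 2 → ZMod 2 → ZMod 2) (F : V →ₗ[k] W →ₗ[k] U →ₗ[k] X) {p q r : ZMod 2}
    {x : V} {y : W} {z : U}
    (hx : x ∈ part k V p) (hy : y ∈ part k W q) (hz : z ∈ part k U r) :
    twist₃ ε F x y z = sg k (ε p q r) • F x y z := by
  simp only [twist₃, LinearMap.sum_apply, LinearMap.smul_apply, LinearMap.compl₁₂_apply,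
    LinearMap.compr₂_apply, LinearMap.lcomp_apply, pr_of_mem hx, pr_of_mem hy, pr_of_mem hz]
  rw [Finset.sum_eq_single p, Finset.sum_eq_single q, Finset.sum_eq_single r]
  · simp
  · intro b _ hb; simp [hb]
  · simp
  · intro b _ hb; simp [hb]
  · simp
  · intro b _ hb; simp [hb]
  · simp

theorem superflip_hom (F : V →ₗ[k] W →ₗ[k] X) {p q : ZMod 2} {x : W} {y : V}
    (hx : x ∈ part k W p) (hy : y ∈ part k V q) :
    superflip F x y = sg k (p * q) • F y x := by
  rw [superflip, twist₂_hom _ _ hx hy, LinearMap.flip_apply]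

end Basic

/-! ### Standard constructions of superspaces -/

section Constructions

variable {k V W : Type*} [Field k] [AddCommGroup V] [Module k V] [Superspace k V]
  [AddCommGroup W] [Module k W] [Superspace k W]

/-- The ground field is purely even. -/
instance instField : Superspace k k where
  proj p := if p = 0 then LinearMap.id else 0
  proj_proj p q v := by
    rcases parity_cases p with rfl | rfl <;> rcases parity_cases q with rfl | rfl <;> simp
  proj_add v := by simp

instance instProd : Superspace k (V × W) where
  proj p := (pr k p).prodMap (pr k p)
  proj_proj p q v := by
    ext <;> simp only [LinearMap.prodMap_apply, Superspace.proj_proj] <;> split_ifs <;> rfl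
  proj_add v := by
    ext <;> simp [Superspace.proj_add]

instance instPi {ι : Type*} : Superspace k (ι → V) where
  proj p := LinearMap.pi fun i => pr k p ∘ₗ LinearMap.proj i
  proj_proj p q v := by
    ext i
    simp only [LinearMap.pi_apply, LinearMap.comp_apply, LinearMap.proj_apply, Superspace.proj_proj]
    split_ifs <;> rfl
  proj_add v := by
    ext i; simp [Superspace.proj_add]

instance instMatrix {m n : Type*} : Superspace k (Matrix m n V) where
  proj p := LinearMap.mapMatrix (pr k p)
  proj_proj p q v := by
    ext i j
    simp only [LinearMap.mapMatrix_apply, Matrix.map_apply, Superspace.proj_proj]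
    split_ifs <;> rfl
  proj_add v := by
    ext i j; simp [Superspace.proj_add]

/-- Linear maps: `f` has parity `p` when `f(V_q) ⊆ W_{p+q}` for all `q`. -/
instance instHom : Superspace k (V →ₗ[k] W) where
  proj p :=
    { toFun := fun f => ∑ q, pr k (p + q) ∘ₗ f ∘ₗ pr k q
      map_add' := fun f g => by
        simp [LinearMap.add_comp, LinearMap.comp_add, Finset.sum_add_distrib]
      map_smul' := fun c f => by
        simp [LinearMap.smul_comp, LinearMap.comp_smul, Finset.smul_sum] }
  proj_proj p q f := by
    ext v
    rcases parity_cases p with rfl | rfl <;> rcases parity_cases q with rfl | rfl <;>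
      simp [sum_parity, Superspace.proj_proj, show (1 + 1 : ZMod 2) = 0 from rfl]
  proj_add f := by
    ext v
    simp only [LinearMap.coe_mk, AddHom.coe_mk, sum_parity, LinearMap.add_apply,
      LinearMap.comp_apply, add_zero, zero_add, show (1 + 1 : ZMod 2) = 0 from rfl]
    conv_rhs => rw [← pr_add (k := k) v, map_add, ← pr_add (k := k) (f (pr k 0 v)),
      ← pr_add (k := k) (f (pr k 1 v))]
    abel

instance instTensor : Superspace k (V ⊗[k] W) where
  proj p := ∑ q, TensorProduct.map (pr k q) (pr k (p + q))
  proj_proj p q v := by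
    induction v using TensorProduct.induction_on with
    | zero => simp
    | tmul x y =>
      rcases parity_cases p with rfl | rfl <;> rcases parity_cases q with rfl | rfl <;>
        simp [sum_parity, Superspace.proj_proj, show (1 + 1 : ZMod 2) = 0 from rfl]
    | add x y hx hy =>
      rw [map_add, map_add, hx, hy]; split_ifs <;> simp
  proj_add v := by
    induction v using TensorProduct.induction_on with
    | zero => simp
    | tmul x y =>
      simp only [sum_parity, LinearMap.add_apply, TensorProduct.map_tmul, add_zero, zero_add,
        show (1 + 1 : ZMod 2) = 0 from rfl]
      conv_rhs => rw [← pr_add (k := k) x, ← pr_add (k := k) y]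
      simp only [TensorProduct.add_tmul, TensorProduct.tmul_add]
      abel
    | add x y hx hy =>
      rw [map_add, map_add, add_add_add_comm, hx, hy]

/-- A graded subspace is a superspace. -/
@[reducible] def superSubmodule (N : Submodule k V) (h : ∀ p, ∀ x ∈ N, pr k p x ∈ N) :
    Superspace k N where
  proj p := (pr k p).restrict (h p)
  proj_proj p q v := by
    ext
    simp only [LinearMap.coe_restrict_apply, Superspace.proj_proj]
    split_ifs <;> rfl
  proj_add v := by
    ext; simp [Superspace.proj_add]

/-- The quotient of a superspace by a graded subspace is a superspace. -/
@[reducible] def superQuotient (N : Submodule k V) (h : ∀ p, ∀ x ∈ N, pr k p x ∈ N) :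
    Superspace k (V ⧸ N) where
  proj p := N.mapQ N (pr k p) (h p)
  proj_proj p q v := by
    induction v using Submodule.Quotient.induction_on with
    | H v =>
      simp only [Submodule.mapQ_apply, Superspace.proj_proj]
      split_ifs <;> rfl
  proj_add v := by
    induction v using Submodule.Quotient.induction_on with
    | H v =>
      simp only [Submodule.mapQ_apply, ← Submodule.Quotient.mk_add, Superspace.proj_add]

theorem mem_part_hom {p : ZMod 2} {f : V →ₗ[k] W} :
    f ∈ part k (V →ₗ[k] W) p ↔ ∀ q, ∀ x ∈ part k V q, f x ∈ part k W (p + q) := by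
  have key : ∀ x, pr k p f x = ∑ q, pr k (p + q) (f (pr k q x)) := fun x => by
    simp [pr, Superspace.proj]
  constructor
  · intro h q x hx
    rw [mem_part] at h
    rw [← h, key]
    rw [Finset.sum_eq_single q]
    · exact pr_mem _ _
    · intro b _ hb; rw [pr_of_mem hx, if_neg hb]; simp
    · simp
  · intro h
    rw [mem_part]
    ext x
    rw [key, sum_parity, mem_part.1 (h 0 _ (pr_mem 0 x)), mem_part.1 (h 1 _ (pr_mem 1 x)),
      ← map_add, pr_add]

theorem mem_part_pi {ι : Type*} {p : ZMod 2} {f : ι → V} :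
    f ∈ part k (ι → V) p ↔ ∀ i, f i ∈ part k V p := by
  simp only [mem_part, funext_iff]; rfl

end Constructions

/-! ### Lie superalgebras -/

section Lie

variable {k : Type*} [Field k]

/-- A superspace with a bilinear bracket is a Lie superalgebra (over a field of characteristic
not two; the last condition follows from the others unless the characteristic is three). -/
structure IsLieSuperalgebra {L : Type*} [AddCommGroup L] [Module k L] [Superspace k L]
    (br : L →ₗ[k] L →ₗ[k] L) : Prop where
  graded : ∀ p q x y, x ∈ part k L p → y ∈ part k L q → br x y ∈ part k L (p + q)
  skew : ∀ p q x y, x ∈ part k L p → y ∈ part k L q → br x y = -(sg k (p * q) • br y x)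
  jacobi : ∀ p q x y z, x ∈ part k L p → y ∈ part k L q →
    br x (br y z) = br (br x y) z + sg k (p * q) • br y (br x z)
  cube : ∀ x ∈ part k L 1, br x (br x x) = 0

/-- Isomorphisms of Lie superalgebras: even linear bijections that preserve the brackets. -/
structure LieSuperIso {L L' : Type*} [AddCommGroup L] [Module k L] [Superspace k L]
    [AddCommGroup L'] [Module k L'] [Superspace k L']
    (br : L →ₗ[k] L →ₗ[k] L) (br' : L' →ₗ[k] L' →ₗ[k] L') extends L ≃ₗ[k] L' where
  map_part : ∀ p, ∀ x ∈ part k L p, toFun x ∈ part k L' p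
  map_bracket : ∀ x y, toFun (br x y) = br' (toFun x) (toFun y)

variable {V : Type*} [AddCommGroup V] [Module k V] [Superspace k V]

/-- The bracket of the general linear Lie superalgebra `gl(V)`: the supercommutator. -/
def glBracket (k V : Type*) [Field k] [AddCommGroup V] [Module k V] [Superspace k V] :
    Module.End k V →ₗ[k] Module.End k V →ₗ[k] Module.End k V :=
  LinearMap.mul k (Module.End k V) - superflip (LinearMap.mul k (Module.End k V))

theorem glBracket_hom {p q : ZMod 2} {f g : Module.End k V}
    (hf : f ∈ part k (Module.End k V) p) (hg : g ∈ part k (Module.End k V) q) :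
    glBracket k V f g = f * g - sg k (p * q) • (g * f) := by
  rw [glBracket, LinearMap.sub_apply, LinearMap.sub_apply, superflip_hom _ hf hg]
  rfl

theorem mul_mem_part {p q : ZMod 2} {f g : Module.End k V}
    (hf : f ∈ part k (Module.End k V) p) (hg : g ∈ part k (Module.End k V) q) :
    f * g ∈ part k (Module.End k V) (p + q) := by
  rw [mem_part_hom] at *
  intro r x hx
  rw [add_assoc]
  exact hf _ _ (hg _ _ hx)

theorem glBracket_mem_part {p q : ZMod 2} {f g : Module.End k V}
    (hf : f ∈ part k (Module.End k V) p) (hg : g ∈ part k (Module.End k V) q) :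
    glBracket k V f g ∈ part k (Module.End k V) (p + q) := by
  rw [glBracket_hom hf hg]
  refine Submodule.sub_mem _ (mul_mem_part hf hg) (Submodule.smul_mem _ _ ?_)
  rw [add_comm]
  exact mul_mem_part hg hf

/-- The restriction of a bracket to a subspace that is closed under it. -/
def subBracket {L : Type*} [AddCommGroup L] [Module k L] (br : L →ₗ[k] L →ₗ[k] L)
    (N : Submodule k L) (h : ∀ x ∈ N, ∀ y ∈ N, br x y ∈ N) : N →ₗ[k] N →ₗ[k] N :=
  LinearMap.mk₂ k (fun x y => ⟨br x y, h x x.2 y y.2⟩)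
    (fun _ _ _ => by ext; simp) (fun _ _ _ => by ext; simp)
    (fun _ _ _ => by ext; simp) (fun _ _ _ => by ext; simp)

/-- The bracket induced on the quotient by a two-sided ideal. -/
def quotBracket {L : Type*} [AddCommGroup L] [Module k L] (br : L →ₗ[k] L →ₗ[k] L)
    (N : Submodule k L) (h : ∀ x, ∀ n ∈ N, br x n ∈ N) (h' : ∀ n ∈ N, ∀ x, br n x ∈ N) :
    (L ⧸ N) →ₗ[k] (L ⧸ N) →ₗ[k] (L ⧸ N) :=
  N.liftQ
    { toFun := fun x => N.mapQ N (br x) (h x)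
      map_add' := fun x y => by
        apply Submodule.linearMap_qext; ext z; simp
      map_smul' := fun c x => by
        apply Submodule.linearMap_qext; ext z; simp }
    (fun n hn => by
      rw [LinearMap.mem_ker]
      apply Submodule.linearMap_qext
      ext z
      simpa using h' n hn z)

/-- The homogeneous derivations of parity `p` of a superalgebra with product `m`. -/
def derPart (m : V →ₗ[k] V →ₗ[k] V) (p : ZMod 2) : Submodule k (Module.End k V) where
  carrier := {d | d ∈ part k (Module.End k V) p ∧
    ∀ q x y, x ∈ part k V q → d (m x y) = m (d x) y + sg k (p * q) • m x (d y)}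
  zero_mem' := ⟨Submodule.zero_mem _, by simp⟩
  add_mem' := fun {a b} ha hb => ⟨Submodule.add_mem _ ha.1 hb.1, fun q x y hx => by
    simp only [LinearMap.add_apply, map_add, ha.2 q x y hx, hb.2 q x y hx, smul_add]; abel⟩
  smul_mem' := fun c a ha => ⟨Submodule.smul_mem _ _ ha.1, fun q x y hx => by
    simp only [LinearMap.smul_apply, map_smul, ha.2 q x y hx, smul_add]
    rw [smul_comm c]⟩

/-- The superspace of derivations `der = der₀ ⊕ der₁` of a superalgebra with product `m`: both
homogeneous components have to be homogeneous derivations. -/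
def der (m : V →ₗ[k] V →ₗ[k] V) : Submodule k (Module.End k V) :=
  ⨅ p, (derPart m p).comap (pr k p)

theorem mem_der {m : V →ₗ[k] V →ₗ[k] V} {d : Module.End k V} :
    d ∈ der m ↔ ∀ p, pr k p d ∈ derPart m p := by
  simp [der, Submodule.mem_iInf]

theorem derPart_le (m : V →ₗ[k] V →ₗ[k] V) (p : ZMod 2) : derPart m p ≤ der m := by
  intro d hd
  rw [mem_der]
  intro q
  rw [pr_of_mem hd.1]
  split_ifs with h
  · exact h ▸ hd
  · exact Submodule.zero_mem _

instance (m : V →ₗ[k] V →ₗ[k] V) : Superspace k (der m) :=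
  superSubmodule (der m) (fun p _ hx => derPart_le m p (mem_der.1 hx p))

/-- Closure of a graded space of endomorphisms (or families of such) under a bilinear map may be
tested on homogeneous elements. -/
theorem bilin_closed {L : Type*} [AddCommGroup L] [Module k L] [Superspace k L]
    (br : L →ₗ[k] L →ₗ[k] L) (N : Submodule k L) (P : ZMod 2 → Submodule k L)
    (hN : ∀ x, x ∈ N → ∀ p, pr k p x ∈ P p)
    (h : ∀ p q x y, x ∈ P p → y ∈ P q → br x y ∈ N) :
    ∀ x ∈ N, ∀ y ∈ N, br x y ∈ N := by
  intro x hx y hy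
  rw [← pr_add (k := k) x, ← pr_add (k := k) y]
  simp only [map_add, LinearMap.add_apply]
  refine Submodule.add_mem _ (Submodule.add_mem _ ?_ ?_) (Submodule.add_mem _ ?_ ?_) <;>
    exact h _ _ _ _ (hN _ hx _) (hN _ hy _)

theorem der_closed (m : V →ₗ[k] V →ₗ[k] V) :
    ∀ x ∈ der m, ∀ y ∈ der m, glBracket k V x y ∈ der m := by
  refine bilin_closed _ _ (derPart m) (fun x hx p => mem_der.1 hx p) ?_
  intro p q f g hf hg
  refine derPart_le m (p + q) ⟨glBracket_mem_part hf.1 hg.1, ?_⟩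
  intro r x y hx
  rw [glBracket_hom hf.1 hg.1]
  have hfx := mem_part_hom.1 hf.1 _ _ hx
  have hgx := mem_part_hom.1 hg.1 _ _ hx
  simp only [LinearMap.sub_apply, LinearMap.smul_apply, Module.End.mul_apply, hf.2 _ _ _ hx,
    hg.2 _ _ _ hx, map_add, map_smul, hf.2 _ _ _ hgx, hg.2 _ _ _ hfx, map_sub, add_mul, mul_add,
    sg_add]
  rw [mul_comm q p]
  rcases sg_cases k (p * q) with h1 | h1 <;> rcases sg_cases k (p * r) with h2 | h2 <;>
    rcases sg_cases k (q * r) with h3 | h3 <;> simp only [h1, h2, h3] <;> module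

/-- The bracket of the Lie superalgebra of derivations. -/
def derBracket (m : V →ₗ[k] V →ₗ[k] V) : der m →ₗ[k] der m →ₗ[k] der m :=
  subBracket (glBracket k V) (der m) (der_closed m)

end Lie

/-! ### Composition superalgebras -/

/-- A composition superalgebra: a superalgebra with product `mul` and a regular quadratic superform
`(q₀, b)` that satisfies the composition laws. -/
structure CompositionSuperalgebra (k C : Type*) [Field k] [AddCommGroup C] [Module k C]
    [Superspace k C] where
  mul : C →ₗ[k] C →ₗ[k] C
  mul_mem : ∀ p q x y, x ∈ part k C p → y ∈ part k C q → mul x y ∈ part k C (p + q)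
  q₀ : QuadraticForm k (part k C 0)
  b : LinearMap.BilinForm k C
  b_even : ∀ p q x y, x ∈ part k C p → y ∈ part k C q → p ≠ q → b x y = 0
  b_symm : ∀ p q x y, x ∈ part k C p → y ∈ part k C q → b x y = sg k (p * q) * b y x
  b_polar : ∀ x y : part k C 0, b x y = QuadraticMap.polar q₀ x y
  regular : b.Nondegenerate
  q₀_mul : ∀ x y z : part k C 0, (z : C) = mul x y → q₀ z = q₀ x * q₀ y
  b_mul_left : ∀ (x : part k C 0) (y z : C), b (mul x y) (mul x z) = q₀ x * b y z
  b_mul_right : ∀ (x : part k C 0) (y z : C), b (mul y x) (mul z x) = q₀ x * b y z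
  b_mul_mul : ∀ p q r s x y z t, x ∈ part k C p → y ∈ part k C q → z ∈ part k C r →
    t ∈ part k C s →
    b (mul x y) (mul z t) + sg k (p * q + p * r + q * r) * b (mul z y) (mul x t) =
      sg k (q * r) * (b x z * b y t)

/-- Hurwitz superalgebras: the unital composition superalgebras. -/
structure HurwitzSuperalgebra (k C : Type*) [Field k] [AddCommGroup C] [Module k C]
    [Superspace k C] extends CompositionSuperalgebra k C where
  one : C
  one_mem : one ∈ part k C 0
  one_mul : ∀ x, mul one x = x
  mul_one : ∀ x, mul x one = x

/-- Symmetric composition superalgebras: those with associative bilinear form. -/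
structure SymmetricCompositionSuperalgebra (k S : Type*) [Field k] [AddCommGroup S] [Module k S]
    [Superspace k S] extends CompositionSuperalgebra k S where
  b_assoc : ∀ x y z, b (mul x y) z = b x (mul y z)

namespace CompositionSuperalgebra

variable {k C : Type*} [Field k] [AddCommGroup C] [Module k C] [Superspace k C]
  (A : CompositionSuperalgebra k C)

theorem eq_of_b_left {x y : C} (h : ∀ r, ∀ z ∈ part k C r, A.b x z = A.b y z) : x = y := by
  rw [← sub_eq_zero]
  apply A.regular.1
  intro z
  rw [map_sub, LinearMap.sub_apply, sub_eq_zero]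
  refine hom_induction (k := k) (P := fun z => A.b x z = A.b y z) ?_ h z
  intro u v hu hv
  rw [map_add, map_add, hu, hv]

theorem eq_of_b_right {x y : C} (h : ∀ r, ∀ z ∈ part k C r, A.b z x = A.b z y) : x = y := by
  rw [← sub_eq_zero]
  apply A.regular.2
  intro z
  rw [map_sub, sub_eq_zero]
  refine hom_induction (k := k) (P := fun z => A.b z x = A.b z y) ?_ h z
  intro u v hu hv
  rw [map_add, LinearMap.add_apply, LinearMap.add_apply, hu, hv]

theorem two_q₀ (x : part k C 0) : 2 * A.q₀ x = A.b x x := by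
  rw [A.b_polar, QuadraticMap.polar, ← two_smul k x, QuadraticMap.map_smul, smul_eq_mul]; ring

end CompositionSuperalgebra

/-! ### Para-Hurwitz superalgebras -/

namespace HurwitzSuperalgebra

variable {k C : Type*} [Field k] [AddCommGroup C] [Module k C] [Superspace k C]
  (H : HurwitzSuperalgebra k C)

/-- The standard involution `x ↦ b(x, 1) 1 - x`. -/
def bar : C →ₗ[k] C := (H.b.flip H.one).smulRight H.one - LinearMap.id

/-- The product `x • y = x̄ ȳ`. -/
def bullet : C →ₗ[k] C →ₗ[k] C := H.mul.compl₁₂ H.bar H.bar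

theorem bar_apply (x : C) : H.bar x = H.b x H.one • H.one - x := rfl

theorem b_one_smul {p : ZMod 2} {x : C} (hx : x ∈ part k C p) (q : ZMod 2) :
    sg k (p * q) * H.b x H.one = H.b x H.one := by
  rcases parity_cases p with rfl | rfl
  · simp [sg_zero]
  · rw [H.b_even _ _ _ _ hx H.one_mem (by decide)]; simp

theorem b_one_comm (x : C) : H.b H.one x = H.b x H.one := by
  refine hom_induction (k := k) (P := fun x => H.b H.one x = H.b x H.one) ?_ ?_ x
  · intro u v hu hv
    rw [map_add, map_add, LinearMap.add_apply, hu, hv]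
  · intro p x hx
    rw [H.b_symm _ _ _ _ H.one_mem hx]; simp [sg_zero]

theorem bar_mem {p : ZMod 2} {x : C} (hx : x ∈ part k C p) : H.bar x ∈ part k C p := by
  rw [bar_apply]
  refine Submodule.sub_mem _ ?_ hx
  rcases parity_cases p with rfl | rfl
  · exact Submodule.smul_mem _ _ H.one_mem
  · rw [H.b_even _ _ _ _ hx H.one_mem (by decide)]; simp

theorem b_one_one_smul (x : C) : H.b H.one H.one • x = (2 : k) • x := by
  have h : ∀ y z, H.b y z = H.q₀ ⟨H.one, H.one_mem⟩ * H.b y z := fun y z => by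
    simpa [H.one_mul] using H.b_mul_left ⟨H.one, H.one_mem⟩ y z
  have h2 := H.two_q₀ ⟨H.one, H.one_mem⟩
  apply H.eq_of_b_left
  intro r z _
  rw [map_smul, map_smul, LinearMap.smul_apply, LinearMap.smul_apply, smul_eq_mul, smul_eq_mul,
    ← h2]
  linear_combination (-2) * h x z

theorem bar_one : H.bar H.one = H.one := by
  rw [bar_apply, b_one_one_smul, two_smul, add_sub_cancel_right]

theorem bar_bar (x : C) : H.bar (H.bar x) = x := by
  conv_lhs => rw [H.bar_apply x]
  rw [map_sub, map_smul, bar_one, bar_apply]; abel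

theorem b_one_one_mul (x y : C) : H.b H.one H.one * H.b x y = 2 * H.b x y := by
  simpa using congrArg (fun z => H.b z y) (H.b_one_one_smul x)

theorem b_bar_bar (x y : C) : H.b (H.bar x) (H.bar y) = H.b x y := by
  simp only [bar_apply, map_sub, map_smul, LinearMap.sub_apply, LinearMap.smul_apply, smul_eq_mul,
    H.b_one_comm y]
  linear_combination (H.b y H.one) * H.b_one_one_mul x H.one

theorem b_bar_left (x y : C) : H.b (H.bar x) y = H.b x (H.bar y) := by
  rw [← H.b_bar_bar x, H.bar_bar]

theorem b_mul_left_adj {p q r : ZMod 2} {x y t : C} (hx : x ∈ part k C p) (hy : y ∈ part k C q)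
    (ht : t ∈ part k C r) : H.b (H.mul x y) t = sg k (p * q) * H.b y (H.mul (H.bar x) t) := by
  have h := H.b_mul_mul p q 0 r x y H.one t hx hy H.one_mem ht
  have h2 := H.b_one_smul hx q
  simp only [H.one_mul, mul_zero, add_zero, sg_zero] at h
  simp only [bar_apply, map_sub, map_smul, LinearMap.sub_apply, LinearMap.smul_apply, smul_eq_mul,
    H.one_mul]
  linear_combination h - H.b y t * h2

theorem b_mul_right_adj {p q r : ZMod 2} {x y z : C} (hx : x ∈ part k C p) (hy : y ∈ part k C q)
    (hz : z ∈ part k C r) : H.b (H.mul x y) z = sg k (q * r) * H.b x (H.mul z (H.bar y)) := by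
  have h := H.b_mul_mul p q r 0 x y z H.one hx hy hz H.one_mem
  have h2 := H.b_one_smul hy r
  have h3 := H.b_symm _ _ _ _ (H.mul_mem _ _ _ _ hz hy) hx
  simp only [H.mul_one] at h
  rw [h3] at h
  simp only [bar_apply, map_sub, map_smul, smul_eq_mul, H.mul_one]
  simp only [sg_add, add_mul, mul_comm r p, mul_comm q p] at h
  rcases sg_cases k (p * q) with h1 | h1 <;> rcases sg_cases k (p * r) with h4 | h4 <;>
    rcases sg_cases k (q * r) with h5 | h5 <;> simp only [h1, h4, h5] at h h2 ⊢ <;>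
    linear_combination h

/-- The standard involution is a superinvolution. -/
theorem bar_mul {p q : ZMod 2} {x y : C} (hx : x ∈ part k C p) (hy : y ∈ part k C q) :
    H.bar (H.mul x y) = sg k (p * q) • H.mul (H.bar y) (H.bar x) := by
  rw [← H.bar_bar (H.mul (H.bar y) (H.bar x)), ← map_smul]
  congr 1
  apply H.eq_of_b_left
  intro r z hz
  have hx' := H.bar_mem hx
  have hy' := H.bar_mem hy
  have hz' := H.bar_mem hz
  rw [map_smul, LinearMap.smul_apply, smul_eq_mul, H.b_bar_left]
  rw [H.b_mul_right_adj hx hy hz, H.b_symm _ _ _ _ hx (H.mul_mem _ _ _ _ hz hy'),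
    H.b_mul_left_adj hz hy' hx, H.b_symm _ _ _ _ hy' (H.mul_mem _ _ _ _ hz' hx),
    H.b_mul_right_adj hz' hx hy', H.b_symm _ _ _ _ hz' (H.mul_mem _ _ _ _ hy' hx')]
  simp only [sg_add, mul_add, mul_comm r p, mul_comm q p, mul_comm r q]
  rcases sg_cases k (p * q) with h1 | h1 <;> rcases sg_cases k (p * r) with h4 | h4 <;>
    rcases sg_cases k (q * r) with h5 | h5 <;> simp only [h1, h4, h5] <;> ring

theorem bullet_apply (x y : C) : H.bullet x y = H.mul (H.bar x) (H.bar y) := rfl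

theorem bullet_assoc (x y z : C) : H.b (H.bullet x y) z = H.b x (H.bullet y z) := by
  refine hom_induction (k := k) (P := fun x => H.b (H.bullet x y) z = H.b x (H.bullet y z))
    ?_ ?_ x
  · intro u v hu hv
    simp only [map_add, LinearMap.add_apply, hu, hv]
  intro p x hx
  refine hom_induction (k := k) (P := fun y => H.b (H.bullet x y) z = H.b x (H.bullet y z))
    ?_ ?_ y
  · intro u v hu hv
    simp only [map_add, LinearMap.add_apply, hu, hv]
  intro q y hy
  refine hom_induction (k := k) (P := fun z => H.b (H.bullet x y) z = H.b x (H.bullet y z))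
    ?_ ?_ z
  · intro u v hu hv
    simp only [map_add, hu, hv]
  intro r z hz
  rw [bullet_apply, bullet_apply, H.b_mul_right_adj (H.bar_mem hx) (H.bar_mem hy) hz, H.bar_bar,
    H.b_bar_left, H.bar_mul hz hy, map_smul, smul_eq_mul, mul_comm r q]
  rcases sg_cases k (q * r) with h5 | h5 <;> simp only [h5] <;> ring

theorem q₀_bar [NeZero (2 : k)] (x : part k C 0) : H.q₀ ⟨H.bar x, H.bar_mem x.2⟩ = H.q₀ x := by
  apply mul_left_cancel₀ (NeZero.ne (2 : k))
  rw [H.two_q₀, H.two_q₀, b_bar_bar]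

/-- The para-Hurwitz superalgebra attached to a Hurwitz superalgebra. -/
def para [NeZero (2 : k)] : SymmetricCompositionSuperalgebra k C where
  mul := H.bullet
  mul_mem p q x y hx hy := H.mul_mem _ _ _ _ (H.bar_mem hx) (H.bar_mem hy)
  q₀ := H.q₀
  b := H.b
  b_even := H.b_even
  b_symm := H.b_symm
  b_polar := H.b_polar
  regular := H.regular
  q₀_mul x y z h := by
    rw [← H.q₀_bar x, ← H.q₀_bar y]
    exact H.q₀_mul _ _ _ h
  b_mul_left x y z := by
    rw [← H.q₀_bar x, ← H.b_bar_bar y]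
    exact H.b_mul_left ⟨_, H.bar_mem x.2⟩ _ _
  b_mul_right x y z := by
    rw [← H.q₀_bar x, ← H.b_bar_bar y]
    exact H.b_mul_right ⟨_, H.bar_mem x.2⟩ _ _
  b_mul_mul p q r s x y z t hx hy hz ht := by
    rw [← H.b_bar_bar x z, ← H.b_bar_bar y t]
    exact H.b_mul_mul p q r s _ _ _ _ (H.bar_mem hx) (H.bar_mem hy) (H.bar_mem hz) (H.bar_mem ht)
  b_assoc := H.bullet_assoc

end HurwitzSuperalgebra

/-! ### The split Hurwitz algebras of dimension one and two -/

section Split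

variable (k : Type*) [Field k]

theorem field_mem (x : k) : x ∈ part k k 0 := rfl

theorem field_sq_mem (x : k × k) : x ∈ part k (k × k) 0 := rfl

theorem field_odd {x : k} {p : ZMod 2} (hx : x ∈ part k k p) : p = 0 ∨ x = 0 := by
  rcases parity_cases p with rfl | rfl
  · exact Or.inl rfl
  · exact Or.inr hx.symm

theorem field_sq_odd {x : k × k} {p : ZMod 2} (hx : x ∈ part k (k × k) p) : p = 0 ∨ x = 0 := by
  rcases parity_cases p with rfl | rfl
  · exact Or.inl rfl
  · exact Or.inr hx.symm

/-- The Hurwitz algebra `k`, with norm `q(α) = α ^ 2`. -/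
def hurwitzField [NeZero (2 : k)] : HurwitzSuperalgebra k k where
  mul := LinearMap.mul k k
  mul_mem p q x y hx hy := by
    rcases field_odd k hx with rfl | rfl
    · rcases field_odd k hy with rfl | rfl
      · exact field_mem k _
      · simp
    · simp
  q₀ := (QuadraticMap.sq (R := k)).comp (part k k 0).subtype
  b := (2 : k) • LinearMap.mul k k
  b_even p q x y hx hy hpq := by
    rcases field_odd k hx with rfl | rfl
    · rcases field_odd k hy with rfl | rfl
      · exact absurd rfl hpq
      · simp
    · simp
  b_symm p q x y hx hy := by
    rcases field_odd k hx with rfl | rfl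
    · simp [sg_zero, mul_comm]
    · simp
  b_polar x y := by
    simp [QuadraticMap.polar]; ring
  regular := by
    constructor
    · intro x hx
      simpa [NeZero.ne (2 : k)] using hx 1
    · intro x hx
      simpa [NeZero.ne (2 : k)] using hx 1
  q₀_mul x y z h := by
    simp at h
    simp [h]; ring
  b_mul_left x y z := by simp; ring
  b_mul_right x y z := by simp; ring
  b_mul_mul p q r s x y z t hx hy hz ht := by
    rcases field_odd k hx with rfl | rfl
    · rcases field_odd k hy with rfl | rfl
      · simp [sg_zero]; ring
      · simp
    · simp
  one := 1
  one_mem := field_mem k 1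
  one_mul x := by simp
  mul_one x := by simp

/-- The polar form `((α, β), (γ, δ)) ↦ α δ + β γ` on `k × k`. -/
def splitForm : LinearMap.BilinForm k (k × k) :=
  LinearMap.mk₂ k (fun x y => x.1 * y.2 + x.2 * y.1)
    (fun _ _ _ => by simp; ring) (fun _ _ _ => by simp; ring)
    (fun _ _ _ => by simp; ring) (fun _ _ _ => by simp; ring)

theorem splitForm_apply (x y : k × k) : splitForm k x y = x.1 * y.2 + x.2 * y.1 := rfl

/-- The norm `(α, β) ↦ α β` on `k × k`. -/
def splitNorm : QuadraticForm k (k × k) :=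
  QuadraticMap.linMulLin (LinearMap.fst k k k) (LinearMap.snd k k k)

/-- The split Hurwitz algebra `k × k`, with norm `q(α, β) = α β`. -/
def hurwitzSplit [NeZero (2 : k)] : HurwitzSuperalgebra k (k × k) where
  mul := LinearMap.mul k (k × k)
  mul_mem p q x y hx hy := by
    rcases field_sq_odd k hx with rfl | rfl
    · rcases field_sq_odd k hy with rfl | rfl
      · exact field_sq_mem k _
      · simp
    · simp
  q₀ := (splitNorm k).comp (part k (k × k) 0).subtype
  b := splitForm k
  b_even p q x y hx hy hpq := by
    rcases field_sq_odd k hx with rfl | rfl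
    · rcases field_sq_odd k hy with rfl | rfl
      · exact absurd rfl hpq
      · simp
    · simp
  b_symm p q x y hx hy := by
    rcases field_sq_odd k hx with rfl | rfl
    · simp [sg_zero, splitForm_apply]; ring
    · simp
  b_polar x y := by
    simp [QuadraticMap.polar, splitForm_apply, splitNorm]; ring
  regular := by
    constructor
    · intro x hx
      have h1 := hx (1, 0)
      have h2 := hx (0, 1)
      simp [splitForm_apply] at h1 h2
      exact Prod.ext h2 h1
    · intro x hx
      have h1 := hx (1, 0)
      have h2 := hx (0, 1)
      simp [splitForm_apply] at h1 h2
      exact Prod.ext h2 h1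
  q₀_mul x y z h := by
    simp at h
    simp [h, splitNorm]; ring
  b_mul_left x y z := by simp [splitForm_apply, splitNorm]; ring
  b_mul_right x y z := by simp [splitForm_apply, splitNorm]; ring
  b_mul_mul p q r s x y z t hx hy hz ht := by
    rcases field_sq_odd k hx with rfl | rfl
    · rcases field_sq_odd k hy with rfl | rfl
      · simp [sg_zero, splitForm_apply]; ring
      · simp
    · simp
  one := 1
  one_mem := field_sq_mem k 1
  one_mul x := by simp
  mul_one x := by simp

/-- The para-Hurwitz algebra `S₁` attached to `k`. -/
def S₁ [NeZero (2 : k)] : SymmetricCompositionSuperalgebra k k := (hurwitzField k).para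

/-- The split two-dimensional para-Hurwitz algebra `S₂` attached to `k × k`. -/
def S₂ [NeZero (2 : k)] : SymmetricCompositionSuperalgebra k (k × k) := (hurwitzSplit k).para

/-- The element `u = (1, -1)` of `S₂`. -/
def uElt : k × k := (1, -1)

end Split

/-! ### The triality Lie superalgebra -/

namespace SymmetricCompositionSuperalgebra

variable {k V : Type*} [Field k] [AddCommGroup V] [Module k V] [Superspace k V]
  (S : SymmetricCompositionSuperalgebra k V)

/-- The component of parity `p` of the orthosymplectic Lie superalgebra `osp(S, q)`. -/
def ospPart (p : ZMod 2) : Submodule k (Module.End k V) where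
  carrier := {d | d ∈ part k (Module.End k V) p ∧
    ∀ q x y, x ∈ part k V q → S.b (d x) y + sg k (p * q) * S.b x (d y) = 0}
  zero_mem' := ⟨Submodule.zero_mem _, by simp⟩
  add_mem' := fun {a b} ha hb => ⟨Submodule.add_mem _ ha.1 hb.1, fun q x y hx => by
    simp only [LinearMap.add_apply, map_add]
    linear_combination ha.2 q x y hx + hb.2 q x y hx⟩
  smul_mem' := fun c a ha => ⟨Submodule.smul_mem _ _ ha.1, fun q x y hx => by
    simp only [LinearMap.smul_apply, map_smul, smul_eq_mul]
    linear_combination c * ha.2 q x y hx⟩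

/-- The component of parity `p` of the triality Lie superalgebra `tri(S)`. -/
def triPart (p : ZMod 2) : Submodule k (Fin 3 → Module.End k V) where
  carrier := {d | (∀ i, d i ∈ S.ospPart p) ∧ ∀ q x y, x ∈ part k V q →
    d 0 (S.mul x y) = S.mul (d 1 x) y + sg k (p * q) • S.mul x (d 2 y)}
  zero_mem' := ⟨fun _ => Submodule.zero_mem _, by simp⟩
  add_mem' := fun {a b} ha hb => ⟨fun i => Submodule.add_mem _ (ha.1 i) (hb.1 i), fun q x y hx => by
    simp only [Pi.add_apply, LinearMap.add_apply, map_add, ha.2 q x y hx, hb.2 q x y hx, smul_add]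
    abel⟩
  smul_mem' := fun c a ha => ⟨fun i => Submodule.smul_mem _ _ (ha.1 i), fun q x y hx => by
    simp only [Pi.smul_apply, LinearMap.smul_apply, map_smul, ha.2 q x y hx, smul_add]
    rw [smul_comm c]⟩

/-- The triality Lie superalgebra `tri(S) = tri(S)₀ ⊕ tri(S)₁`. -/
def tri : Submodule k (Fin 3 → Module.End k V) := ⨅ p, (S.triPart p).comap (pr k p)

theorem mem_tri {d : Fin 3 → Module.End k V} : d ∈ S.tri ↔ ∀ p, pr k p d ∈ S.triPart p := by
  simp [tri, Submodule.mem_iInf]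

variable {S} in
theorem mem_part_of_triPart {p : ZMod 2} {d : Fin 3 → Module.End k V} (hd : d ∈ S.triPart p) :
    d ∈ part k (Fin 3 → Module.End k V) p := mem_part_pi.2 fun i => (hd.1 i).1

theorem triPart_le (p : ZMod 2) : S.triPart p ≤ S.tri := by
  intro d hd
  rw [mem_tri]
  intro q
  rw [pr_of_mem (mem_part_of_triPart hd)]
  split_ifs with h
  · exact h ▸ hd
  · exact Submodule.zero_mem _

instance : Superspace k S.tri :=
  superSubmodule S.tri (fun p _ hx => S.triPart_le p (S.mem_tri.1 hx p))

/-- The componentwise supercommutator on triples of endomorphisms. -/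
def tripleBracket (k V : Type*) [Field k] [AddCommGroup V] [Module k V] [Superspace k V] :
    (Fin 3 → Module.End k V) →ₗ[k] (Fin 3 → Module.End k V) →ₗ[k] (Fin 3 → Module.End k V) :=
  LinearMap.mk₂ k (fun d e i => glBracket k V (d i) (e i))
    (fun _ _ _ => by ext1; simp) (fun _ _ _ => by ext1; simp)
    (fun _ _ _ => by ext1; simp) (fun _ _ _ => by ext1; simp)

theorem osp_closed {p q : ZMod 2} {f g : Module.End k V} (hf : f ∈ S.ospPart p)
    (hg : g ∈ S.ospPart q) : glBracket k V f g ∈ S.ospPart (p + q) := by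
  refine ⟨glBracket_mem_part hf.1 hg.1, ?_⟩
  intro r x y hx
  rw [glBracket_hom hf.1 hg.1]
  have h1 := hf.2 _ _ y (mem_part_hom.1 hg.1 _ _ hx)
  have h2 := hg.2 _ _ y (mem_part_hom.1 hf.1 _ _ hx)
  have h3 := hf.2 _ _ (g y) hx
  have h4 := hg.2 _ _ (f y) hx
  simp only [LinearMap.sub_apply, LinearMap.smul_apply, Module.End.mul_apply, map_sub, map_smul,
    smul_eq_mul, add_mul, mul_add, sg_add] at h1 h2 ⊢
  rw [mul_comm q p] at h2
  rcases sg_cases k (p * q) with e1 | e1 <;> rcases sg_cases k (p * r) with e2 | e2 <;>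
    rcases sg_cases k (q * r) with e3 | e3 <;> simp only [e1, e2, e3] at h1 h2 h3 h4 ⊢
  · linear_combination h1 - h2 + h3 - h4
  · linear_combination h1 - h2 - h3 - h4
  · linear_combination h1 - h2 + h3 + h4
  · linear_combination h1 - h2 - h3 + h4
  · linear_combination h1 + h2 + h3 + h4
  · linear_combination h1 + h2 - h3 + h4
  · linear_combination h1 + h2 + h3 - h4
  · linear_combination h1 + h2 - h3 - h4

theorem tri_closed : ∀ x ∈ S.tri, ∀ y ∈ S.tri, tripleBracket k V x y ∈ S.tri := by
  refine bilin_closed _ _ S.triPart (fun x hx p => S.mem_tri.1 hx p) ?_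
  intro p q f g hf hg
  refine S.triPart_le (p + q) ⟨fun i => S.osp_closed (hf.1 i) (hg.1 i), ?_⟩
  intro r x y hx
  change glBracket k V (f 0) (g 0) _ = S.mul (glBracket k V (f 1) (g 1) x) y +
    sg k ((p + q) * r) • S.mul x (glBracket k V (f 2) (g 2) y)
  rw [glBracket_hom (hf.1 0).1 (hg.1 0).1, glBracket_hom (hf.1 1).1 (hg.1 1).1,
    glBracket_hom (hf.1 2).1 (hg.1 2).1]
  have hfx := mem_part_hom.1 (hf.1 1).1 _ _ hx
  have hgx := mem_part_hom.1 (hg.1 1).1 _ _ hx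
  simp only [LinearMap.sub_apply, LinearMap.smul_apply, Module.End.mul_apply, hf.2 _ _ _ hx,
    hg.2 _ _ _ hx, map_add, map_smul, hf.2 _ _ _ hgx, hg.2 _ _ _ hfx, map_sub, add_mul, mul_add,
    sg_add]
  rw [mul_comm q p]
  rcases sg_cases k (p * q) with h1 | h1 <;> rcases sg_cases k (p * r) with h2 | h2 <;>
    rcases sg_cases k (q * r) with h3 | h3 <;> simp only [h1, h2, h3] <;> module

/-- The bracket of `tri(S)`. -/
def triBracket : S.tri →ₗ[k] S.tri →ₗ[k] S.tri := subBracket (tripleBracket k V) S.tri S.tri_closed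

/-- `(d₀, d₁, d₂) ↦ (d₂, d₀, d₁)` on triples. -/
def rot (k V : Type*) [Field k] [AddCommGroup V] [Module k V] :
    (Fin 3 → Module.End k V) →ₗ[k] (Fin 3 → Module.End k V) where
  toFun d := ![d 2, d 0, d 1]
  map_add' d e := by ext i : 1; fin_cases i <;> rfl
  map_smul' c d := by ext i : 1; fin_cases i <;> rfl

theorem rot_mem_triPart {p : ZMod 2} {d : Fin 3 → Module.End k V} (hd : d ∈ S.triPart p) :
    rot k V d ∈ S.triPart p := by
  constructor
  · intro i
    fin_cases i
    · exact hd.1 2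
    · exact hd.1 0
    · exact hd.1 1
  intro ε e a he
  change d 2 (S.mul e a) = S.mul (d 0 e) a + sg k (p * ε) • S.mul e (d 1 a)
  refine hom_induction (k := k) (P := fun a => d 2 (S.mul e a) =
    S.mul (d 0 e) a + sg k (p * ε) • S.mul e (d 1 a)) ?_ ?_ a
  · intro u v hu hv
    simp only [map_add, hu, hv, smul_add]; abel
  intro α a ha
  apply S.eq_of_b_left
  intro γ c hc
  have hd0e := mem_part_hom.1 (hd.1 0).1 _ _ he
  have hd1a := mem_part_hom.1 (hd.1 1).1 _ _ ha
  have hd2c := mem_part_hom.1 (hd.1 2).1 _ _ hc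
  have h1 := (hd.1 2).2 _ _ c (S.mul_mem _ _ _ _ he ha)
  have h2 := (hd.1 0).2 _ _ e (S.mul_mem _ _ _ _ ha hc)
  rw [hd.2 _ _ _ ha] at h2
  rw [S.b_assoc, S.b_symm _ _ _ _ he (S.mul_mem _ _ _ _ ha hd2c)] at h1
  simp only [map_add, map_smul, LinearMap.add_apply, LinearMap.smul_apply, smul_eq_mul]
  rw [S.b_assoc, S.b_assoc, S.b_symm _ _ _ _ hd0e (S.mul_mem _ _ _ _ ha hc),
    S.b_symm _ _ _ _ he (S.mul_mem _ _ _ _ hd1a hc)]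
  simp only [map_add, map_smul, LinearMap.add_apply, LinearMap.smul_apply, smul_eq_mul,
    add_mul, mul_add, sg_add] at h1 h2 ⊢
  rw [mul_comm ε p] at *
  rcases sg_cases k (p * ε) with e1 | e1 <;> rcases sg_cases k (p * α) with e2 | e2 <;>
    rcases sg_cases k (p * γ) with e3 | e3 <;> rcases sg_cases k (ε * α) with e4 | e4 <;>
    rcases sg_cases k (ε * γ) with e5 | e5 <;> simp only [e1, e2, e3, e4, e5] at h1 h2 ⊢ <;>
    first
    | linear_combination h1 - h2
    | linear_combination h1 + h2

theorem rot_mem {d : Fin 3 → Module.End k V} (hd : d ∈ S.tri) : rot k V d ∈ S.tri := by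
  rw [← pr_add (k := k) d, map_add]
  exact Submodule.add_mem _ (S.triPart_le 0 (S.rot_mem_triPart (S.mem_tri.1 hd 0)))
    (S.triPart_le 1 (S.rot_mem_triPart (S.mem_tri.1 hd 1)))

/-- The automorphism `θ : (d₀, d₁, d₂) ↦ (d₂, d₀, d₁)` of `tri(S)`. -/
def θ : Module.End k S.tri := (rot k V).restrict (fun _ hd => S.rot_mem hd)

/-- `l_x(y) = x • y`. -/
def l : V →ₗ[k] Module.End k V := S.mul

/-- `r_x(y) = (-1) ^ (x y) y • x`. -/
def r : V →ₗ[k] Module.End k V := superflip S.mul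

/-- `(x, y) ↦ (z ↦ b(x, z) y)`. -/
def rankOne : V →ₗ[k] V →ₗ[k] Module.End k V :=
  LinearMap.mk₂ k (fun x y => (S.b x).smulRight y)
    (fun _ _ _ => by ext; simp [add_smul]) (fun _ _ _ => by ext; simp [mul_smul])
    (fun _ _ _ => by ext; simp) (fun c _ _ => by ext; simp [smul_comm c])

/-- `σ_{x,y}(z) = (-1) ^ (y z) b(x, z) y - (-1) ^ (x (y + z)) b(y, z) x`. -/
def σ : V →ₗ[k] V →ₗ[k] Module.End k V :=
  twist₃ (fun _ q r => q * r) S.rankOne - twist₃ (fun p q r => p * (q + r)) S.rankOne.flip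

/-- The triple `(σ_{x,y}, ½ b(x,y) 1 - r_x l_y, ½ b(x,y) 1 - l_x r_y)`. -/
def tTriple : V →ₗ[k] V →ₗ[k] (Fin 3 → Module.End k V) :=
  LinearMap.mk₂ k
    (fun x y => ![S.σ x y, ((1 / 2 : k) * S.b x y) • 1 - S.r x * S.l y,
      ((1 / 2 : k) * S.b x y) • 1 - S.l x * S.r y])
    (fun _ _ _ => by
      ext i : 1
      fin_cases i <;> simp [mul_add, add_mul, add_smul] <;> abel)
    (fun _ _ _ => by
      ext i : 1
      fin_cases i <;> simp [mul_smul, smul_sub, mul_left_comm (2⁻¹ : k)])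
    (fun _ _ _ => by
      ext i : 1
      fin_cases i <;> simp [mul_add, add_smul] <;> abel)
    (fun _ _ _ => by
      ext i : 1
      fin_cases i <;> simp [mul_smul, smul_sub, mul_left_comm (2⁻¹ : k)])

theorem mul_mul_right {p q r : ZMod 2} {x y z : V} (hx : x ∈ part k V p) (hy : y ∈ part k V q)
    (hz : z ∈ part k V r) : S.mul (S.mul x y) z + sg k (p * q + p * r + q * r) •
      S.mul (S.mul z y) x = (sg k (q * r) * S.b x z) • y := by
  apply S.eq_of_b_left
  intro s t ht
  have h := S.b_mul_mul p q r s x y z t hx hy hz ht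
  rw [← S.b_assoc, ← S.b_assoc] at h
  simp only [map_add, map_smul, LinearMap.add_apply, LinearMap.smul_apply, smul_eq_mul]
  linear_combination h

theorem mul_mul_left {p q r : ZMod 2} {x y z : V} (hx : x ∈ part k V p) (hy : y ∈ part k V q)
    (hz : z ∈ part k V r) : S.mul x (S.mul y z) + sg k (p * q + p * r + q * r) •
      S.mul z (S.mul y x) = (sg k (p * q) * S.b x z) • y := by
  apply S.eq_of_b_right
  intro s t ht
  have h := S.b_mul_mul s p q r t x y z ht hx hy hz
  rw [S.b_assoc, S.b_symm _ _ _ _ (S.mul_mem _ _ _ _ hy hx) (S.mul_mem _ _ _ _ ht hz),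
    S.b_assoc] at h
  simp only [map_add, map_smul, smul_eq_mul]
  simp only [add_mul, mul_add, sg_add] at h ⊢
  rw [mul_comm q s, mul_comm p s, mul_comm q r] at *
  rcases sg_cases k (s * p) with e1 | e1 <;> rcases sg_cases k (s * q) with e2 | e2 <;>
    rcases sg_cases k (p * q) with e3 | e3 <;> rcases sg_cases k (p * r) with e4 | e4 <;>
    simp only [e1, e2, e3, e4] at h ⊢ <;>
    linear_combination h

theorem l_mem {p : ZMod 2} {x : V} (hx : x ∈ part k V p) : S.l x ∈ part k (Module.End k V) p :=
  mem_part_hom.2 fun _ _ hy => S.mul_mem _ _ _ _ hx hy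

theorem l_apply (x y : V) : S.l x y = S.mul x y := rfl

theorem r_apply {p q : ZMod 2} {x y : V} (hx : x ∈ part k V p) (hy : y ∈ part k V q) :
    S.r x y = sg k (p * q) • S.mul y x := superflip_hom _ hx hy

theorem r_mem {p : ZMod 2} {x : V} (hx : x ∈ part k V p) : S.r x ∈ part k (Module.End k V) p := by
  rw [mem_part_hom]
  intro q y hy
  rw [S.r_apply hx hy, add_comm]
  exact Submodule.smul_mem _ _ (S.mul_mem _ _ _ _ hy hx)

theorem σ_apply {p q r : ZMod 2} {x y z : V} (hx : x ∈ part k V p) (hy : y ∈ part k V q)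
    (hz : z ∈ part k V r) :
    S.σ x y z = (sg k (q * r) * S.b x z) • y - (sg k (p * (q + r)) * S.b y z) • x := by
  rw [σ, LinearMap.sub_apply, LinearMap.sub_apply, LinearMap.sub_apply, twist₃_hom _ _ hx hy hz,
    twist₃_hom _ _ hx hy hz, mul_smul, mul_smul]
  rfl

theorem b_zero_or {p q : ZMod 2} {x y : V} (hx : x ∈ part k V p) (hy : y ∈ part k V q) :
    p = q ∨ S.b x y = 0 := by
  by_cases h : p = q
  · exact Or.inl h
  · exact Or.inr (S.b_even _ _ _ _ hx hy h)

theorem parity_add_self (p q : ZMod 2) : p + (q + p) = q := by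
  revert p q; decide

theorem parity_two (p : ZMod 2) : p + p = 0 := by
  revert p; decide

theorem sign_aux₀ (p q r s : ZMod 2) (A B C D : k) (hD : q = s ∨ D = 0) (hC : p = s ∨ C = 0) :
    sg k (q * r) * A * D - sg k (p * (q + r)) * B * C + sg k ((p + q) * r) *
      (sg k (q * s) * C * (sg k (r * q) * B) - sg k (p * (q + s)) * D * (sg k (r * p) * A)) = 0 := by
  rcases parity_cases p with rfl | rfl <;> rcases parity_cases q with rfl | rfl <;>
    rcases parity_cases r with rfl | rfl <;> rcases parity_cases s with rfl | rfl <;>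
    simp [sg_zero, sg_one, parity_two] at hC hD ⊢ <;>
    (try simp only [hC, hD]) <;> ring

theorem sign_aux₁ (p q r s : ZMod 2) (A B β ζ : k)
    (h : A + sg k (q * r + q * p + r * p) * B = sg k (r * p) * (sg k (q * p) * β * ζ))
    (hB : p + r = q + s ∨ B = 0) (hβ : p = q ∨ β = 0) :
    sg k (p * (q + r)) * A + sg k ((p + q) * r) * (sg k (p * (q + s)) *
      (sg k (r * (q + s + p)) * (sg k ((q + s) * (p + r)) * B))) = β * ζ := by
  rcases parity_cases p with rfl | rfl <;> rcases parity_cases q with rfl | rfl <;>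
    rcases parity_cases r with rfl | rfl <;> rcases parity_cases s with rfl | rfl <;>
    simp [sg_zero, sg_one, parity_two] at h hB hβ ⊢ <;>
    (try simp only [hB, hβ, zero_mul, add_zero, neg_zero] at h ⊢) <;>
    first
    | linear_combination h
    | linear_combination -h

theorem sign_aux₂ (p q r s : ZMod 2) (A B β ζ : k)
    (h : A + sg k (s * p + s * r + p * r) * B = sg k (p * r) * (sg k (s * r) * ζ * β))
    (hA : s + p = r + q ∨ A = 0) (hB : r + p = s + q ∨ B = 0) (hβ : p = q ∨ β = 0) :
    sg k (q * r) * (sg k ((p + (r + q)) * s) * A) +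
      sg k ((p + q) * r) * (sg k (q * s) * B) = β * ζ := by
  rcases parity_cases p with rfl | rfl <;> rcases parity_cases q with rfl | rfl <;>
    rcases parity_cases r with rfl | rfl <;> rcases parity_cases s with rfl | rfl <;>
    simp [sg_zero, sg_one, parity_two] at h hA hB hβ ⊢ <;>
    (try simp only [hA, hB, hβ, mul_zero, zero_mul, add_zero, neg_zero] at h ⊢) <;>
    first
    | linear_combination h
    | linear_combination -h

/-- To be orthosymplectic may be tested on homogeneous elements. -/
theorem mem_osp {p : ZMod 2} {d : Module.End k V} (h : d ∈ part k (Module.End k V) p)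
    (h2 : ∀ r s z w, z ∈ part k V r → w ∈ part k V s →
      S.b (d z) w + sg k (p * r) * S.b z (d w) = 0) : d ∈ S.ospPart p := by
  refine ⟨h, fun r z w hz => ?_⟩
  refine hom_induction (k := k) (P := fun w => S.b (d z) w + sg k (p * r) * S.b z (d w) = 0)
    ?_ (fun s w hw => h2 r s z w hz hw) w
  intro u v hu hv
  simp only [map_add]
  linear_combination hu + hv

theorem smul_one_mem {p q : ZMod 2} {x y : V} (hx : x ∈ part k V p) (hy : y ∈ part k V q) :
    ((1 / 2 : k) * S.b x y) • (1 : Module.End k V) ∈ part k (Module.End k V) (p + q) := by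
  rcases S.b_zero_or hx hy with rfl | h
  · refine Submodule.smul_mem _ _ (mem_part_hom.2 fun q x hx => ?_)
    rwa [parity_two, zero_add]
  · rw [h]; simp

theorem t0_mem {p q : ZMod 2} {x y : V} (hx : x ∈ part k V p) (hy : y ∈ part k V q) :
    S.σ x y ∈ S.ospPart (p + q) := by
  apply S.mem_osp
  · rw [mem_part_hom]
    intro r z hz
    rw [S.σ_apply hx hy hz]
    refine Submodule.sub_mem _ ?_ ?_
    · rcases S.b_zero_or hx hz with rfl | h
      · rw [add_assoc, parity_add_self]; exact Submodule.smul_mem _ _ hy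
      · rw [h]; simp
    · rcases S.b_zero_or hy hz with rfl | h
      · rw [add_assoc, add_comm q q, add_comm p, add_assoc, add_comm q p, parity_add_self]
        exact Submodule.smul_mem _ _ hx
      · rw [h]; simp
  · intro r s z w hz hw
    rw [S.σ_apply hx hy hz, S.σ_apply hx hy hw]
    simp only [map_sub, map_smul, LinearMap.sub_apply, LinearMap.smul_apply, smul_eq_mul,
      S.b_symm _ _ _ _ hz hy, S.b_symm _ _ _ _ hz hx]
    exact sign_aux₀ p q r s _ _ _ _ (S.b_zero_or hy hw) (S.b_zero_or hx hw)

theorem half_b [NeZero (2 : k)] {p q : ZMod 2} {x y : V} (hx : x ∈ part k V p)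
    (hy : y ∈ part k V q) (r : ZMod 2) (c : k) :
    (1 / 2 : k) * S.b x y * c + sg k ((p + q) * r) * ((1 / 2 : k) * S.b x y * c) = S.b x y * c := by
  have h2 := NeZero.ne (2 : k)
  rcases S.b_zero_or hx hy with rfl | h
  · rw [parity_two, zero_mul, sg_zero]
    field_simp
    ring
  · rw [h]; ring

theorem t1_mem [NeZero (2 : k)] {p q : ZMod 2} {x y : V} (hx : x ∈ part k V p)
    (hy : y ∈ part k V q) :
    ((1 / 2 : k) * S.b x y) • 1 - S.r x * S.l y ∈ S.ospPart (p + q) := by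
  apply S.mem_osp
  · exact Submodule.sub_mem _ (S.smul_one_mem hx hy) (mul_mem_part (S.r_mem hx) (S.l_mem hy))
  · intro r s z w hz hw
    have hyz := S.mul_mem _ _ _ _ hy hz
    have hyw := S.mul_mem _ _ _ _ hy hw
    have hb := S.half_b hx hy r (S.b z w)
    have hc := S.b_mul_mul _ _ _ _ _ _ _ _ hy hz hx hw
    have hxz := S.mul_mem _ _ _ _ hx hz
    rw [S.b_symm _ _ _ _ hy hx] at hc
    have hs := sign_aux₁ p q r s _ _ _ _ hc (S.b_zero_or hxz hyw) (S.b_zero_or hx hy)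
    have e2 : S.b z (S.mul (S.mul y w) x) = sg k (r * (q + s + p)) * (sg k ((q + s) * (p + r)) *
        S.b (S.mul x z) (S.mul y w)) := by
      rw [S.b_symm _ _ _ _ hz (S.mul_mem _ _ _ _ hyw hx), S.b_assoc, S.b_symm _ _ _ _ hyw hxz]
    simp only [LinearMap.sub_apply, LinearMap.smul_apply, Module.End.mul_apply, S.l_apply,
      S.r_apply hx hyz, S.r_apply hx hyw, Module.End.one_apply, map_sub, map_smul, smul_eq_mul,
      e2, S.b_assoc (S.mul y z) x w]
    linear_combination hb - hs

theorem t2_mem [NeZero (2 : k)] {p q : ZMod 2} {x y : V} (hx : x ∈ part k V p)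
    (hy : y ∈ part k V q) :
    ((1 / 2 : k) * S.b x y) • 1 - S.l x * S.r y ∈ S.ospPart (p + q) := by
  apply S.mem_osp
  · exact Submodule.sub_mem _ (S.smul_one_mem hx hy) (mul_mem_part (S.l_mem hx) (S.r_mem hy))
  · intro r s z w hz hw
    have hzy := S.mul_mem _ _ _ _ hz hy
    have hwy := S.mul_mem _ _ _ _ hw hy
    have hwx := S.mul_mem _ _ _ _ hw hx
    have hzx := S.mul_mem _ _ _ _ hz hx
    have hb := S.half_b hx hy r (S.b z w)
    have hc := S.b_mul_mul _ _ _ _ _ _ _ _ hw hx hz hy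
    rw [S.b_symm _ _ _ _ hw hz] at hc
    have hs := sign_aux₂ p q r s _ _ _ _ hc (S.b_zero_or hwx hzy) (S.b_zero_or hzx hwy)
      (S.b_zero_or hx hy)
    have e1 : S.b (S.mul x (S.mul z y)) w = sg k ((p + (r + q)) * s) *
        S.b (S.mul w x) (S.mul z y) := by
      rw [S.b_symm _ _ _ _ (S.mul_mem _ _ _ _ hx hzy) hw, S.b_assoc]
    simp only [LinearMap.sub_apply, LinearMap.smul_apply, Module.End.mul_apply, S.l_apply,
      S.r_apply hy hz, S.r_apply hy hw, Module.End.one_apply, map_sub, map_smul, smul_eq_mul,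
      e1, ← S.b_assoc z x]
    linear_combination hb - hs

theorem tTriple_mem_triPart [NeZero (2 : k)] {p q : ZMod 2} {x y : V} (hx : x ∈ part k V p)
    (hy : y ∈ part k V q) : S.tTriple x y ∈ S.triPart (p + q) := by
  constructor
  · intro i
    fin_cases i
    · exact S.t0_mem hx hy
    · exact S.t1_mem hx hy
    · exact S.t2_mem hx hy
  intro r z w hz
  change S.σ x y (S.mul z w) =
    S.mul ((((1 / 2 : k) * S.b x y) • 1 - S.r x * S.l y : Module.End k V) z) w +
    sg k ((p + q) * r) • S.mul z ((((1 / 2 : k) * S.b x y) • 1 - S.l x * S.r y : Module.End k V) w)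
  refine hom_induction (k := k) (P := fun w => S.σ x y (S.mul z w) =
    S.mul ((((1 / 2 : k) * S.b x y) • 1 - S.r x * S.l y : Module.End k V) z) w +
    sg k ((p + q) * r) •
      S.mul z ((((1 / 2 : k) * S.b x y) • 1 - S.l x * S.r y : Module.End k V) w)) ?_ ?_ w
  · intro u v hu hv
    rw [map_add, map_add, hu, hv, map_add, map_add, map_add, smul_add]
    abel
  intro s w hw
  have hzw := S.mul_mem _ _ _ _ hz hw
  have hyz := S.mul_mem _ _ _ _ hy hz
  have hwx := S.mul_mem _ _ _ _ hw hx
  have i1 := eq_sub_of_add_eq (S.mul_mul_right hyz hx hw)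
  have i2 := eq_sub_of_add_eq (S.mul_mul_left hwx hy hz)
  have i3 := eq_sub_of_add_eq (S.mul_mul_left hy hw hx)
  have e1 : S.b (S.mul w x) z = sg k ((s + p) * r) * (sg k ((r + s) * p) * S.b x (S.mul z w)) := by
    rw [S.b_symm _ _ _ _ hwx hz, ← S.b_assoc, S.b_symm _ _ _ _ hzw hx]
  have hb := S.half_b hx hy r 1
  simp only [mul_one] at hb
  rw [S.σ_apply hx hy hzw]
  simp only [LinearMap.sub_apply, LinearMap.smul_apply, Module.End.mul_apply, S.l_apply,
      S.r_apply hx hyz, S.r_apply hy hw, Module.End.one_apply, map_sub, map_smul, smul_sub]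
  rw [i1, i2, i3, e1, S.b_assoc y z w, S.b_symm _ _ _ _ hy hx]
  have hb2 : ((1 / 2 : k) * S.b x y) • S.mul z w +
      (sg k ((p + q) * r) * ((1 / 2 : k) * S.b x y)) • S.mul z w = S.b x y • S.mul z w := by
    rw [← add_smul, hb]
  have c1 := S.b_zero_or hx hzw
  have c2 := S.b_zero_or hx hy
  simp only [map_sub, map_smul, smul_sub, smul_smul] at hb2 ⊢
  clear i1 i2 i3 e1 hb hyz hwx
  generalize S.b x (S.mul z w) = ξ at *
  generalize S.b x y = β at *
  generalize S.b y (S.mul z w) = η at *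
  generalize S.mul z (S.mul x (S.mul w y)) = T at *
  generalize S.mul z w = U at *
  clear hx hy hz hw hzw
  rcases parity_cases p with rfl | rfl <;> rcases parity_cases q with rfl | rfl <;>
    rcases parity_cases r with rfl | rfl <;> rcases parity_cases s with rfl | rfl <;>
    simp only [add_zero, zero_add, mul_zero, mul_one, one_mul, sg_zero, sg_one,
      parity_two, zero_ne_one, one_ne_zero, false_or] at hb2 c1 c2 ⊢ <;>
    (try simp only [c1, c2] at hb2 ⊢) <;> linear_combination (norm := module) -hb2


end SymmetricCompositionSuperalgebra

/-! ### The Lie superalgebra `g(S, S')` -/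

namespace SymmetricCompositionSuperalgebra

section Square

variable {k V V' : Type*} [Field k]
  [AddCommGroup V] [Module k V] [Superspace k V]
  [AddCommGroup V'] [Module k V'] [Superspace k V']
  (S : SymmetricCompositionSuperalgebra k V) (S' : SymmetricCompositionSuperalgebra k V')

theorem tTriple_mem [NeZero (2 : k)] (x y : V) : S.tTriple x y ∈ S.tri := by
  rw [← pr_add (k := k) x, ← pr_add (k := k) y]
  simp only [map_add, LinearMap.add_apply]
  refine Submodule.add_mem _ (Submodule.add_mem _ ?_ ?_) (Submodule.add_mem _ ?_ ?_) <;>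
    exact S.triPart_le _ (S.tTriple_mem_triPart (pr_mem _ _) (pr_mem _ _))

/-- The element `t_{x,y}` of `tri(S)`. -/
def t [NeZero (2 : k)] : V →ₗ[k] V →ₗ[k] S.tri :=
  LinearMap.mk₂ k (fun x y => ⟨S.tTriple x y, S.tTriple_mem x y⟩)
    (fun _ _ _ => by ext1; simp) (fun _ _ _ => by ext1; simp)
    (fun _ _ _ => by ext1; simp) (fun _ _ _ => by ext1; simp)

/-- `[(d₀, d₁, d₂), ι_i(x ⊗ x')] = ι_i(d_i(x) ⊗ x')`, as a map with values in `S ⊗ S'`. -/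
def actL (V' : Type*) [AddCommGroup V'] [Module k V'] (i : Fin 3) :
    S.tri →ₗ[k] (V ⊗[k] V') →ₗ[k] (V ⊗[k] V') :=
  LinearMap.rTensorHom V' ∘ₗ LinearMap.proj i ∘ₗ S.tri.subtype

/-- `[(d₀', d₁', d₂'), ι_i(x ⊗ x')] = (-1) ^ (d_i' x) ι_i(x ⊗ d_i'(x'))`. -/
def actR (V : Type*) [AddCommGroup V] [Module k V] [Superspace k V] (i : Fin 3) :
    S'.tri →ₗ[k] (V ⊗[k] V') →ₗ[k] (V ⊗[k] V') :=
  ∑ p, ∑ q, sg k (p * q) •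
    (TensorProduct.mapBilinear (RingHom.id k) V V' V V' (pr k q) ∘ₗ pr k p ∘ₗ
      LinearMap.proj i ∘ₗ S'.tri.subtype)

/-- `[ι_i(x ⊗ x'), ι_{i+1}(y ⊗ y')] = (-1) ^ (x' y) ι_{i+2}((x • y) ⊗ (x' • y'))`. -/
def mulT : (V ⊗[k] V') →ₗ[k] (V ⊗[k] V') →ₗ[k] (V ⊗[k] V') :=
  ∑ p', ∑ q, sg k (p' * q) •
    TensorProduct.map₂ (S.mul.compl₂ (pr k q)) (S'.mul ∘ₗ pr k p')

/-- `(x ⊗ x', y ⊗ y') ↦ (-1) ^ (x x' + x y' + y y') b'(x', y') t_{x,y}`. -/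
def tL [NeZero (2 : k)] : (V ⊗[k] V') →ₗ[k] (V ⊗[k] V') →ₗ[k] S.tri :=
  ∑ p, ∑ p', ∑ q, ∑ q', sg k (p * p' + p * q' + q * q') •
    (TensorProduct.map₂ (S.t.compl₁₂ (pr k p) (pr k q))
      (S'.b.compl₁₂ (pr k p') (pr k q'))).compr₂ (TensorProduct.rid k S.tri).toLinearMap

/-- `(x ⊗ x', y ⊗ y') ↦ (-1) ^ (y x') b(x, y) t'_{x',y'}`. -/
def tR [NeZero (2 : k)] : (V ⊗[k] V') →ₗ[k] (V ⊗[k] V') →ₗ[k] S'.tri :=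
  ∑ q, ∑ p', sg k (q * p') •
    (TensorProduct.map₂ (S.b.compl₂ (pr k q)) (S'.t ∘ₗ pr k p')).compr₂
      (TensorProduct.lid k S'.tri).toLinearMap

/-- The superspace `g(S, S') = tri(S) ⊕ tri(S') ⊕ ι₀(S ⊗ S') ⊕ ι₁(S ⊗ S') ⊕ ι₂(S ⊗ S')`. -/
def G : Type _ := S.tri × S'.tri × (Fin 3 → V ⊗[k] V')

instance : AddCommGroup (G S S') :=
  inferInstanceAs (AddCommGroup (S.tri × S'.tri × (Fin 3 → V ⊗[k] V')))

instance : Module k (G S S') :=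
  inferInstanceAs (Module k (S.tri × S'.tri × (Fin 3 → V ⊗[k] V')))

instance : Superspace k (G S S') :=
  inferInstanceAs (Superspace k (S.tri × S'.tri × (Fin 3 → V ⊗[k] V')))

/-- The component of an element of `g(S, S')` in `tri(S)`. -/
def prTriL : G S S' →ₗ[k] S.tri := LinearMap.fst k S.tri (S'.tri × (Fin 3 → V ⊗[k] V'))

/-- The component of an element of `g(S, S')` in `tri(S')`. -/
def prTriR : G S S' →ₗ[k] S'.tri :=
  LinearMap.fst k S'.tri (Fin 3 → V ⊗[k] V') ∘ₗ
    LinearMap.snd k S.tri (S'.tri × (Fin 3 → V ⊗[k] V'))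

/-- The component of an element of `g(S, S')` in `ι_i(S ⊗ S')`. -/
def prι (i : Fin 3) : G S S' →ₗ[k] V ⊗[k] V' :=
  LinearMap.proj i ∘ₗ LinearMap.snd k S'.tri (Fin 3 → V ⊗[k] V') ∘ₗ
    LinearMap.snd k S.tri (S'.tri × (Fin 3 → V ⊗[k] V'))

/-- The element of `g(S, S')` with given components. -/
def mkG (d : S.tri) (d' : S'.tri) (w : Fin 3 → V ⊗[k] V') : G S S' := (d, d', w)

variable {S S'} in
theorem G_ext {X Y : G S S'} (h : prTriL S S' X = prTriL S S' Y)
    (h' : prTriR S S' X = prTriR S S' Y) (hι : ∀ i, prι S S' i X = prι S S' i Y) : X = Y :=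
  Prod.ext h (Prod.ext h' (funext hι))

theorem prTriL_mkG (d : S.tri) (d' : S'.tri) (w : Fin 3 → V ⊗[k] V') :
    prTriL S S' (mkG S S' d d' w) = d := rfl

theorem prTriR_mkG (d : S.tri) (d' : S'.tri) (w : Fin 3 → V ⊗[k] V') :
    prTriR S S' (mkG S S' d d' w) = d' := rfl

theorem prι_mkG (d : S.tri) (d' : S'.tri) (w : Fin 3 → V ⊗[k] V') (i : Fin 3) :
    prι S S' i (mkG S S' d d' w) = w i := rfl

/-- The copy of `tri(S)` in `g(S, S')`. -/
def inTriL (d : S.tri) : G S S' := mkG S S' d 0 0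

/-- The copy of `tri(S')` in `g(S, S')`. -/
def inTriR (d : S'.tri) : G S S' := mkG S S' 0 d 0

/-- The copy `ι_i(S ⊗ S')` of `S ⊗ S'` in `g(S, S')`. -/
def ι (i : Fin 3) (w : V ⊗[k] V') : G S S' := mkG S S' 0 0 (Pi.single i w)

/-- The bracket of `g(S, S')`. In the last component, the terms with `superflip` are the brackets
`[ι_j(w), d]` and `[ι_{j+2}(w), ι_{j+1}(z)]`, given by super-anticommutativity. -/
def gBracket [NeZero (2 : k)] : G S S' →ₗ[k] G S S' →ₗ[k] G S S' :=
  LinearMap.mk₂ k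
    (fun X Y => mkG S S'
      (S.triBracket (prTriL S S' X) (prTriL S S' Y) +
        ∑ i : Fin 3, (S.θ ^ (i : ℕ)) (tL S S' (prι S S' i X) (prι S S' i Y)))
      (S'.triBracket (prTriR S S' X) (prTriR S S' Y) +
        ∑ i : Fin 3, (S'.θ ^ (i : ℕ)) (tR S S' (prι S S' i X) (prι S S' i Y)))
      (fun j =>
        S.actL V' j (prTriL S S' X) (prι S S' j Y) + S'.actR V j (prTriR S S' X) (prι S S' j Y)
          - superflip (S.actL V' j) (prι S S' j X) (prTriL S S' Y)
          - superflip (S'.actR V j) (prι S S' j X) (prTriR S S' Y)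
          + mulT S S' (prι S S' (j + 1) X) (prι S S' (j + 2) Y)
          - superflip (mulT S S') (prι S S' (j + 2) X) (prι S S' (j + 1) Y)))
    (fun X Y Z => by
      refine G_ext ?_ ?_ (fun j => ?_) <;>
        simp [prTriL_mkG, prTriR_mkG, prι_mkG, Finset.sum_add_distrib] <;> abel)
    (fun c X Y => by
      refine G_ext ?_ ?_ (fun j => ?_) <;>
        simp [prTriL_mkG, prTriR_mkG, prι_mkG, Finset.smul_sum, smul_add,
          smul_sub])
    (fun X Y Z => by
      refine G_ext ?_ ?_ (fun j => ?_) <;>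
        simp [prTriL_mkG, prTriR_mkG, prι_mkG, Finset.sum_add_distrib] <;> abel)
    (fun c X Y => by
      refine G_ext ?_ ?_ (fun j => ?_) <;>
        simp [prTriL_mkG, prTriR_mkG, prι_mkG, Finset.smul_sum, smul_add,
          smul_sub])

end Square

end SymmetricCompositionSuperalgebra

/-! ### The Jordan superalgebra `H₃(C)` -/

namespace HurwitzSuperalgebra

section Jordan

variable {k C : Type*} [Field k] [AddCommGroup C] [Module k C] [Superspace k C]
  (H : HurwitzSuperalgebra k C)

/-- The product of `3 × 3` matrices over `C`. -/
def matMul : Matrix (Fin 3) (Fin 3) C →ₗ[k] Matrix (Fin 3) (Fin 3) C →ₗ[k]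
    Matrix (Fin 3) (Fin 3) C :=
  LinearMap.mk₂ k (fun M N => Matrix.of fun i j => ∑ l, H.mul (M i l) (N l j))
    (fun _ _ _ => by ext; simp [Finset.sum_add_distrib])
    (fun _ _ _ => by ext; simp [Finset.smul_sum])
    (fun _ _ _ => by ext; simp [Finset.sum_add_distrib])
    (fun _ _ _ => by ext; simp [Finset.smul_sum])

/-- The symmetrized product `x ∘ y = ½ (x y + (-1) ^ (x y) y x)` of matrices. -/
def symMul : Matrix (Fin 3) (Fin 3) C →ₗ[k] Matrix (Fin 3) (Fin 3) C →ₗ[k]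
    Matrix (Fin 3) (Fin 3) C :=
  (1 / 2 : k) • (H.matMul + superflip H.matMul)

/-- The space `H₃(C)` of hermitian matrices: those with `(a_{ij}) = (ā_{ji})`. -/
def herm : Submodule k (Matrix (Fin 3) (Fin 3) C) where
  carrier := {M | M = Matrix.of fun i j => H.bar (M j i)}
  zero_mem' := by ext; simp
  add_mem' := fun {M N} hM hN => by
    ext i j
    have h1 := congrFun (congrFun hM i) j
    have h2 := congrFun (congrFun hN i) j
    simp only [Matrix.of_apply, Matrix.add_apply, map_add] at *
    rw [← h1, ← h2]
  smul_mem' := fun c M hM => by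
    ext i j
    have h1 := congrFun (congrFun hM i) j
    simp only [Matrix.of_apply, Matrix.smul_apply, map_smul] at *
    rw [← h1]

theorem mem_herm {M : Matrix (Fin 3) (Fin 3) C} :
    M ∈ H.herm ↔ ∀ i j, M i j = H.bar (M j i) :=
  ⟨fun h i j => congrFun (congrFun h i) j, fun h => by ext i j; exact h i j⟩

theorem pr_bar (p : ZMod 2) (x : C) : pr k p (H.bar x) = H.bar (pr k p x) := by
  refine hom_induction (k := k) (P := fun x => pr k p (H.bar x) = H.bar (pr k p x)) ?_ ?_ x
  · intro u v hu hv
    simp only [map_add, hu, hv]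
  · intro q x hx
    rw [pr_of_mem hx, pr_of_mem (H.bar_mem hx)]
    split_ifs <;> simp

theorem pr_herm (p : ZMod 2) (M : Matrix (Fin 3) (Fin 3) C) (hM : M ∈ H.herm) :
    pr k p M ∈ H.herm := by
  rw [mem_herm] at *
  intro i j
  change pr k p (M i j) = H.bar (pr k p (M j i))
  rw [← pr_bar, ← hM i j]

theorem bar_mul_flip (x y : C) : H.bar (H.mul x y) = superflip H.mul (H.bar x) (H.bar y) := by
  refine hom_induction (k := k)
    (P := fun x => H.bar (H.mul x y) = superflip H.mul (H.bar x) (H.bar y)) ?_ ?_ x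
  · intro u v hu hv
    simp only [map_add, LinearMap.add_apply, hu, hv]
  intro p x hx
  refine hom_induction (k := k)
    (P := fun y => H.bar (H.mul x y) = superflip H.mul (H.bar x) (H.bar y)) ?_ ?_ y
  · intro u v hu hv
    simp only [map_add, hu, hv]
  intro q y hy
  rw [H.bar_mul hx hy, superflip_hom _ (H.bar_mem hx) (H.bar_mem hy)]

theorem bar_flip_mul (x y : C) : H.bar (superflip H.mul x y) = H.mul (H.bar x) (H.bar y) := by
  rw [← H.bar_bar (H.mul (H.bar x) (H.bar y)), bar_mul_flip, bar_bar, bar_bar]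

theorem superflip_matMul_apply (M N : Matrix (Fin 3) (Fin 3) C) (i j : Fin 3) :
    superflip H.matMul M N i j = ∑ l, superflip H.mul (M l j) (N i l) := by
  simp only [superflip, twist₂, LinearMap.sum_apply, LinearMap.smul_apply, LinearMap.compl₁₂_apply,
    LinearMap.flip_apply, Matrix.sum_apply, Matrix.smul_apply]
  rw [Finset.sum_comm]
  simp only [sum_parity, Fin.sum_univ_three]
  simp only [matMul, LinearMap.mk₂_apply, Matrix.of_apply, Fin.sum_univ_three]
  change _ • (H.mul (pr k 0 (N i 0)) (pr k 0 (M 0 j)) + H.mul (pr k 0 (N i 1)) (pr k 0 (M 1 j)) +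
      H.mul (pr k 0 (N i 2)) (pr k 0 (M 2 j))) +
    _ • (H.mul (pr k 0 (N i 0)) (pr k 1 (M 0 j)) + H.mul (pr k 0 (N i 1)) (pr k 1 (M 1 j)) +
      H.mul (pr k 0 (N i 2)) (pr k 1 (M 2 j))) +
    (_ • (H.mul (pr k 1 (N i 0)) (pr k 0 (M 0 j)) + H.mul (pr k 1 (N i 1)) (pr k 0 (M 1 j)) +
      H.mul (pr k 1 (N i 2)) (pr k 0 (M 2 j))) +
    _ • (H.mul (pr k 1 (N i 0)) (pr k 1 (M 0 j)) + H.mul (pr k 1 (N i 1)) (pr k 1 (M 1 j)) +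
      H.mul (pr k 1 (N i 2)) (pr k 1 (M 2 j)))) = _
  module

theorem symMul_mem {M N : Matrix (Fin 3) (Fin 3) C} (hM : M ∈ H.herm) (hN : N ∈ H.herm) :
    H.symMul M N ∈ H.herm := by
  rw [mem_herm] at *
  intro i j
  simp only [symMul, LinearMap.smul_apply, LinearMap.add_apply, Matrix.smul_apply,
    Matrix.add_apply, superflip_matMul_apply, map_smul, map_add, map_sum, bar_flip_mul]
  congr 1
  simp only [matMul, LinearMap.mk₂_apply, Matrix.of_apply, map_sum, bar_mul_flip]
  rw [add_comm]
  congr 1 <;> refine Finset.sum_congr rfl fun l _ => ?_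
  · rw [← hM l j, ← hN i l]
  · rw [← hM i l, ← hN l j]

instance : Superspace k H.herm := superSubmodule H.herm H.pr_herm

/-- The Jordan superalgebra `J = H₃(C)`. -/
def J : Type _ := H.herm

instance : AddCommGroup H.J := inferInstanceAs (AddCommGroup H.herm)

instance : Module k H.J := inferInstanceAs (Module k H.herm)

instance : Superspace k H.J := inferInstanceAs (Superspace k H.herm)

/-- The matrix underlying an element of `J`. -/
def toMat : H.J →ₗ[k] Matrix (Fin 3) (Fin 3) C := H.herm.subtype

/-- The element of `J` given by a hermitian matrix. -/
def ofMat (M : Matrix (Fin 3) (Fin 3) C) (hM : M ∈ H.herm) : H.J := ⟨M, hM⟩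

theorem toMat_ofMat (M : Matrix (Fin 3) (Fin 3) C) (hM : M ∈ H.herm) :
    H.toMat (H.ofMat M hM) = M := rfl

theorem toMat_injective : Function.Injective H.toMat := Subtype.val_injective

/-- The product of `J`. As a map `J → End(J)` this is `x ↦ L_x`. -/
def jmul : H.J →ₗ[k] Module.End k H.J :=
  LinearMap.mk₂ k
    (fun x y => H.ofMat (H.symMul (H.toMat x) (H.toMat y)) (H.symMul_mem x.2 y.2))
    (fun _ _ _ => H.toMat_injective (by simp [toMat_ofMat]))
    (fun _ _ _ => H.toMat_injective (by simp [toMat_ofMat]))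
    (fun _ _ _ => H.toMat_injective (by simp [toMat_ofMat]))
    (fun _ _ _ => H.toMat_injective (by simp [toMat_ofMat]))

/-- The diagonal idempotents `e_i`. -/
def e (i : Fin 3) : H.J := H.ofMat (Matrix.single i i H.one) (by
  rw [mem_herm]
  intro a b
  by_cases h : i = a ∧ i = b
  · obtain ⟨rfl, rfl⟩ := h
    simp [bar_one]
  · rw [Matrix.single_apply_of_ne _ _ _ _ _ h,
      Matrix.single_apply_of_ne _ _ _ _ _ (fun h' => h h'.symm), map_zero])

/-- The hermitian matrices `ι_i(a)`, with entries `2 a` at `(i + 2, i + 1)` and `2 ā` at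
`(i + 1, i + 2)`. -/
def ιJ (i : Fin 3) : C →ₗ[k] H.J where
  toFun a := H.ofMat
    ((2 : k) • (Matrix.single (i + 2) (i + 1) a + Matrix.single (i + 1) (i + 2) (H.bar a))) (by
      refine Submodule.smul_mem _ _ ?_
      rw [mem_herm]
      intro x y
      fin_cases i <;> fin_cases x <;> fin_cases y <;>
        simp [H.bar_bar])
  map_add' a a' := by
    apply H.toMat_injective
    simp only [map_add, toMat_ofMat, Matrix.single_add]
    module
  map_smul' c a := by
    apply H.toMat_injective
    simp only [map_smul, toMat_ofMat, ← Matrix.smul_single, RingHom.id_apply]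
    module

/-! ### Derivations, the structure Lie superalgebra and its projective version -/

/-- The Lie superalgebra `der J`. -/
abbrev derJ : Submodule k (Module.End k H.J) := der H.jmul

/-- The inner derivations `D_i(a) = 2 [L_{ι_i(a)}, L_{e_{i+1}}]`. -/
def D (i : Fin 3) (a : C) : Module.End k H.J :=
  (2 : k) • glBracket k H.J (H.jmul (H.ιJ i a)) (H.jmul (H.e (i + 1)))

/-- The endomorphism `D_{(d₀,d₁,d₂)}` of `J` with `e_i ↦ 0` and `ι_i(a) ↦ ι_i(d_i(a))`. -/
def Dtri (d : Fin 3 → Module.End k C) : Module.End k H.J where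
  toFun x := ∑ i, H.ιJ i (d i ((1 / 2 : k) • H.toMat x (i + 2) (i + 1)))
  map_add' x y := by
    simp [smul_add, Finset.sum_add_distrib]
  map_smul' c x := by
    simp [Finset.smul_sum, smul_comm c]

/-- The structure Lie superalgebra `str J`: the smallest graded subspace of `gl(J)` that contains
`der J` and `L_J` and is closed under the bracket. -/
def str : Submodule k (Module.End k H.J) :=
  sInf {N | (∀ p, ∀ f ∈ N, pr k p f ∈ N) ∧ (∀ f ∈ N, ∀ g ∈ N, glBracket k H.J f g ∈ N) ∧
    H.derJ ≤ N ∧ LinearMap.range H.jmul ≤ N}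

theorem pr_str (p : ZMod 2) (f : Module.End k H.J) (hf : f ∈ H.str) : pr k p f ∈ H.str := by
  rw [str, Submodule.mem_sInf] at *
  exact fun N hN => hN.1 p f (hf N hN)

theorem str_closed : ∀ f ∈ H.str, ∀ g ∈ H.str, glBracket k H.J f g ∈ H.str := by
  intro f hf g hg
  rw [str, Submodule.mem_sInf] at *
  exact fun N hN => hN.2.1 f (hf N hN) g (hg N hN)

instance : Superspace k H.str := superSubmodule H.str H.pr_str

/-- The bracket of `str J`. -/
def strBracket : H.str →ₗ[k] H.str →ₗ[k] H.str :=
  subBracket (glBracket k H.J) H.str H.str_closed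

/-- The subspace `k I` of `str J`, where `I` is the identity map of `J`. -/
def scalars : Submodule k H.str := (Submodule.span k {(1 : Module.End k H.J)}).comap H.str.subtype

theorem one_mem_part {V : Type*} [AddCommGroup V] [Module k V] [Superspace k V] :
    (1 : Module.End k V) ∈ part k (Module.End k V) 0 :=
  mem_part_hom.2 fun q x hx => by rwa [zero_add]

theorem glBracket_one_left {V : Type*} [AddCommGroup V] [Module k V] [Superspace k V]
    (f : Module.End k V) : glBracket k V 1 f = 0 := by
  refine hom_induction (k := k) (P := fun f => glBracket k V 1 f = 0) ?_ ?_ f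
  · intro u v hu hv; rw [map_add, hu, hv, add_zero]
  · intro p f hf
    rw [glBracket_hom one_mem_part hf, zero_mul, sg_zero]; simp

theorem glBracket_one_right {V : Type*} [AddCommGroup V] [Module k V] [Superspace k V]
    (f : Module.End k V) : glBracket k V f 1 = 0 := by
  refine hom_induction (k := k) (P := fun f => glBracket k V f 1 = 0) ?_ ?_ f
  · intro u v hu hv; rw [map_add, LinearMap.add_apply, hu, hv, add_zero]
  · intro p f hf
    rw [glBracket_hom hf one_mem_part, mul_zero, sg_zero]; simp

theorem mem_scalars {x : H.str} : x ∈ H.scalars ↔ ∃ c : k, c • (1 : Module.End k H.J) = x := by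
  rw [scalars, Submodule.mem_comap, Submodule.mem_span_singleton]; rfl

theorem pr_scalars (p : ZMod 2) (x : H.str) (hx : x ∈ H.scalars) : pr k p x ∈ H.scalars := by
  obtain ⟨c, hc⟩ := H.mem_scalars.1 hx
  rw [mem_scalars]
  change ∃ c : k, c • (1 : Module.End k H.J) = pr k p (x : Module.End k H.J)
  rw [← hc, map_smul, pr_of_mem one_mem_part]
  split_ifs
  · exact ⟨c, rfl⟩
  · exact ⟨0, by simp⟩

/-- The projective structure Lie superalgebra `pstr J = str J / k I`. -/
abbrev pstr : Type _ := H.str ⧸ H.scalars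

instance : Superspace k H.pstr := superQuotient H.scalars H.pr_scalars

theorem strBracket_scalars_right (x n : H.str) (hn : n ∈ H.scalars) :
    H.strBracket x n ∈ H.scalars := by
  obtain ⟨c, hc⟩ := H.mem_scalars.1 hn
  rw [mem_scalars]
  refine ⟨0, ?_⟩
  change _ = glBracket k H.J x n
  rw [← hc, map_smul, glBracket_one_right]; simp

theorem strBracket_scalars_left (n : H.str) (hn : n ∈ H.scalars) (x : H.str) :
    H.strBracket n x ∈ H.scalars := by
  obtain ⟨c, hc⟩ := H.mem_scalars.1 hn
  rw [mem_scalars]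
  refine ⟨0, ?_⟩
  change _ = glBracket k H.J n x
  rw [← hc, map_smul, LinearMap.smul_apply, glBracket_one_left]; simp

/-- The bracket of `pstr J`. -/
def pstrBracket : H.pstr →ₗ[k] H.pstr →ₗ[k] H.pstr :=
  quotBracket H.strBracket H.scalars H.strBracket_scalars_right H.strBracket_scalars_left

/-- `ξ` is the class `f + k I` in `pstr J` of the endomorphism `f` of `J` (and `f ∈ str J`). -/
def IsClass (f : Module.End k H.J) (ξ : H.pstr) : Prop :=
  ∃ hf : f ∈ H.str, ξ = Submodule.Quotient.mk ⟨f, hf⟩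

end Jordan

end HurwitzSuperalgebra

/-! ### The elements and maps in the statement -/

section Maps

variable (k : Type*) [Field k] [NeZero (2 : k)]

/-- The endomorphism `σ = ½ σ_{1,u}` of `S₂`. -/
def sigmaS₂ : Module.End k (k × k) := (1 / 2 : k) • (S₂ k).σ 1 (uElt k)

variable {k} {V : Type*} [AddCommGroup V] [Module k V] [Superspace k V]

/-- The inclusion `g(S₁, S) → g(S₂, S)` given by `S₁ = k 1 ⊆ S₂`. (As `tri(S₁) = 0`, the first
component carries no information.) -/
def inclusion (S : SymmetricCompositionSuperalgebra k V) (x : (S₁ k).G S) : (S₂ k).G S :=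
  (S₂ k).mkG S 0 ((S₁ k).prTriR S x) fun i =>
    LinearMap.rTensor V (LinearMap.toSpanSingleton k (k × k) 1) ((S₁ k).prι S i x)

end Maps

end Supermagic

end

open Supermagic
open scoped TensorProduct

/-! Relative to `e_0, e_1, e_2` the Peirce decomposition of `J` is `⊕ k e_i ⊕ ⊕ ι_i(C)`, and the
multiplication table sees `C` only through `S`: `ι_i(x) ∘ ι_{i+1}(y) = ι_{i+2}(x • y)` and `ι_i(x) ∘
ι_i(y) = 2 b(x,y) (e_{i+1} + e_{i+2})`. A derivation that kills the idempotents therefore acts on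
each `ι_i(C)` by some `d_i`, and the derivation rule says exactly that `(d_0, d_1, d_2)` lies in
`tri(S)`. An arbitrary derivation moves each `e_j` only into the `ι_l(C)` with `l ≠ j`, and a unique
sum of `D_i(a_i)` does the same. So `der J` is the direct sum of the `D_d`, `d ∈ tri(S)`, and the
three spaces `D_i(C)` (`exists_of_mem_der`, `eq_zero_of_der_eq_zero`). This is the shape of `g(S₁,
S)`, as `tri(S₁) = 0`, and the brackets agree by `D_bracket_self`, `D_bracket_succ`,
`Dtri_bracket_D` and `Dtri_bracket_Dtri`.

The brackets `[L_x, L_y]` are derivations (`L_bracket_mem`), so `der J + L_J` is closed and equals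
`str J`; the sum is direct because derivations kill the unit of `J`. Modulo `k I` the diagonal
multiplications form a plane, matched with `tri(S₂)`, while `1 ⊗ a` and `u ⊗ a` in the `i`-th
summand correspond to `D_i(a)` and `L_{ι_i(a)}`. The resulting linear map `toStr` into `gl(J)`
respects brackets only up to `k I` (`toStr_bracket`), which is enough for the quotient.

The Jacobi identity is never checked on `g(S₁, S)` or `g(S₂, S)`. It holds in `gl(J)`, passes to the
subalgebra `der J` and the subquotient `pstr J`, and is pulled back along the two bijections.
Compatibility with brackets is tested on generators (`bracket_mem_of_generators`); since `S₁` and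
`S₂` are purely even, the signs in the definition of `g` become trivial on pure tensors. What
remains are identities between operators on `J`, evaluated on `e_j` and `ι_j(c)`. They reduce to the
super-linearizations of `(x • y) • x = q(x) y = x • (y • x)` and to associativity of `b`. -/

noncomputable section

namespace Supermagic

/-! ### Complements on superspaces and Lie superalgebras -/

section General

variable {k V W : Type*} [Field k] [AddCommGroup V] [Module k V] [Superspace k V]
  [AddCommGroup W] [Module k W] [Superspace k W]

/-- A linear map that respects the homogeneous components commutes with the projections. -/
theorem pr_map_of_even {f : V →ₗ[k] W} (h : ∀ p, ∀ x ∈ part k V p, f x ∈ part k W p)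
    (p : ZMod 2) (x : V) : pr k p (f x) = f (pr k p x) := by
  refine hom_induction (k := k) (P := fun x => pr k p (f x) = f (pr k p x)) ?_ ?_ x
  · intro u v hu hv
    simp only [map_add, hu, hv]
  · intro q x hx
    rw [pr_of_mem hx, pr_of_mem (h q x hx)]
    split_ifs <;> simp

theorem map_mem_part_of_pr {f : V →ₗ[k] W} (h : ∀ p x, pr k p (f x) = f (pr k p x))
    {p : ZMod 2} {x : V} (hx : x ∈ part k V p) : f x ∈ part k W p := by
  rw [mem_part] at *
  rw [h, hx]

theorem glBracket_even_right {f g : Module.End k V} (hg : g ∈ part k (Module.End k V) 0) :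
    glBracket k V f g = f * g - g * f := by
  refine hom_induction (k := k) (P := fun f => glBracket k V f g = f * g - g * f) ?_ ?_ f
  · intro u v hu hv
    rw [map_add, LinearMap.add_apply, hu, hv, add_mul, mul_add]; abel
  · intro p f hf
    rw [glBracket_hom hf hg, mul_zero, sg_zero, one_smul]

theorem glBracket_skew {p q : ZMod 2} {f g : Module.End k V}
    (hf : f ∈ part k (Module.End k V) p) (hg : g ∈ part k (Module.End k V) q) :
    glBracket k V f g = -(sg k (p * q) • glBracket k V g f) := by
  rw [glBracket_hom hf hg, glBracket_hom hg hf, mul_comm q p]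
  rcases sg_cases k (p * q) with h | h <;> simp only [h] <;> module

theorem glBracket_jacobi {p q : ZMod 2} {f g : Module.End k V} (h : Module.End k V)
    (hf : f ∈ part k (Module.End k V) p) (hg : g ∈ part k (Module.End k V) q) :
    glBracket k V f (glBracket k V g h) = glBracket k V (glBracket k V f g) h +
      sg k (p * q) • glBracket k V g (glBracket k V f h) := by
  refine hom_induction (k := k) (P := fun h => glBracket k V f (glBracket k V g h) =
    glBracket k V (glBracket k V f g) h + sg k (p * q) • glBracket k V g (glBracket k V f h))
    ?_ ?_ h
  · intro u v hu hv
    simp only [map_add, hu, hv, smul_add]; abel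
  · intro r h hh
    rw [glBracket_hom hf (glBracket_mem_part hg hh), glBracket_hom hg hh,
      glBracket_hom (glBracket_mem_part hf hg) hh, glBracket_hom hf hg,
      glBracket_hom hg (glBracket_mem_part hf hh), glBracket_hom hf hh]
    simp only [add_mul, mul_add, sg_add, mul_comm q p, mul_sub, sub_mul, mul_smul_comm,
      smul_mul_assoc, mul_assoc]
    rcases sg_cases k (p * q) with h1 | h1 <;> rcases sg_cases k (p * r) with h2 | h2 <;>
      rcases sg_cases k (q * r) with h3 | h3 <;> simp only [h1, h2, h3] <;> module

theorem isLieSuperalgebra_gl : IsLieSuperalgebra (glBracket k V) where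
  graded _ _ _ _ hx hy := glBracket_mem_part hx hy
  skew _ _ _ _ hx hy := glBracket_skew hx hy
  jacobi _ _ _ _ z hx hy := glBracket_jacobi z hx hy
  -- For odd `x` the bracket `[x, x]` is `2 x²`, which is even, so the outer bracket is an ordinary
  -- commutator of `x` with `2 x²`. This argument covers characteristic three as well.
  cube x hx := by
    have h := glBracket_mem_part hx hx
    rw [glBracket_hom hx h, glBracket_hom hx hx]
    simp [sg_one, mul_add, add_mul, mul_assoc, sg_zero, show (1 + 1 : ZMod 2) = 0 from rfl]

theorem isLieSuperalgebra_subBracket {L : Type*} [AddCommGroup L] [Module k L] [Superspace k L]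
    {br : L →ₗ[k] L →ₗ[k] L} (hbr : IsLieSuperalgebra br) (N : Submodule k L)
    (hN : ∀ p, ∀ x ∈ N, pr k p x ∈ N) (h : ∀ x ∈ N, ∀ y ∈ N, br x y ∈ N) :
    @IsLieSuperalgebra k _ N _ _ (superSubmodule N hN) (subBracket br N h) := by
  let _ := superSubmodule N hN
  have hp : ∀ {p : ZMod 2} {x : N}, x ∈ part k N p ↔ (x : L) ∈ part k L p := fun {p x} => by
    rw [mem_part, mem_part, Subtype.ext_iff]; rfl
  constructor
  · intro p q x y hx hy
    exact hp.2 (hbr.graded p q x y (hp.1 hx) (hp.1 hy))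
  · intro p q x y hx hy
    exact Subtype.ext (hbr.skew p q x y (hp.1 hx) (hp.1 hy))
  · intro p q x y z hx hy
    exact Subtype.ext (hbr.jacobi p q x y z (hp.1 hx) (hp.1 hy))
  · intro x hx
    exact Subtype.ext (hbr.cube x (hp.1 hx))

theorem isLieSuperalgebra_quotBracket {L : Type*} [AddCommGroup L] [Module k L] [Superspace k L]
    {br : L →ₗ[k] L →ₗ[k] L} (hbr : IsLieSuperalgebra br) (N : Submodule k L)
    (hN : ∀ p, ∀ x ∈ N, pr k p x ∈ N) (h : ∀ x, ∀ n ∈ N, br x n ∈ N)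
    (h' : ∀ n ∈ N, ∀ x, br n x ∈ N) :
    @IsLieSuperalgebra k _ (L ⧸ N) _ _ (superQuotient N hN) (quotBracket br N h h') := by
  let _ := superQuotient N hN
  -- A homogeneous class has a homogeneous representative: the component of parity `p` of any
  -- representative.
  have hp : ∀ {p : ZMod 2} {x : L ⧸ N}, x ∈ part k (L ⧸ N) p →
      ∃ y ∈ part k L p, N.mkQ y = x := fun {p x} hx => by
    obtain ⟨y, rfl⟩ := N.mkQ_surjective x
    exact ⟨pr k p y, pr_mem _ _, hx⟩
  have hb : ∀ x y, quotBracket br N h h' (N.mkQ x) (N.mkQ y) = N.mkQ (br x y) := fun _ _ => rfl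
  constructor
  · intro p q x y hx hy
    obtain ⟨x, hx', rfl⟩ := hp hx
    obtain ⟨y, hy', rfl⟩ := hp hy
    rw [hb]
    exact congrArg N.mkQ (hbr.graded p q x y hx' hy')
  · intro p q x y hx hy
    obtain ⟨x, hx', rfl⟩ := hp hx
    obtain ⟨y, hy', rfl⟩ := hp hy
    rw [hb, hb, hbr.skew p q x y hx' hy', map_neg, map_smul]
  · intro p q x y z hx hy
    obtain ⟨x, hx', rfl⟩ := hp hx
    obtain ⟨y, hy', rfl⟩ := hp hy
    obtain ⟨z, rfl⟩ := N.mkQ_surjective z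
    simp only [hb]
    rw [hbr.jacobi p q x y z hx' hy', map_add, map_smul]
  · intro x hx
    obtain ⟨x, hx', rfl⟩ := hp hx
    simp only [hb]
    rw [hbr.cube x hx', map_zero]

/-- The axioms of a Lie superalgebra pull back along an isomorphism. -/
theorem LieSuperIso.isLieSuperalgebra {L L' : Type*} [AddCommGroup L] [Module k L]
    [Superspace k L] [AddCommGroup L'] [Module k L'] [Superspace k L']
    {br : L →ₗ[k] L →ₗ[k] L} {br' : L' →ₗ[k] L' →ₗ[k] L'} (Φ : LieSuperIso br br')
    (h : IsLieSuperalgebra br') : IsLieSuperalgebra br := by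
  have hb : ∀ x y, Φ.toLinearEquiv (br x y) = br' (Φ.toLinearEquiv x) (Φ.toLinearEquiv y) :=
    Φ.map_bracket
  have hp : ∀ p x, x ∈ part k L p → Φ.toLinearEquiv x ∈ part k L' p := Φ.map_part
  -- An even bijection also reflects parity, because it commutes with the projections.
  have hp' : ∀ p x, Φ.toLinearEquiv x ∈ part k L' p → x ∈ part k L p := fun p x hx => by
    rw [mem_part] at *
    apply Φ.toLinearEquiv.injective
    rw [← hx]
    exact (pr_map_of_even (f := Φ.toLinearEquiv.toLinearMap) hp p x).symm
  constructor
  · intro p q x y hx hy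
    apply hp'
    rw [hb]
    exact h.graded p q _ _ (hp _ _ hx) (hp _ _ hy)
  · intro p q x y hx hy
    apply Φ.toLinearEquiv.injective
    rw [map_neg, map_smul, hb, hb]
    exact h.skew p q _ _ (hp _ _ hx) (hp _ _ hy)
  · intro p q x y z hx hy
    apply Φ.toLinearEquiv.injective
    simp only [map_add, map_smul, hb]
    exact h.jacobi p q _ _ _ (hp _ _ hx) (hp _ _ hy)
  · intro x hx
    apply Φ.toLinearEquiv.injective
    simp only [map_zero, hb]
    exact h.cube _ (hp _ _ hx)

/-- A homogeneous map is a derivation as soon as `[d, L_x] = L_{d x}`. -/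
theorem mem_derPart_of_glBracket {m : V →ₗ[k] V →ₗ[k] V}
    (hm : ∀ p, ∀ x ∈ part k V p, m x ∈ part k (Module.End k V) p) {p : ZMod 2}
    {d : Module.End k V} (hd : d ∈ part k (Module.End k V) p)
    (h : ∀ x, glBracket k V d (m x) = m (d x)) : d ∈ derPart m p := by
  refine ⟨hd, fun q x y hx => ?_⟩
  have h1 := congrArg (fun f => f y) (h x)
  simp only [glBracket_hom hd (hm q x hx), LinearMap.sub_apply, Module.End.mul_apply,
    LinearMap.smul_apply] at h1
  rw [← h1]; abel

/-- In this form the derivation rule carries no sign and is linear in `d` and in `x`, so neither has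
to be homogeneous. With the preceding converse it replaces all computations with derivations by
computations in `gl(V)`. -/
theorem glBracket_of_mem_der {m : V →ₗ[k] V →ₗ[k] V}
    (hm : ∀ p, ∀ x ∈ part k V p, m x ∈ part k (Module.End k V) p)
    {d : Module.End k V} (hd : d ∈ der m) (x : V) : glBracket k V d (m x) = m (d x) := by
  have key : ∀ p, ∀ d ∈ derPart m p, glBracket k V d (m x) = m (d x) := by
    intro p d hd
    refine hom_induction (k := k) (P := fun x => glBracket k V d (m x) = m (d x)) ?_ ?_ x
    · intro u v hu hv
      simp only [map_add, hu, hv]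
    · intro q x hx
      ext y
      rw [glBracket_hom hd.1 (hm q x hx)]
      simp only [LinearMap.sub_apply, Module.End.mul_apply, LinearMap.smul_apply]
      rw [hd.2 q x y hx]; abel
  rw [← pr_add (k := k) d, map_add, LinearMap.add_apply, LinearMap.add_apply, map_add,
    key 0 _ (mem_der.1 hd 0), key 1 _ (mem_der.1 hd 1)]

theorem pr_mem_der {m : V →ₗ[k] V →ₗ[k] V} {d : Module.End k V} (hd : d ∈ der m) (p : ZMod 2) :
    pr k p d ∈ der m := derPart_le m p (mem_der.1 hd p)

end General

end Supermagic
end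

noncomputable section

namespace Supermagic

/-! ### Indices modulo three -/

section Indices

theorem fin3_one_one (i : Fin 3) : i + 1 + 1 = i + 2 := by revert i; decide
theorem fin3_one_two (i : Fin 3) : i + 1 + 2 = i := by revert i; decide
theorem fin3_two_one (i : Fin 3) : i + 2 + 1 = i := by revert i; decide
theorem fin3_two_two (i : Fin 3) : i + 2 + 2 = i + 1 := by revert i; decide
theorem fin3_ne_one (i : Fin 3) : i ≠ i + 1 := by revert i; decide
theorem fin3_ne_two (i : Fin 3) : i ≠ i + 2 := by revert i; decide
theorem fin3_one_ne_two (i : Fin 3) : i + 1 ≠ i + 2 := by revert i; decide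

/-- Counting indices from a fixed `i` uses the cyclic symmetry of the construction: one argument in
`i, i + 1, i + 2` serves for all `i`. -/
theorem fin3_forall {P : Fin 3 → Prop} (i : Fin 3) (h0 : P i) (h1 : P (i + 1)) (h2 : P (i + 2))
    (j : Fin 3) : P j := by
  have : j = i ∨ j = i + 1 ∨ j = i + 2 := by
    clear h0 h1 h2; revert i j; decide
  rcases this with rfl | rfl | rfl <;> assumption

theorem fin3_sum {M : Type*} [AddCommMonoid M] (f : Fin 3 → M) (i : Fin 3) :
    ∑ j, f j = f i + f (i + 1) + f (i + 2) := by
  rw [Fin.sum_univ_three]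
  fin_cases i
  · rfl
  · exact (by abel : f 0 + f 1 + f 2 = f 1 + f 2 + f 0)
  · exact (by abel : f 0 + f 1 + f 2 = f 2 + f 0 + f 1)

end Indices

/-! ### The multiplication table of `H₃(C)` -/

namespace HurwitzSuperalgebra

variable {k C : Type*} [Field k] [AddCommGroup C] [Module k C] [Superspace k C]
  (H : HurwitzSuperalgebra k C)

theorem superflip_one_left (x : C) : superflip H.mul H.one x = x := by
  refine hom_induction (k := k) (P := fun x => superflip H.mul H.one x = x) ?_ ?_ x
  · intro u v hu hv; rw [map_add, hu, hv]
  · intro p x hx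
    rw [superflip_hom _ H.one_mem hx, zero_mul, sg_zero, one_smul, H.mul_one]

theorem superflip_one_right (x : C) : superflip H.mul x H.one = x := by
  refine hom_induction (k := k) (P := fun x => superflip H.mul x H.one = x) ?_ ?_ x
  · intro u v hu hv; rw [map_add, LinearMap.add_apply, hu, hv]
  · intro p x hx
    rw [superflip_hom _ hx H.one_mem, mul_zero, sg_zero, one_smul, H.one_mul]

theorem b_mul_bar_one (x y : C) : H.b (H.mul x (H.bar y)) H.one = H.b x y := by
  refine hom_induction (k := k) (P := fun x => H.b (H.mul x (H.bar y)) H.one = H.b x y) ?_ ?_ x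
  · intro u v hu hv; simp only [map_add, LinearMap.add_apply, hu, hv]
  intro p x hx
  refine hom_induction (k := k) (P := fun y => H.b (H.mul x (H.bar y)) H.one = H.b x y) ?_ ?_ y
  · intro u v hu hv; simp only [map_add, LinearMap.add_apply, hu, hv]
  intro q y hy
  rw [H.b_mul_right_adj hx (H.bar_mem hy) H.one_mem, mul_zero, sg_zero, H.one_mul, H.bar_bar,
    _root_.one_mul]

theorem b_bar_mul_one (x y : C) : H.b (H.mul (H.bar x) y) H.one = H.b x y := by
  have h := H.b_mul_bar_one (H.bar x) (H.bar y)
  rwa [H.bar_bar, H.b_bar_bar] at h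

theorem add_bar (x : C) : x + H.bar x = H.b x H.one • H.one := by
  rw [H.bar_apply]; abel

/-- The second term is the conjugate of the first, so the sum is the trace of `x ȳ`, and this trace
is `b(x, y)` by adjointness. This identity and the next one give the two diagonal entries of `ι_i(x)
∘ ι_i(y)`. -/
theorem mul_bar_add_flip (x y : C) :
    H.mul x (H.bar y) + superflip H.mul (H.bar x) y = H.b x y • H.one := by
  have h := H.bar_mul_flip x (H.bar y)
  rw [H.bar_bar] at h
  rw [← h, add_bar, b_mul_bar_one]

theorem bar_mul_add_flip (x y : C) :
    H.mul (H.bar x) y + superflip H.mul x (H.bar y) = H.b x y • H.one := by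
  have h := H.bar_mul_flip (H.bar x) y
  rw [H.bar_bar] at h
  rw [← h, add_bar, b_bar_mul_one]

theorem toMat_jmul (x y : H.J) (i j : Fin 3) : H.toMat (H.jmul x y) i j =
    (1 / 2 : k) • (∑ l, H.mul (H.toMat x i l) (H.toMat y l j) +
      ∑ l, superflip H.mul (H.toMat x l j) (H.toMat y i l)) := by
  rw [← superflip_matMul_apply]
  rfl

theorem toMat_e (i : Fin 3) : H.toMat (H.e i) = Matrix.single i i H.one := rfl

theorem toMat_ιJ (i : Fin 3) (a : C) : H.toMat (H.ιJ i a) =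
    (2 : k) • (Matrix.single (i + 2) (i + 1) a + Matrix.single (i + 1) (i + 2) (H.bar a)) := rfl

theorem jmul_e_e [NeZero (2 : k)] (i j : Fin 3) :
    H.jmul (H.e i) (H.e j) = if i = j then H.e i else 0 := by
  have h2 : (2 : k) ≠ 0 := NeZero.ne 2
  have h : (1 / 2 : k) • (H.one + H.one) = H.one := by
    rw [← two_smul k, smul_smul, one_div, inv_mul_cancel₀ h2, one_smul]
  apply H.toMat_injective
  ext a b
  rw [toMat_jmul, apply_ite H.toMat]
  fin_cases i <;> fin_cases j <;> fin_cases a <;> fin_cases b <;>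
    simp [Fin.sum_univ_three, toMat_e, H.one_mul, superflip_one_left, Matrix.single,
      show (2⁻¹ : k) • H.one + (2⁻¹ : k) • H.one = H.one by simpa using h]

theorem jmul_e_ι [NeZero (2 : k)] (i j : Fin 3) (x : C) :
    H.jmul (H.e i) (H.ιJ j x) = if i = j then 0 else (1 / 2 : k) • H.ιJ j x := by
  apply H.toMat_injective
  ext a b
  rw [toMat_jmul, apply_ite H.toMat]
  fin_cases i <;> fin_cases j <;> fin_cases a <;> fin_cases b <;>
    simp [Fin.sum_univ_three, toMat_e, toMat_ιJ, H.one_mul, superflip_one_left, Matrix.single]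

theorem jmul_ι_e [NeZero (2 : k)] (i j : Fin 3) (x : C) :
    H.jmul (H.ιJ j x) (H.e i) = if i = j then 0 else (1 / 2 : k) • H.ιJ j x := by
  apply H.toMat_injective
  ext a b
  rw [toMat_jmul, apply_ite H.toMat]
  fin_cases i <;> fin_cases j <;> fin_cases a <;> fin_cases b <;>
    simp [Fin.sum_univ_three, toMat_e, toMat_ιJ, H.mul_one, superflip_one_right, Matrix.single]

theorem jmul_ι_self [NeZero (2 : k)] (i : Fin 3) (x y : C) :
    H.jmul (H.ιJ i x) (H.ιJ i y) = (2 * H.b x y) • (H.e (i + 1) + H.e (i + 2)) := by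
  have h2 : (2 : k) ≠ 0 := NeZero.ne 2
  apply H.toMat_injective
  ext a b
  rw [toMat_jmul]
  have h3 := H.mul_bar_add_flip x y
  have h4 := H.bar_mul_add_flip x y
  fin_cases i <;> fin_cases a <;> fin_cases b <;>
    simp [Fin.sum_univ_three, toMat_e, toMat_ιJ, Matrix.single, h2] <;>
    first
    | linear_combination (norm := module) (2 : k) • h3
    | linear_combination (norm := module) (2 : k) • h4

/-- The para-Hurwitz product enters here. The only path from row `i + 1` to column `i` passes
through `i + 2` and contributes `½ · 2x̄ · 2ȳ = 2 (x • y)`; the factor `2` in `ι_i` is what makes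
the table free of constants. The transposed entry is the conjugate. -/
theorem jmul_ι_succ [NeZero (2 : k)] (i : Fin 3) (x y : C) :
    H.jmul (H.ιJ i x) (H.ιJ (i + 1) y) = H.ιJ (i + 2) (H.para.l x y) := by
  have h2 : (2 : k) ≠ 0 := NeZero.ne 2
  have h3 : H.para.l x y = H.mul (H.bar x) (H.bar y) := rfl
  have h4 := H.bar_mul_flip (H.bar x) (H.bar y)
  rw [H.bar_bar, H.bar_bar] at h4
  apply H.toMat_injective
  ext a b
  rw [toMat_jmul]
  fin_cases i <;> fin_cases a <;> fin_cases b <;>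
    simp [Fin.sum_univ_three, toMat_ιJ, Matrix.single, h2, h3, h4]

theorem jmul_ι_pred [NeZero (2 : k)] (i : Fin 3) (x y : C) :
    H.jmul (H.ιJ i x) (H.ιJ (i + 2) y) = H.ιJ (i + 1) (H.para.r x y) := by
  have h2 : (2 : k) ≠ 0 := NeZero.ne 2
  have h4 : H.para.r x y = superflip H.mul (H.bar x) (H.bar y) := by
    refine hom_induction (k := k)
      (P := fun x => H.para.r x y = superflip H.mul (H.bar x) (H.bar y)) ?_ ?_ x
    · intro u v hu hv; simp only [map_add, LinearMap.add_apply, hu, hv]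
    intro p x hx
    refine hom_induction (k := k)
      (P := fun y => H.para.r x y = superflip H.mul (H.bar x) (H.bar y)) ?_ ?_ y
    · intro u v hu hv; simp only [map_add, hu, hv]
    intro q y hy
    rw [H.para.r_apply hx hy, superflip_hom _ (H.bar_mem hx) (H.bar_mem hy)]
    rfl
  have h5 := H.bar_flip_mul (H.bar x) (H.bar y)
  rw [H.bar_bar, H.bar_bar] at h5
  apply H.toMat_injective
  ext a b
  rw [toMat_jmul]
  fin_cases i <;> fin_cases a <;> fin_cases b <;>
    simp [Fin.sum_univ_three, toMat_ιJ, Matrix.single, h2, h4, h5]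

end HurwitzSuperalgebra
end Supermagic
end

noncomputable section

namespace Supermagic

namespace HurwitzSuperalgebra

/-! ### Coordinates on `H₃(C)` -/

variable {k C : Type*} [Field k] [NeZero (2 : k)] [AddCommGroup C] [Module k C] [Superspace k C]
  (H : HurwitzSuperalgebra k C)

/-- The coefficient of `e_i` in an element of `J`. -/
def eCoord (i : Fin 3) : H.J →ₗ[k] k where
  toFun x := (1 / 2 : k) * H.b (H.toMat x i i) H.one
  map_add' x y := by simp [mul_add]
  map_smul' c x := by simp; ring

/-- The element `a` for which `ι_i(a)` is the corresponding component of an element of `J`. -/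
def ιCoord (i : Fin 3) : H.J →ₗ[k] C where
  toFun x := (1 / 2 : k) • H.toMat x (i + 2) (i + 1)
  map_add' x y := by simp
  map_smul' c x := by simp [smul_comm c]

/-- The assumption `C ≠ 0` enters the argument here: without it the `e_i` would vanish and have no
well-defined coefficients. -/
theorem b_one_one [Nontrivial C] : H.b H.one H.one = 2 := by
  obtain ⟨x, hx⟩ := exists_ne (0 : C)
  exact smul_left_injective k hx (H.b_one_one_smul x)

theorem eCoord_e [Nontrivial C] (i j : Fin 3) : H.eCoord i (H.e j) = if i = j then 1 else 0 := by
  have h2 : (2 : k) ≠ 0 := NeZero.ne 2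
  change (1 / 2 : k) * H.b (H.toMat (H.e j) i i) H.one = _
  split_ifs with h
  · subst h
    simp [toMat_e, b_one_one, h2]
  · simp [toMat_e, Ne.symm h]

theorem eCoord_ι (i j : Fin 3) (a : C) : H.eCoord i (H.ιJ j a) = 0 := by
  change (1 / 2 : k) * H.b (H.toMat (H.ιJ j a) i i) H.one = _
  fin_cases i <;> fin_cases j <;> simp [toMat_ιJ]

theorem ιCoord_e (i j : Fin 3) : H.ιCoord i (H.e j) = 0 := by
  change (1 / 2 : k) • H.toMat (H.e j) (i + 2) (i + 1) = _
  fin_cases i <;> fin_cases j <;> simp [toMat_e]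

theorem ιCoord_ι (i j : Fin 3) (a : C) :
    H.ιCoord i (H.ιJ j a) = if i = j then a else 0 := by
  have h2 : (2 : k) ≠ 0 := NeZero.ne 2
  change (1 / 2 : k) • H.toMat (H.ιJ j a) (i + 2) (i + 1) = _
  fin_cases i <;> fin_cases j <;> simp [toMat_ιJ, h2]

/-- Since `x + x̄ = b(x, 1) 1`, a fixed point of the involution is a scalar in characteristic not
two. This is why the diagonal entries of hermitian matrices have coordinates in `k`. -/
theorem eq_half_b_of_bar_eq {x : C} (h : x = H.bar x) :
    x = ((1 / 2 : k) * H.b x H.one) • H.one := by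
  have h2 : (2 : k) ≠ 0 := NeZero.ne 2
  have h3 := H.add_bar x
  rw [← h, ← two_smul k] at h3
  rw [mul_smul, ← h3, smul_smul, one_div, inv_mul_cancel₀ h2, one_smul]

/-- The Peirce decomposition. It makes linear maps on `J` comparable on the `e_i` and `ι_i(a)`
alone, and nearly every operator identity below is proved that way. -/
theorem sum_coord (x : H.J) :
    x = ∑ i, (H.eCoord i x • H.e i) + ∑ i, H.ιJ i (H.ιCoord i x) := by
  have h2 : (2 : k) ≠ 0 := NeZero.ne 2
  have hx := H.mem_herm.1 x.2
  have hd : ∀ i, H.toMat x i i = H.eCoord i x • H.one := fun i =>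
    H.eq_half_b_of_bar_eq (hx i i)
  have h10 : H.toMat x 1 0 = (2 : k) • H.ιCoord 2 x := by
    change _ = (2 : k) • (1 / 2 : k) • H.toMat x 1 0
    rw [smul_smul, mul_one_div_cancel h2, one_smul]
  have h21 : H.toMat x 2 1 = (2 : k) • H.ιCoord 0 x := by
    change _ = (2 : k) • (1 / 2 : k) • H.toMat x 2 1
    rw [smul_smul, mul_one_div_cancel h2, one_smul]
  have h02 : H.toMat x 0 2 = (2 : k) • H.ιCoord 1 x := by
    change _ = (2 : k) • (1 / 2 : k) • H.toMat x 0 2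
    rw [smul_smul, mul_one_div_cancel h2, one_smul]
  have h01 : H.toMat x 0 1 = (2 : k) • H.bar (H.ιCoord 2 x) := by
    rw [← map_smul, ← h10]; exact hx 0 1
  have h12 : H.toMat x 1 2 = (2 : k) • H.bar (H.ιCoord 0 x) := by
    rw [← map_smul, ← h21]; exact hx 1 2
  have h20 : H.toMat x 2 0 = (2 : k) • H.bar (H.ιCoord 1 x) := by
    rw [← map_smul, ← h02]; exact hx 2 0
  apply H.toMat_injective
  ext a b
  fin_cases a <;> fin_cases b <;>
    simp [Fin.sum_univ_three, toMat_e, toMat_ιJ, Matrix.single, hd, h10, h21, h02, h01, h12, h20]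

variable {H} in
theorem J_hom_ext {M : Type*} [AddCommGroup M] [Module k M] {f g : H.J →ₗ[k] M} 
    (he : ∀ i, f (H.e i) = g (H.e i)) (hι : ∀ i a, f (H.ιJ i a) = g (H.ιJ i a)) : f = g := by
  ext x
  rw [H.sum_coord x]
  simp only [map_add, map_sum, map_smul, he, hι]

variable {H} in
/-- Linear maps on `J` agree when they do on the `e_i` and the `ι_i(a)` with `a` homogeneous. -/
theorem J_hom_ext_part {M : Type*} [AddCommGroup M] [Module k M] {f g : H.J →ₗ[k] M} 
    (he : ∀ i, f (H.e i) = g (H.e i))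
    (hι : ∀ i p, ∀ a ∈ part k C p, f (H.ιJ i a) = g (H.ιJ i a)) : f = g := by
  refine J_hom_ext he fun i a => ?_
  refine hom_induction (k := k) (P := fun a => f (H.ιJ i a) = g (H.ιJ i a)) ?_ (hι i) a
  intro u v hu hv
  simp only [map_add, hu, hv]

variable {H} in
theorem J_ext {x y : H.J} (he : ∀ i, H.eCoord i x = H.eCoord i y)
    (hι : ∀ i, H.ιCoord i x = H.ιCoord i y) : x = y := by
  rw [H.sum_coord x, H.sum_coord y]
  simp only [he, hι]

theorem ιJ_injective (i : Fin 3) : Function.Injective (H.ιJ i) := fun a b h => by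
  simpa [ιCoord_ι] using congrArg (H.ιCoord i) h

theorem mem_part_J {p : ZMod 2} {x : H.J} :
    x ∈ part k H.J p ↔ ∀ i j, H.toMat x i j ∈ part k C p := by
  constructor
  · intro h i j
    exact congrArg (fun y => H.toMat y i j) h
  · intro h
    apply H.toMat_injective
    ext i j
    exact h i j

theorem e_mem (i : Fin 3) : H.e i ∈ part k H.J 0 := by
  rw [mem_part_J]
  intro a b
  rw [toMat_e, Matrix.single_apply]
  split_ifs
  exacts [H.one_mem, Submodule.zero_mem _]

theorem ιJ_mem {p : ZMod 2} {a : C} (ha : a ∈ part k C p) (i : Fin 3) :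
    H.ιJ i a ∈ part k H.J p := by
  rw [mem_part_J]
  intro x y
  rw [toMat_ιJ, Matrix.smul_apply, Matrix.add_apply, Matrix.single_apply, Matrix.single_apply]
  refine Submodule.smul_mem _ _ (Submodule.add_mem _ ?_ ?_) <;> split_ifs
  exacts [ha, Submodule.zero_mem _, H.bar_mem ha, Submodule.zero_mem _]

theorem ιCoord_mem {p : ZMod 2} {x : H.J} (hx : x ∈ part k H.J p) (i : Fin 3) :
    H.ιCoord i x ∈ part k C p :=
  Submodule.smul_mem _ _ (H.mem_part_J.1 hx _ _)

theorem jmul_mem_part (p : ZMod 2) (x : H.J) (hx : x ∈ part k H.J p) :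
    H.jmul x ∈ part k (Module.End k H.J) p := by
  rw [mem_part_hom]
  intro q y hy
  rw [mem_part_J] at *
  intro i j
  rw [toMat_jmul]
  refine Submodule.smul_mem _ _ (Submodule.add_mem _ (Submodule.sum_mem _ fun l _ => ?_)
    (Submodule.sum_mem _ fun l _ => ?_))
  · exact H.mul_mem _ _ _ _ (hx _ _) (hy _ _)
  · rw [superflip_hom _ (hx _ _) (hy _ _), add_comm]
    exact Submodule.smul_mem _ _ (H.mul_mem _ _ _ _ (hy _ _) (hx _ _))

/-- The unit of `J`. -/
theorem jmul_sum_e : H.jmul (H.e 0 + H.e 1 + H.e 2) = 1 := by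
  have h2 : (2 : k) ≠ 0 := NeZero.ne 2
  refine J_hom_ext (fun i => ?_) (fun i a => ?_)
  · fin_cases i <;> simp [jmul_e_e]
  · fin_cases i <;> simp [jmul_e_ι, ← two_smul k, smul_smul, h2] 

theorem jmul_apply_sum_e (x : H.J) : H.jmul x (H.e 0 + H.e 1 + H.e 2) = x := by
  have h2 : (2 : k) ≠ 0 := NeZero.ne 2
  suffices h : (H.jmul : H.J →ₗ[k] H.J →ₗ[k] H.J).flip (H.e 0 + H.e 1 + H.e 2) = LinearMap.id from
    congrArg (fun f => f x) h
  refine J_hom_ext (fun i => ?_) (fun i a => ?_)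
  · fin_cases i <;> simp [jmul_e_e]
  · fin_cases i <;> simp [jmul_ι_e, ← two_smul k, smul_smul, h2] 

/-! ### The inner derivations `D_i(a)` -/

theorem D_eq (i : Fin 3) (a : C) : H.D i a =
    (2 : k) • (H.jmul (H.ιJ i a) * H.jmul (H.e (i + 1)) -
      H.jmul (H.e (i + 1)) * H.jmul (H.ιJ i a)) := by
  rw [D, glBracket_even_right (H.jmul_mem_part _ _ (H.e_mem _))]

theorem D_add (i : Fin 3) (a b : C) : H.D i (a + b) = H.D i a + H.D i b := by
  simp [D]

theorem D_smul (i : Fin 3) (c : k) (a : C) : H.D i (c • a) = c • H.D i a := by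
  simp only [D, map_smul, LinearMap.smul_apply]
  rw [smul_comm]

theorem D_mem {p : ZMod 2} {a : C} (ha : a ∈ part k C p) (i : Fin 3) :
    H.D i a ∈ part k (Module.End k H.J) p := by
  have h := glBracket_mem_part (H.jmul_mem_part _ _ (H.ιJ_mem ha i))
    (H.jmul_mem_part _ _ (H.e_mem (i + 1)))
  rw [add_zero] at h
  exact Submodule.smul_mem _ _ h

/-- This value and the five that follow determine `D_i(a)`. In each commutator `L_{e_{i+1}}` acts by
a Peirce eigenvalue `0`, `½` or `1`, which explains the coefficients; for instance it kills
`ι_{i+1}(C)`, so only one of the two terms survives on `ι_{i+1}(b)` and on `ι_{i+2}(b)`. -/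
theorem D_e (i : Fin 3) (a : C) : H.D i a (H.e i) = 0 := by
  rw [D_eq]
  simp [jmul_e_e, jmul_ι_e, (fin3_ne_one i).symm]

theorem D_e_one (i : Fin 3) (a : C) : H.D i a (H.e (i + 1)) = (1 / 2 : k) • H.ιJ i a := by
  have h2 : (2 : k) ≠ 0 := NeZero.ne 2
  rw [D_eq]
  simp [jmul_e_e, jmul_ι_e, jmul_e_ι, (fin3_ne_one i).symm]
  match_scalars
  field_simp
  norm_num

theorem D_e_two (i : Fin 3) (a : C) : H.D i a (H.e (i + 2)) = -((1 / 2 : k) • H.ιJ i a) := by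
  have h2 : (2 : k) ≠ 0 := NeZero.ne 2
  rw [D_eq]
  simp [jmul_e_e, jmul_ι_e, jmul_e_ι, (fin3_ne_one i).symm, (fin3_ne_two i).symm,
    fin3_one_ne_two]
  match_scalars
  field_simp

theorem D_ι (i : Fin 3) (a b : C) :
    H.D i a (H.ιJ i b) = (2 * H.b a b) • (H.e (i + 2) - H.e (i + 1)) := by
  have h2 : (2 : k) ≠ 0 := NeZero.ne 2
  rw [D_eq]
  simp [jmul_e_e, jmul_ι_self, jmul_e_ι, (fin3_ne_one i).symm, fin3_one_ne_two]
  match_scalars <;> field_simp <;> ring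

theorem D_ι_one (i : Fin 3) (a b : C) :
    H.D i a (H.ιJ (i + 1) b) = -H.ιJ (i + 2) (H.para.l a b) := by
  have h2 : (2 : k) ≠ 0 := NeZero.ne 2
  rw [D_eq]
  simp [jmul_e_ι, jmul_ι_succ, fin3_one_ne_two, h2]

theorem D_ι_two (i : Fin 3) (a b : C) :
    H.D i a (H.ιJ (i + 2) b) = H.ιJ (i + 1) (H.para.r a b) := by
  have h2 : (2 : k) ≠ 0 := NeZero.ne 2
  rw [D_eq]
  simp [jmul_e_ι, jmul_ι_pred, fin3_one_ne_two, h2]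

/-! ### The maps `D_{(d₀,d₁,d₂)}` -/

theorem Dtri_e (d : Fin 3 → Module.End k C) (i : Fin 3) : H.Dtri d (H.e i) = 0 := by
  change ∑ j, H.ιJ j (d j (H.ιCoord j (H.e i))) = 0
  simp [ιCoord_e]

theorem Dtri_ι (d : Fin 3 → Module.End k C) (i : Fin 3) (a : C) :
    H.Dtri d (H.ιJ i a) = H.ιJ i (d i a) := by
  change ∑ j, H.ιJ j (d j (H.ιCoord j (H.ιJ i a))) = _
  rw [Finset.sum_eq_single i]
  · simp [ιCoord_ι]
  · intro j _ hj
    simp [ιCoord_ι, hj]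
  · simp

theorem Dtri_add (d d' : Fin 3 → Module.End k C) : H.Dtri (d + d') = H.Dtri d + H.Dtri d' :=
  J_hom_ext (by simp [Dtri_e]) (by simp [Dtri_ι])

theorem Dtri_smul (c : k) (d : Fin 3 → Module.End k C) : H.Dtri (c • d) = c • H.Dtri d :=
  J_hom_ext (by simp [Dtri_e]) (by simp [Dtri_ι])

theorem Dtri_mem {p : ZMod 2} {d : Fin 3 → Module.End k C}
    (hd : ∀ i, d i ∈ part k (Module.End k C) p) : H.Dtri d ∈ part k (Module.End k H.J) p := by
  rw [mem_part_hom]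
  intro q x hx
  refine Submodule.sum_mem _ fun i _ => H.ιJ_mem ?_ i
  exact mem_part_hom.1 (hd i) _ _ (H.ιCoord_mem hx i)

end HurwitzSuperalgebra
end Supermagic
end

noncomputable section

namespace Supermagic

namespace SymmetricCompositionSuperalgebra

/-! ### Identities for the left and right multiplications -/

variable {k V : Type*} [Field k] [AddCommGroup V] [Module k V] [Superspace k V]
  (S : SymmetricCompositionSuperalgebra k V)

theorem r_comm {p q : ZMod 2} {a b : V} (ha : a ∈ part k V p) (hb : b ∈ part k V q) :
    S.r b a = sg k (p * q) • S.l a b := by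
  rw [S.r_apply hb ha, mul_comm, S.l_apply]

/-- The identities from here to `r_r_add'` are `mul_mul_right` and `mul_mul_left` with a different
variable kept free each time, so that they hold for inhomogeneous `c`. Each supplies one component
of an operator identity on `J`. -/
theorem r_l_add {p q : ZMod 2} {a b : V} (ha : a ∈ part k V p) (hb : b ∈ part k V q) (c : V) :
    S.r a (S.l b c) + sg k (p * q) • S.r b (S.l a c) = S.b a b • c := by
  refine hom_induction (k := k) (P := fun c =>
    S.r a (S.l b c) + sg k (p * q) • S.r b (S.l a c) = S.b a b • c) ?_ ?_ c
  · intro u v hu hv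
    simp only [map_add, smul_add, ← hu, ← hv]; abel
  intro r c hc
  have h := S.mul_mul_right hb hc ha
  have hs := S.b_symm _ _ _ _ hb ha
  simp only [l_apply]
  rw [S.r_apply ha (S.mul_mem _ _ _ _ hb hc), S.r_apply hb (S.mul_mem _ _ _ _ ha hc)]
  rw [hs] at h
  rcases parity_cases p with rfl | rfl <;> rcases parity_cases q with rfl | rfl <;>
    rcases parity_cases r with rfl | rfl <;>
    simp only [add_zero, zero_add, mul_zero, mul_one, one_mul, zero_mul, sg_zero, sg_one,
      parity_two] at h ⊢ <;>
    first
    | linear_combination (norm := module) h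
    | linear_combination (norm := module) -h

theorem l_r_add {p q : ZMod 2} {a b : V} (ha : a ∈ part k V p) (hb : b ∈ part k V q) (c : V) :
    S.l a (S.r b c) + sg k (p * q) • S.l b (S.r a c) = S.b a b • c := by
  refine hom_induction (k := k) (P := fun c =>
    S.l a (S.r b c) + sg k (p * q) • S.l b (S.r a c) = S.b a b • c) ?_ ?_ c
  · intro u v hu hv
    simp only [map_add, smul_add, ← hu, ← hv]; abel
  intro r c hc
  have h := S.mul_mul_left ha hc hb
  -- The coefficient of `b(a, b)` differs from the wanted one by the sign `(-1) ^ ((p + q) r)`,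
  -- which matters only when `p ≠ q`, and then `b(a, b) = 0`.
  have h0 := S.b_zero_or ha hb
  rw [S.r_apply hb hc, S.r_apply ha hc]
  simp only [l_apply, map_smul]
  rcases parity_cases p with rfl | rfl <;> rcases parity_cases q with rfl | rfl <;>
    rcases parity_cases r with rfl | rfl <;>
    simp only [add_zero, zero_add, mul_zero, mul_one, one_mul, zero_mul, sg_zero, sg_one,
      parity_two, zero_ne_one, one_ne_zero, false_or] at h h0 ⊢ <;>
    (try simp only [h0] at h ⊢) <;>
    first
    | linear_combination (norm := module) h
    | linear_combination (norm := module) -h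

theorem r_r_add {p q : ZMod 2} {a b : V} (ha : a ∈ part k V p) (hb : b ∈ part k V q) (c : V) :
    S.r a (S.r b c) + S.l (S.l a b) c = (sg k (p * q) * S.b a c) • b := by
  refine hom_induction (k := k) (P := fun c =>
    S.r a (S.r b c) + S.l (S.l a b) c = (sg k (p * q) * S.b a c) • b) ?_ ?_ c
  · intro u v hu hv
    simp only [map_add, mul_add, add_smul, ← hu, ← hv]; abel
  intro r c hc
  have h := S.mul_mul_right ha hb hc
  have h0 := S.b_zero_or ha hc
  rw [S.r_apply hb hc, map_smul, S.r_apply ha (S.mul_mem _ _ _ _ hc hb)]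
  simp only [l_apply]
  rcases parity_cases p with rfl | rfl <;> rcases parity_cases q with rfl | rfl <;>
    rcases parity_cases r with rfl | rfl <;>
    simp only [add_zero, zero_add, mul_zero, mul_one, one_mul, zero_mul, sg_zero, sg_one,
      parity_two, zero_ne_one, one_ne_zero, false_or] at h h0 ⊢ <;>
    (try simp only [h0] at h ⊢) <;>
    first
    | linear_combination (norm := module) h
    | linear_combination (norm := module) -h

theorem l_l_add {p q : ZMod 2} {a b : V} (ha : a ∈ part k V p) (hb : b ∈ part k V q) (c : V) :
    sg k (p * q) • S.l b (S.l a c) + S.r (S.l a b) c = S.b b c • a := by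
  refine hom_induction (k := k) (P := fun c =>
    sg k (p * q) • S.l b (S.l a c) + S.r (S.l a b) c = S.b b c • a) ?_ ?_ c
  · intro u v hu hv
    simp only [map_add, smul_add, add_smul, ← hu, ← hv]; abel
  intro r c hc
  have h := S.mul_mul_left hb ha hc
  simp only [l_apply]
  rw [S.r_apply (S.mul_mem _ _ _ _ ha hb) hc]
  rcases parity_cases p with rfl | rfl <;> rcases parity_cases q with rfl | rfl <;>
    rcases parity_cases r with rfl | rfl <;>
    simp only [add_zero, zero_add, mul_zero, mul_one, one_mul, zero_mul, sg_zero, sg_one,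
      parity_two] at h ⊢ <;>
    first
    | linear_combination (norm := module) h
    | linear_combination (norm := module) -h

theorem l_l_add' {p q : ZMod 2} {a b : V} (ha : a ∈ part k V p) (hb : b ∈ part k V q) (c : V) :
    S.l a (S.l b c) + S.r (S.r a b) c = (sg k (p * q) * S.b a c) • b := by
  have h := S.l_l_add hb ha c
  rw [S.r_apply ha hb, map_smul, LinearMap.smul_apply, mul_smul, ← h, mul_comm q p]
  rcases sg_cases k (p * q) with e | e <;> simp only [e, l_apply] <;> module

theorem r_r_add' {p q : ZMod 2} {a b : V} (ha : a ∈ part k V p) (hb : b ∈ part k V q) (c : V) :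
    sg k (p * q) • S.r b (S.r a c) + S.l (S.r a b) c = S.b b c • a := by
  have h := S.r_r_add hb ha c
  rw [mul_smul, mul_comm q p] at h
  rw [S.r_apply ha hb, map_smul, LinearMap.smul_apply]
  rw [l_apply S b] at h
  rcases sg_cases k (p * q) with e | e <;> simp only [e] at h ⊢
  · linear_combination (norm := module) h
  · linear_combination (norm := module) -h

theorem b_l_left (a b c : V) : S.b (S.l a b) c = S.b a (S.l b c) := S.b_assoc a b c

theorem b_r_right {p q : ZMod 2} {a b : V} (ha : a ∈ part k V p) (hb : b ∈ part k V q) (c : V) :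
    S.b b (S.r a c) = sg k (p * q) * S.b a (S.l b c) := by
  refine hom_induction (k := k) (P := fun c =>
    S.b b (S.r a c) = sg k (p * q) * S.b a (S.l b c)) ?_ ?_ c
  · intro u v hu hv
    simp only [map_add, mul_add, hu, hv]
  intro r c hc
  rw [S.r_apply ha hc, map_smul, ← S.b_assoc,
    S.b_symm _ _ _ _ (S.mul_mem _ _ _ _ hb hc) ha, l_apply]
  simp only [add_mul, sg_add, smul_eq_mul, mul_comm r p, mul_comm q p]
  rcases sg_cases k (p * q) with e | e <;> rcases sg_cases k (p * r) with e' | e' <;>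
    simp only [e, e'] <;> ring

theorem b_r_left {p q : ZMod 2} {a b : V} (ha : a ∈ part k V p) (hb : b ∈ part k V q) (c : V) :
    S.b (S.r a b) c = sg k (p * q) * S.b b (S.l a c) := by
  rw [S.r_apply ha hb, map_smul, LinearMap.smul_apply, smul_eq_mul, S.b_assoc, l_apply]

end SymmetricCompositionSuperalgebra

namespace HurwitzSuperalgebra

/-! ### `D_i(a)` is a derivation -/

variable {k C : Type*} [Field k] [NeZero (2 : k)] [AddCommGroup C] [Module k C] [Superspace k C]
  (H : HurwitzSuperalgebra k C)

/-- Here and in the next five lemmas the multiplication table is restated with indices reduced to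
`i`, `i + 1`, `i + 2`, the normal form for rewriting. -/
theorem jmul_ι_one_self (i : Fin 3) (x y : C) :
    H.jmul (H.ιJ (i + 1) x) (H.ιJ (i + 1) y) = (2 * H.b x y) • (H.e (i + 2) + H.e i) := by
  simpa only [fin3_one_one, fin3_one_two] using H.jmul_ι_self (i + 1) x y

theorem jmul_ι_two_self (i : Fin 3) (x y : C) :
    H.jmul (H.ιJ (i + 2) x) (H.ιJ (i + 2) y) = (2 * H.b x y) • (H.e i + H.e (i + 1)) := by
  simpa only [fin3_two_one, fin3_two_two] using H.jmul_ι_self (i + 2) x y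

theorem jmul_ι_one_two (i : Fin 3) (x y : C) :
    H.jmul (H.ιJ (i + 1) x) (H.ιJ (i + 2) y) = H.ιJ i (H.para.l x y) := by
  simpa only [fin3_one_one, fin3_one_two] using H.jmul_ι_succ (i + 1) x y

theorem jmul_ι_two_zero (i : Fin 3) (x y : C) :
    H.jmul (H.ιJ (i + 2) x) (H.ιJ i y) = H.ιJ (i + 1) (H.para.l x y) := by
  simpa only [fin3_two_one, fin3_two_two] using H.jmul_ι_succ (i + 2) x y

theorem jmul_ι_one_zero (i : Fin 3) (x y : C) :
    H.jmul (H.ιJ (i + 1) x) (H.ιJ i y) = H.ιJ (i + 2) (H.para.r x y) := by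
  simpa only [fin3_one_one, fin3_one_two] using H.jmul_ι_pred (i + 1) x y

theorem jmul_ι_two_one (i : Fin 3) (x y : C) :
    H.jmul (H.ιJ (i + 2) x) (H.ιJ (i + 1) y) = H.ιJ i (H.para.r x y) := by
  simpa only [fin3_two_one, fin3_two_two] using H.jmul_ι_pred (i + 2) x y

theorem para_b : H.para.b = H.b := rfl

variable {H} in
/-- Linear maps on `J` agree when they do on the `e_j` and the `ι_j(a)`, with the indices counted
from a given one. -/
theorem J_hom_ext_from {M : Type*} [AddCommGroup M] [Module k M] {f g : H.J →ₗ[k] M} (i : Fin 3)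
    (he : f (H.e i) = g (H.e i)) (he₁ : f (H.e (i + 1)) = g (H.e (i + 1)))
    (he₂ : f (H.e (i + 2)) = g (H.e (i + 2))) (hι : ∀ a, f (H.ιJ i a) = g (H.ιJ i a))
    (hι₁ : ∀ a, f (H.ιJ (i + 1) a) = g (H.ιJ (i + 1) a))
    (hι₂ : ∀ a, f (H.ιJ (i + 2) a) = g (H.ιJ (i + 2) a)) : f = g :=
  J_hom_ext (fin3_forall i he he₁ he₂) (fin3_forall i hι hι₁ hι₂)

/-- The derivation rule for `D_i(a)` against an idempotent follows from the tables alone, with no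
composition identity. The identities are needed only against the `ι_j(b)`, in the next three lemmas.
-/
theorem D_bracket_e (i : Fin 3) (a : C) (j : Fin 3) :
    glBracket k H.J (H.D i a) (H.jmul (H.e j)) = H.jmul (H.D i a (H.e j)) := by
  have h2 : (2 : k) ≠ 0 := NeZero.ne 2
  rw [glBracket_even_right (H.jmul_mem_part _ _ (H.e_mem j))]
  revert j
  refine fin3_forall i ?_ ?_ ?_ <;>
  refine J_hom_ext_from i ?_ ?_ ?_ (fun c => ?_) (fun c => ?_) (fun c => ?_) <;>
  simp only [LinearMap.sub_apply, LinearMap.neg_apply, Module.End.mul_apply, LinearMap.zero_apply,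
    LinearMap.smul_apply, map_zero, map_smul, map_neg, map_sub, map_add,
    D_e, D_e_one, D_e_two, D_ι, D_ι_one, D_ι_two, jmul_e_e, jmul_e_ι, jmul_ι_e, jmul_ι_self,
    jmul_ι_succ, jmul_ι_pred,
    fin3_ne_one, fin3_ne_two, fin3_one_ne_two, (fin3_ne_one i).symm, (fin3_ne_two i).symm,
    (fin3_one_ne_two i).symm, if_true, if_false] <;>
  match_scalars <;> field_simp <;> norm_num

/-- On `e_j` and `ι_i(c)` only symmetry of `b` is involved. On `ι_{i+1}(c)` and `ι_{i+2}(c)` the two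
terms of the bracket add up to `r_a l_b ± r_b l_a` and `l_a r_b ± l_b r_a`, which are both `b(a,
b)`. -/
theorem D_bracket_ι {p : ZMod 2} {a : C} (ha : a ∈ part k C p) (i : Fin 3)
    {q : ZMod 2} {b : C} (hb : b ∈ part k C q) :
    glBracket k H.J (H.D i a) (H.jmul (H.ιJ i b)) = H.jmul (H.D i a (H.ιJ i b)) := by
  have h2 : (2 : k) ≠ 0 := NeZero.ne 2
  rw [glBracket_hom (H.D_mem ha i) (H.jmul_mem_part _ _ (H.ιJ_mem hb i))]
  have hs := H.b_symm _ _ _ _ ha hb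
  refine J_hom_ext_from i ?_ ?_ ?_ (fun c => ?_) (fun c => ?_) (fun c => ?_) <;>
  simp only [LinearMap.sub_apply, LinearMap.neg_apply, Module.End.mul_apply, LinearMap.zero_apply,
    LinearMap.smul_apply, map_zero, map_smul, map_neg, map_sub, map_add, LinearMap.add_apply,
    D_e, D_e_one, D_e_two, D_ι, D_ι_one, D_ι_two, jmul_e_e, jmul_e_ι, jmul_ι_e, jmul_ι_self,
    jmul_ι_succ, jmul_ι_pred,
    fin3_ne_one, fin3_ne_two, fin3_one_ne_two, (fin3_ne_one i).symm, (fin3_ne_two i).symm,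
    (fin3_one_ne_two i).symm, if_true, if_false]
  · simp
  · rw [hs]; match_scalars <;> field_simp <;> ring
  · rw [hs]; match_scalars <;> field_simp <;> ring
  · match_scalars <;> field_simp <;> norm_num
  · have h := congrArg (H.ιJ (i + 1)) (H.para.r_l_add ha hb c)
    simp only [map_add, map_smul, para_b] at h
    linear_combination (norm := skip) h
    match_scalars <;> field_simp <;> norm_num
  · have h := congrArg (H.ιJ (i + 2)) (H.para.l_r_add ha hb c)
    simp only [map_add, map_smul, para_b] at h
    linear_combination (norm := skip) -h
    match_scalars <;> field_simp <;> norm_num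

/-- The values on `ι_i(c)`, `ι_{i+1}(c)` and `ι_{i+2}(c)` are, in this order, `r_r_add`, `l_l_add`
and the associativity of `b`. On the idempotents `r_b(a) = ± l_a(b)` brings in a sign that cancels
the sign of the superbracket. -/
theorem D_bracket_ι_one {p : ZMod 2} {a : C} (ha : a ∈ part k C p) (i : Fin 3)
    {q : ZMod 2} {b : C} (hb : b ∈ part k C q) :
    glBracket k H.J (H.D i a) (H.jmul (H.ιJ (i + 1) b)) = H.jmul (H.D i a (H.ιJ (i + 1) b)) := by
  have h2 : (2 : k) ≠ 0 := NeZero.ne 2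
  rw [glBracket_hom (H.D_mem ha i) (H.jmul_mem_part _ _ (H.ιJ_mem hb _))]
  have hr := congrArg (H.ιJ (i + 2)) (H.para.r_comm ha hb)
  rw [map_smul] at hr
  have hss : sg k (p * q) * sg k (p * q) = 1 := by
    rcases sg_cases k (p * q) with h | h <;> simp [h]
  refine J_hom_ext_from i ?_ ?_ ?_ (fun c => ?_) (fun c => ?_) (fun c => ?_) <;>
  simp only [LinearMap.sub_apply, LinearMap.neg_apply, Module.End.mul_apply, LinearMap.zero_apply,
    LinearMap.smul_apply, map_zero, map_smul, map_neg, map_sub, map_add, LinearMap.add_apply,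
    D_e, D_e_one, D_e_two, D_ι, D_ι_one, D_ι_two, jmul_e_e, jmul_e_ι, jmul_ι_e, 
    jmul_ι_one_self, jmul_ι_two_self, jmul_ι_one_two, jmul_ι_two_zero, jmul_ι_one_zero, jmul_ι_two_one,
    fin3_ne_one, fin3_ne_two, fin3_one_ne_two, (fin3_ne_one i).symm, (fin3_ne_two i).symm,
    (fin3_one_ne_two i).symm, if_true, if_false]
  · match_scalars; field_simp
  · rw [hr]; match_scalars; linear_combination (-(1 / 2 : k)) * hss
  · rw [hr]; match_scalars; linear_combination (1 / 2 : k) * hss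
  · have h := congrArg (H.ιJ (i + 1)) (H.para.r_r_add ha hb c)
    simp only [map_add, map_smul, para_b] at h
    linear_combination (norm := skip) h
    match_scalars <;> field_simp <;> ring
  · have h := congrArg (H.ιJ i) (H.para.l_l_add ha hb c)
    simp only [map_add, map_smul, para_b] at h
    linear_combination (norm := skip) h
    match_scalars <;> field_simp <;> ring
  · have h1 := H.para.b_l_left a b c
    have h3 := H.para.b_r_right ha hb c
    rw [para_b] at h1 h3
    rw [h1, h3]
    rcases sg_cases k (p * q) with h | h <;> simp only [h] <;> match_scalars <;> ring

theorem D_bracket_ι_two {p : ZMod 2} {a : C} (ha : a ∈ part k C p) (i : Fin 3)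
    {q : ZMod 2} {b : C} (hb : b ∈ part k C q) :
    glBracket k H.J (H.D i a) (H.jmul (H.ιJ (i + 2) b)) = H.jmul (H.D i a (H.ιJ (i + 2) b)) := by
  have h2 : (2 : k) ≠ 0 := NeZero.ne 2
  rw [glBracket_hom (H.D_mem ha i) (H.jmul_mem_part _ _ (H.ιJ_mem hb _))]
  have hr := congrArg (H.ιJ (i + 1)) (H.para.r_comm hb ha)
  rw [map_smul, mul_comm q p] at hr
  have hss : sg k (p * q) * sg k (p * q) = 1 := by
    rcases sg_cases k (p * q) with h | h <;> simp [h]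
  refine J_hom_ext_from i ?_ ?_ ?_ (fun c => ?_) (fun c => ?_) (fun c => ?_) <;>
  simp only [LinearMap.sub_apply, LinearMap.neg_apply, Module.End.mul_apply, LinearMap.zero_apply,
    LinearMap.smul_apply, map_zero, map_smul, map_neg, map_sub, map_add, LinearMap.add_apply,
    D_e, D_e_one, D_e_two, D_ι, D_ι_one, D_ι_two, jmul_e_e, jmul_e_ι, jmul_ι_e, 
    jmul_ι_one_self, jmul_ι_two_self, jmul_ι_one_two, jmul_ι_two_zero, jmul_ι_one_zero,
    jmul_ι_two_one,
    fin3_ne_one, fin3_ne_two, fin3_one_ne_two, (fin3_ne_one i).symm, (fin3_ne_two i).symm,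
    (fin3_one_ne_two i).symm, if_true, if_false]
  · rw [hr]; match_scalars; ring
  · rw [hr]; match_scalars; ring
  · rw [hr]; match_scalars; ring
  · have h := congrArg (H.ιJ (i + 2)) (H.para.l_l_add' ha hb c)
    simp only [map_add, map_smul, para_b] at h
    linear_combination (norm := skip) -h
    match_scalars <;> field_simp <;> ring
  · have h1 := H.para.b_r_left ha hb c
    have h3 := H.para.b_r_right hb ha c
    rw [para_b, mul_comm q p] at h3
    rw [para_b] at h1
    rw [h1, h3]
    match_scalars <;> ring
  · have h := congrArg (H.ιJ i) (H.para.r_r_add' ha hb c)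
    simp only [map_add, map_smul, para_b] at h
    linear_combination (norm := skip) -h
    match_scalars <;> field_simp <;> ring

end HurwitzSuperalgebra
end Supermagic
end

/-! ### Triality and the derivations `D_i(a)`, `D_d` of `J` -/

noncomputable section

namespace Supermagic

namespace SymmetricCompositionSuperalgebra

variable {k V : Type*} [Field k] [AddCommGroup V] [Module k V] [Superspace k V]
  (S : SymmetricCompositionSuperalgebra k V)

variable {S} in
-- The defining rule of `tri(S)` is the case `i = 1`; the other cases come from its invariance under
-- `θ` and `θ²`.
theorem triPart_mul {p : ZMod 2} {d : Fin 3 → Module.End k V} (hd : d ∈ S.triPart p) (i : Fin 3)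
    {q : ZMod 2} {x : V} (hx : x ∈ part k V q) (y : V) :
    d (i + 2) (S.l x y) = S.l (d i x) y + sg k (p * q) • S.l x (d (i + 1) y) := by
  fin_cases i
  · exact (S.rot_mem_triPart hd).2 q x y hx
  · exact hd.2 q x y hx
  · exact (S.rot_mem_triPart (S.rot_mem_triPart hd)).2 q x y hx

variable {S} in
theorem triPart_mul_r {p : ZMod 2} {d : Fin 3 → Module.End k V} (hd : d ∈ S.triPart p) (i : Fin 3)
    {q : ZMod 2} {x : V} (hx : x ∈ part k V q) (y : V) :
    d (i + 1) (S.r x y) = S.r (d i x) y + sg k (p * q) • S.r x (d (i + 2) y) := by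
  refine hom_induction (k := k) (P := fun y => d (i + 1) (S.r x y) =
    S.r (d i x) y + sg k (p * q) • S.r x (d (i + 2) y)) ?_ ?_ y
  · intro u v hu hv
    simp only [map_add, hu, hv, smul_add]; abel
  intro r y hy
  have h := triPart_mul hd (i + 2) hy x
  rw [fin3_two_two, fin3_two_one] at h
  rw [S.r_apply hx hy, S.r_apply (mem_part_hom.1 (hd.1 i).1 _ _ hx) hy,
    S.r_apply hx (mem_part_hom.1 (hd.1 (i + 2)).1 _ _ hy), map_smul, ← l_apply, h]
  simp only [l_apply, add_mul, mul_add, sg_add, mul_comm q p, smul_smul, smul_add]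
  rcases sg_cases k (p * q) with e1 | e1 <;> rcases sg_cases k (p * r) with e2 | e2 <;>
    rcases sg_cases k (q * r) with e3 | e3 <;> simp only [e1, e2, e3] <;> module

/-- `θ^i` moves the component `j` to the place `i + j`. Hence `θ^i(t_{a,b})` has `σ_{a,b}` at the
place `i`, the one acting on `ι_i(C)`. -/
theorem θ_pow_apply (d : S.tri) (i : Fin 3) :
    ((S.θ ^ (i : ℕ)) d : Fin 3 → Module.End k V) i = (d : Fin 3 → Module.End k V) 0 ∧
    ((S.θ ^ (i : ℕ)) d : Fin 3 → Module.End k V) (i + 1) = (d : Fin 3 → Module.End k V) 1 ∧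
    ((S.θ ^ (i : ℕ)) d : Fin 3 → Module.End k V) (i + 2) = (d : Fin 3 → Module.End k V) 2 := by
  fin_cases i
  · exact ⟨rfl, rfl, rfl⟩
  · exact ⟨rfl, rfl, rfl⟩
  · exact ⟨rfl, rfl, rfl⟩

end SymmetricCompositionSuperalgebra

namespace HurwitzSuperalgebra

variable {k C : Type*} [Field k] [NeZero (2 : k)] [AddCommGroup C] [Module k C] [Superspace k C]
  (H : HurwitzSuperalgebra k C)

theorem D_mem_derPart {p : ZMod 2} {a : C} (ha : a ∈ part k C p) (i : Fin 3) :
    H.D i a ∈ derPart H.jmul p := by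
  refine mem_derPart_of_glBracket H.jmul_mem_part (H.D_mem ha i) fun x => ?_
  suffices h : glBracket k H.J (H.D i a) ∘ₗ H.jmul = H.jmul ∘ₗ H.D i a by
    rw [← LinearMap.comp_apply, h, LinearMap.comp_apply]
  refine J_hom_ext_part (H.D_bracket_e i a) (fin3_forall i ?_ ?_ ?_)
  · exact fun q b hb => H.D_bracket_ι ha i hb
  · exact fun q b hb => H.D_bracket_ι_one ha i hb
  · exact fun q b hb => H.D_bracket_ι_two ha i hb

theorem D_mem_der (i : Fin 3) (a : C) : H.D i a ∈ H.derJ := by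
  rw [← pr_add (k := k) a, D_add]
  exact Submodule.add_mem _ (derPart_le _ 0 (H.D_mem_derPart (pr_mem _ _) i))
    (derPart_le _ 1 (H.D_mem_derPart (pr_mem _ _) i))

/-- Against `e_j` the rule holds because `e_j` acts by a scalar on each `ι_i(C)`. On `ι_i ∘ ι_i` it
is the orthosymplectic condition on `d_i`, and on `ι_i ∘ ι_{i+1}` and `ι_i ∘ ι_{i+2}` it is
triality. -/
theorem Dtri_mem_derPart {p : ZMod 2} {d : Fin 3 → Module.End k C} (hd : d ∈ H.para.triPart p) :
    H.Dtri d ∈ derPart H.jmul p := by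
  have hp := H.Dtri_mem fun i => (hd.1 i).1
  refine mem_derPart_of_glBracket H.jmul_mem_part hp fun x => ?_
  suffices h : glBracket k H.J (H.Dtri d) ∘ₗ H.jmul = H.jmul ∘ₗ H.Dtri d by
    simpa only [LinearMap.comp_apply] using LinearMap.congr_fun h x
  refine J_hom_ext_part (fun i => ?_) (fun i q b hb => ?_)
  · change glBracket k H.J (H.Dtri d) (H.jmul (H.e i)) = H.jmul (H.Dtri d (H.e i))
    rw [glBracket_even_right (H.jmul_mem_part _ _ (H.e_mem i)), Dtri_e, map_zero]
    refine J_hom_ext (fun j => ?_) (fun j c => ?_)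
    · simp only [LinearMap.sub_apply, Module.End.mul_apply, jmul_e_e, Dtri_e, map_zero]
      split_ifs <;> simp [Dtri_e]
    · simp only [LinearMap.sub_apply, Module.End.mul_apply, jmul_e_ι, Dtri_ι]
      split_ifs <;> simp [Dtri_ι]
  · change glBracket k H.J (H.Dtri d) (H.jmul (H.ιJ i b)) = H.jmul (H.Dtri d (H.ιJ i b))
    rw [glBracket_hom hp (H.jmul_mem_part _ _ (H.ιJ_mem hb i)), Dtri_ι]
    have ho := (hd.1 i).2 q b
    rw [para_b] at ho
    have he : ∀ j, (H.Dtri d * H.jmul (H.ιJ i b) - sg k (p * q) • (H.jmul (H.ιJ i b) * H.Dtri d))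
        (H.e j) = H.jmul (H.ιJ i (d i b)) (H.e j) := by
      intro j
      simp only [LinearMap.sub_apply, LinearMap.smul_apply, Module.End.mul_apply, jmul_ι_e, Dtri_e,
        map_zero]
      split_ifs <;> simp [Dtri_ι]
    refine J_hom_ext_from i (he _) (he _) (he _) (fun c => ?_) (fun c => ?_) (fun c => ?_) <;>
      simp only [LinearMap.sub_apply, LinearMap.smul_apply, Module.End.mul_apply, Dtri_ι,
        jmul_ι_self, jmul_ι_succ, jmul_ι_pred, map_smul, map_add, Dtri_e]
    · have h := ho c hb
      match_scalars <;> linear_combination (-2) * h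
    · rw [SymmetricCompositionSuperalgebra.triPart_mul hd i hb, map_add, map_smul]
      abel
    · rw [SymmetricCompositionSuperalgebra.triPart_mul_r hd i hb, map_add, map_smul]
      abel

theorem Dtri_mem_der {d : Fin 3 → Module.End k C} (hd : d ∈ H.para.tri) : H.Dtri d ∈ H.derJ := by
  rw [← pr_add (k := k) d, Dtri_add]
  exact Submodule.add_mem _ (derPart_le _ 0 (H.Dtri_mem_derPart (H.para.mem_tri.1 hd 0)))
    (derPart_le _ 1 (H.Dtri_mem_derPart (H.para.mem_tri.1 hd 1)))

theorem der_bracket {d : Module.End k H.J} (hd : d ∈ H.derJ) (x : H.J) :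
    glBracket k H.J d (H.jmul x) = H.jmul (d x) :=
  glBracket_of_mem_der H.jmul_mem_part hd x

/-! ### Brackets of multiplication operators -/

theorem L_e_bracket (i j : Fin 3) : glBracket k H.J (H.jmul (H.e i)) (H.jmul (H.e j)) = 0 := by
  rw [glBracket_even_right (H.jmul_mem_part _ _ (H.e_mem j))]
  refine J_hom_ext (fun l => ?_) (fun l c => ?_)
  · simp only [LinearMap.sub_apply, Module.End.mul_apply, jmul_e_e, LinearMap.zero_apply]
    split_ifs <;> simp_all [jmul_e_e]
  · simp only [LinearMap.sub_apply, Module.End.mul_apply, jmul_e_ι, LinearMap.zero_apply]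
    split_ifs <;> simp_all [jmul_e_ι]

theorem L_ι_e_bracket (i : Fin 3) (a : C) :
    glBracket k H.J (H.jmul (H.ιJ i a)) (H.jmul (H.e i)) = 0 := by
  rw [glBracket_even_right (H.jmul_mem_part _ _ (H.e_mem i))]
  refine J_hom_ext_from i ?_ ?_ ?_ (fun c => ?_) (fun c => ?_) (fun c => ?_) <;>
  simp [jmul_e_e, jmul_e_ι, jmul_ι_e, jmul_ι_self,
    jmul_ι_succ, jmul_ι_pred, (fin3_ne_one i).symm, (fin3_ne_two i).symm]

theorem L_ι_e_one_bracket (i : Fin 3) (a : C) :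
    glBracket k H.J (H.jmul (H.ιJ i a)) (H.jmul (H.e (i + 1))) = (1 / 2 : k) • H.D i a := by
  have h2 : (2 : k) ≠ 0 := NeZero.ne 2
  rw [D, smul_smul, one_div, inv_mul_cancel₀ h2, one_smul]

theorem L_ι_e_two_bracket (i : Fin 3) (a : C) :
    glBracket k H.J (H.jmul (H.ιJ i a)) (H.jmul (H.e (i + 2))) = -((1 / 2 : k) • H.D i a) := by
  -- The unit `e_0 + e_1 + e_2` acts as the identity and is central in `gl(J)`, so this bracket
  -- follows from the previous two.
  have h : H.e (i + 2) = (H.e 0 + H.e 1 + H.e 2) - H.e i - H.e (i + 1) := by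
    rw [← Fin.sum_univ_three (f := H.e), fin3_sum _ i]; abel
  rw [h, map_sub, map_sub, map_sub, map_sub, L_ι_e_bracket, L_ι_e_one_bracket, jmul_sum_e,
    glBracket_one_right]
  abel

/-- The triple `θ^i(t_{a,b})`. -/
def rotT (i : Fin 3) (a b : C) : H.para.tri := (H.para.θ ^ (i : ℕ)) (H.para.t a b)

/-- This is the origin of `t_{a,b}`. On `ι_i(C)` the product of two multiplications passes through
the idempotents and yields the rank-two map `σ_{a,b}`. On `ι_{i+1}(C)` the bracket is `r_a l_b ∓ r_b
l_a`, which by `r_l_add` equals `2 r_a l_b - b(a, b)`, that is, `-2` times the second component of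
`t_{a,b}`; on `ι_{i+2}(C)` likewise with `l_r_add`. -/
theorem L_ι_bracket_self {p q : ZMod 2} {a b : C} (ha : a ∈ part k C p) (hb : b ∈ part k C q)
    (i : Fin 3) : glBracket k H.J (H.jmul (H.ιJ i a)) (H.jmul (H.ιJ i b)) =
      (-2 : k) • H.Dtri (H.rotT i a b) := by
  have h2 : (2 : k) ≠ 0 := NeZero.ne 2
  rw [glBracket_hom (H.jmul_mem_part _ _ (H.ιJ_mem ha i)) (H.jmul_mem_part _ _ (H.ιJ_mem hb i))]
  obtain ⟨t0, t1, t2⟩ := H.para.θ_pow_apply (H.para.t a b) i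
  have t0' : (H.rotT i a b : Fin 3 → Module.End k C) i = H.para.σ a b := t0
  have t1' : (H.rotT i a b : Fin 3 → Module.End k C) (i + 1) =
    ((1 / 2 : k) * H.para.b a b) • 1 - H.para.r a * H.para.l b := t1
  have t2' : (H.rotT i a b : Fin 3 → Module.End k C) (i + 2) =
    ((1 / 2 : k) * H.para.b a b) • 1 - H.para.l a * H.para.r b := t2
  have hs := H.b_symm _ _ _ _ ha hb
  refine J_hom_ext_from i ?_ ?_ ?_ (fun c => ?_) (fun c => ?_) (fun c => ?_) <;>
  simp only [LinearMap.sub_apply, LinearMap.neg_apply, Module.End.mul_apply, LinearMap.zero_apply,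
    LinearMap.smul_apply, map_zero, map_smul, map_neg, map_sub, map_add, LinearMap.add_apply,
    Dtri_e, Dtri_ι, jmul_e_e, jmul_e_ι, jmul_ι_e, jmul_ι_self, jmul_ι_succ, jmul_ι_pred, t0', t1',
    t2', Module.End.one_apply, para_b,
    fin3_ne_one, fin3_ne_two, fin3_one_ne_two, (fin3_ne_one i).symm, (fin3_ne_two i).symm,
    (fin3_one_ne_two i).symm, if_true, if_false]
  · simp
  · rw [hs]; module
  · rw [hs]; module
  -- The signs in `σ_{a,b}(c)` depend on the parity of `c`, so this component alone requires `c` to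
  -- be split into homogeneous parts.
  · refine hom_induction (k := k) (P := fun c =>
      (2 * H.b b c) • ((1 / 2 : k) • H.ιJ i a + (1 / 2 : k) • H.ιJ i a) -
        sg k (p * q) • (2 * H.b a c) • ((1 / 2 : k) • H.ιJ i b + (1 / 2 : k) • H.ιJ i b) =
      (-2 : k) • H.ιJ i (H.para.σ a b c)) ?_ ?_ c
    · intro u v hu hv
      simp only [map_add, smul_add (-2 : k), ← hu, ← hv]
      module
    intro r c hc
    have h0 := H.para.b_zero_or ha hc
    have h1 := H.para.b_zero_or hb hc
    rw [H.para.σ_apply ha hb hc, map_sub, map_smul, map_smul]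
    rw [para_b] at *
    rcases parity_cases p with rfl | rfl <;> rcases parity_cases q with rfl | rfl <;>
    rcases parity_cases r with rfl | rfl <;>
    simp only [add_zero, zero_add, mul_zero, mul_one, one_mul, zero_mul, sg_zero, sg_one,
      SymmetricCompositionSuperalgebra.parity_two, zero_ne_one, one_ne_zero, false_or,
      _root_.mul_one, _root_.one_mul] at h0 h1 ⊢ <;>
    (try simp only [h0, h1]) <;> match_scalars <;> field_simp <;> ring
  · have h := congrArg (H.ιJ (i + 1)) (H.para.r_l_add ha hb c)
    simp only [map_add, map_smul, para_b] at h
    linear_combination (norm := skip) -h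
    match_scalars <;> field_simp <;> ring
  · have h := congrArg (H.ιJ (i + 2)) (H.para.l_r_add ha hb c)
    simp only [map_add, map_smul, para_b] at h
    linear_combination (norm := skip) -h
    match_scalars <;> field_simp <;> ring

/-- On the `ι_j(c)` this rests on the three identities used for `D_bracket_ι_one`: `r_r_add`,
`l_l_add` and the associativity of `b`. -/
theorem L_ι_bracket_succ {p q : ZMod 2} {a b : C} (ha : a ∈ part k C p) (hb : b ∈ part k C q)
    (i : Fin 3) : glBracket k H.J (H.jmul (H.ιJ i a)) (H.jmul (H.ιJ (i + 1) b)) =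
      H.D (i + 2) (H.para.l a b) := by
  have h2 : (2 : k) ≠ 0 := NeZero.ne 2
  rw [glBracket_hom (H.jmul_mem_part _ _ (H.ιJ_mem ha i))
    (H.jmul_mem_part _ _ (H.ιJ_mem hb (i + 1)))]
  -- The table of `D_{i+2}`, with its indices counted from `i`.
  have d0 := H.D_e (i + 2)
  have d1 := H.D_e_one (i + 2)
  have d2 := H.D_e_two (i + 2)
  have d3 := H.D_ι (i + 2)
  have d4 := H.D_ι_one (i + 2)
  have d5 := H.D_ι_two (i + 2)
  simp only [fin3_two_one, fin3_two_two] at d1 d2 d3 d4 d5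
  have hr := congrArg (H.ιJ (i + 2)) (H.para.r_comm ha hb)
  rw [map_smul] at hr
  have hss : sg k (p * q) * sg k (p * q) = 1 := by
    rcases sg_cases k (p * q) with h | h <;> simp [h]
  refine J_hom_ext_from i ?_ ?_ ?_ (fun c => ?_) (fun c => ?_) (fun c => ?_) <;>
  simp only [LinearMap.sub_apply, LinearMap.neg_apply, Module.End.mul_apply, LinearMap.zero_apply,
    LinearMap.smul_apply, map_zero, map_smul, map_neg, map_sub, map_add, LinearMap.add_apply,
    jmul_e_e, jmul_e_ι, jmul_ι_e, jmul_ι_self, jmul_ι_succ, jmul_ι_pred, d0, d1, d2, d3, d4, d5,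
    jmul_ι_one_self, jmul_ι_two_self, jmul_ι_one_two, jmul_ι_two_zero, jmul_ι_one_zero,
    jmul_ι_two_one, fin3_one_one, fin3_one_two,
    fin3_ne_one, fin3_ne_two, fin3_one_ne_two, (fin3_ne_one i).symm, (fin3_ne_two i).symm,
    (fin3_one_ne_two i).symm, if_true, if_false]
  · simp
  · rw [hr]; match_scalars; linear_combination (-(1 / 2 : k)) * hss
  · rw [hr]; match_scalars; linear_combination (-(1 / 2 : k)) * hss
  · have h := congrArg (H.ιJ (i + 1)) (H.para.r_r_add ha hb c)
    simp only [map_add, map_smul, para_b] at h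
    linear_combination (norm := skip) h
    match_scalars <;> field_simp <;> ring
  · have h := congrArg (H.ιJ i) (H.para.l_l_add ha hb c)
    simp only [map_add, map_smul, para_b] at h
    linear_combination (norm := skip) -h
    match_scalars <;> field_simp <;> ring
  · have h1 := H.para.b_l_left a b c
    have h3 := H.para.b_r_right ha hb c
    rw [para_b] at h1 h3
    rw [h1, h3]
    rcases sg_cases k (p * q) with h | h <;> simp only [h] <;> match_scalars <;> ring

/-! ### Brackets of the derivations `D_i(a)` -/

/-- Since `D_i(b) = 2 [L_{ι_i(b)}, L_{e_{i+1}}]` and `D_i(a)` is a derivation, the Jacobi identity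
reduces this to brackets of multiplications. The term with `D_i(a)(ι_i(b))` vanishes, as that
element is diagonal. The other contains `D_i(a)(e_{i+1}) = ½ ι_i(a)` and is `-[L_{ι_i(a)},
L_{ι_i(b)}]`. -/
theorem D_bracket_self {p q : ZMod 2} {a b : C} (ha : a ∈ part k C p) (hb : b ∈ part k C q)
    (i : Fin 3) : glBracket k H.J (H.D i a) (H.D i b) = (2 : k) • H.Dtri (H.rotT i a b) := by
  have h2 : (2 : k) ≠ 0 := NeZero.ne 2
  have hs := glBracket_skew (H.jmul_mem_part _ _ (H.ιJ_mem ha i))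
    (H.jmul_mem_part _ _ (H.ιJ_mem hb i))
  rw [L_ι_bracket_self H ha hb] at hs
  conv_lhs => rw [D.eq_1 H i b]
  rw [map_smul, glBracket_jacobi _ (H.D_mem ha i) (H.jmul_mem_part _ _ (H.ιJ_mem hb i)),
    H.der_bracket (H.D_mem_der i a), H.der_bracket (H.D_mem_der i a), D_ι, D_e_one]
  simp only [map_smul, map_sub, LinearMap.smul_apply, LinearMap.sub_apply, L_e_bracket]
  linear_combination (norm := skip) hs
  match_scalars <;> field_simp <;> norm_num

/-- The same reduction: the first term vanishes because `L_{ι_{i+2}(c)}` commutes with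
`L_{e_{i+2}}`, and the second one is `[L_{ι_i(a)}, L_{ι_{i+1}(b)}]`, since `D_i(a)(e_{i+2}) = -½
ι_i(a)`. -/
theorem D_bracket_succ {p q : ZMod 2} {a b : C} (ha : a ∈ part k C p) (hb : b ∈ part k C q)
    (i : Fin 3) : glBracket k H.J (H.D i a) (H.D (i + 1) b) = H.D (i + 2) (H.para.l a b) := by
  have h2 : (2 : k) ≠ 0 := NeZero.ne 2
  have hs := glBracket_skew (H.jmul_mem_part _ _ (H.ιJ_mem ha i))
    (H.jmul_mem_part _ _ (H.ιJ_mem hb (i + 1)))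
  rw [L_ι_bracket_succ H ha hb] at hs
  conv_lhs => rw [D.eq_1 H (i + 1) b]
  rw [map_smul, glBracket_jacobi _ (H.D_mem ha i) (H.jmul_mem_part _ _ (H.ιJ_mem hb (i + 1))),
    H.der_bracket (H.D_mem_der i a), H.der_bracket (H.D_mem_der i a), D_ι_one, fin3_one_one,
    D_e_two]
  simp only [map_smul, map_neg, LinearMap.neg_apply, L_ι_e_bracket]
  rw [hs]
  match_scalars <;> field_simp

theorem Dtri_bracket_D {d : Fin 3 → Module.End k C} (hd : d ∈ H.para.tri) (i : Fin 3) (a : C) :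
    glBracket k H.J (H.Dtri d) (H.D i a) = H.D i (d i a) := by
  have key : ∀ p, ∀ d ∈ H.para.triPart p,
      glBracket k H.J (H.Dtri d) (H.D i a) = H.D i (d i a) := by
    intro p d hd
    refine hom_induction (k := k) (P := fun a =>
      glBracket k H.J (H.Dtri d) (H.D i a) = H.D i (d i a)) ?_ ?_ a
    · intro u v hu hv
      simp only [map_add, D_add, hu, hv]
    intro q a ha
    have hd' := derPart_le _ _ (H.Dtri_mem_derPart hd)
    rw [D, map_smul, glBracket_jacobi _ (H.Dtri_mem fun i => (hd.1 i).1)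
      (H.jmul_mem_part _ _ (H.ιJ_mem ha i)), H.der_bracket hd', H.der_bracket hd', Dtri_ι, Dtri_e,
      map_zero, map_zero, smul_zero, add_zero]
    rfl
  rw [← pr_add (k := k) d, Dtri_add, map_add, LinearMap.add_apply,
    key 0 _ (H.para.mem_tri.1 hd 0), key 1 _ (H.para.mem_tri.1 hd 1), ← D_add]
  rfl

theorem Dtri_bracket_L_ι {d : Fin 3 → Module.End k C} (hd : d ∈ H.para.tri) (i : Fin 3) (a : C) :
    glBracket k H.J (H.Dtri d) (H.jmul (H.ιJ i a)) = H.jmul (H.ιJ i (d i a)) := by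
  rw [H.der_bracket (H.Dtri_mem_der hd), Dtri_ι]

theorem Dtri_bracket_L_e {d : Fin 3 → Module.End k C} (hd : d ∈ H.para.tri) (i : Fin 3) :
    glBracket k H.J (H.Dtri d) (H.jmul (H.e i)) = 0 := by
  rw [H.der_bracket (H.Dtri_mem_der hd), Dtri_e, map_zero]

theorem Dtri_bracket_Dtri (d d' : Fin 3 → Module.End k C) :
    glBracket k H.J (H.Dtri d) (H.Dtri d') =
      H.Dtri (SymmetricCompositionSuperalgebra.tripleBracket k C d d') := by
  refine hom_induction (k := k) (P := fun d => glBracket k H.J (H.Dtri d) (H.Dtri d') =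
      H.Dtri (SymmetricCompositionSuperalgebra.tripleBracket k C d d')) ?_ ?_ d
  · intro u v hu hv
    simp only [map_add, Dtri_add, LinearMap.add_apply, hu, hv]
  intro p d hd
  refine hom_induction (k := k) (P := fun d' => glBracket k H.J (H.Dtri d) (H.Dtri d') =
      H.Dtri (SymmetricCompositionSuperalgebra.tripleBracket k C d d')) ?_ ?_ d'
  · intro u v hu hv
    simp only [map_add, Dtri_add, hu, hv]
  intro q d' hd'
  rw [mem_part_pi] at hd hd'
  rw [glBracket_hom (H.Dtri_mem hd) (H.Dtri_mem hd')]
  refine J_hom_ext (fun i => ?_) (fun i a => ?_)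
  · simp [Dtri_e]
  · simp only [LinearMap.sub_apply, LinearMap.smul_apply, Module.End.mul_apply, Dtri_ι]
    rw [← map_smul, ← map_sub]
    change _ = H.ιJ i (glBracket k C (d i) (d' i) a)
    rw [glBracket_hom (hd i) (hd' i)]
    rfl

end HurwitzSuperalgebra
end Supermagic
end

noncomputable section

namespace Supermagic
namespace HurwitzSuperalgebra

/-! ### The derivations of `H₃(C)` -/

variable {k C : Type*} [Field k] [NeZero (2 : k)] [AddCommGroup C] [Module k C] [Superspace k C]
  (H : HurwitzSuperalgebra k C)

theorem jmul_e_comm (i : Fin 3) (x : H.J) : H.jmul x (H.e i) = H.jmul (H.e i) x := by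
  suffices h : (H.jmul : H.J →ₗ[k] H.J →ₗ[k] H.J).flip (H.e i) = H.jmul (H.e i) by
    rw [← h, LinearMap.flip_apply]
  refine J_hom_ext (fun j => ?_) (fun j a => ?_)
  · rw [LinearMap.flip_apply, jmul_e_e, jmul_e_e]
    split_ifs <;> simp_all
  · rw [LinearMap.flip_apply, jmul_ι_e, jmul_e_ι]

theorem eCoord_jmul_e [Nontrivial C] (i j : Fin 3) (x : H.J) :
    H.eCoord j (H.jmul (H.e i) x) = if i = j then H.eCoord j x else 0 := by
  suffices h : H.eCoord j ∘ₗ H.jmul (H.e i) = if i = j then H.eCoord j else 0 by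
    rw [← LinearMap.comp_apply, h]
    split_ifs <;> rfl
  refine J_hom_ext (fun l => ?_) (fun l a => ?_)
  · rw [LinearMap.comp_apply, jmul_e_e]
    split_ifs <;> simp_all [eCoord_e, eq_comm]
  · rw [LinearMap.comp_apply, jmul_e_ι]
    split_ifs <;> simp [eCoord_ι]

theorem ιCoord_jmul_e (i j : Fin 3) (x : H.J) :
    H.ιCoord j (H.jmul (H.e i) x) = if i = j then 0 else (1 / 2 : k) • H.ιCoord j x := by
  suffices h : H.ιCoord j ∘ₗ H.jmul (H.e i) = if i = j then 0 else (1 / 2 : k) • H.ιCoord j by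
    rw [← LinearMap.comp_apply, h]
    split_ifs <;> rfl
  refine J_hom_ext (fun l => ?_) (fun l a => ?_)
  · rw [LinearMap.comp_apply, jmul_e_e]
    split_ifs <;> simp [ιCoord_e]
  · rw [LinearMap.comp_apply, jmul_e_ι]
    split_ifs <;> simp_all [ιCoord_ι, eq_comm]

theorem half_ne : (1 / 2 : k) ≠ 0 := one_div_ne_zero (NeZero.ne 2)

theorem eq_zero_of_eq_half_smul {M : Type*} [AddCommGroup M] [Module k M] {x : M}
    (h : (1 / 2 : k) • x = x) : x = 0 := by
  have h2 : (2 : k) ≠ 0 := NeZero.ne 2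
  have h3 : (1 / 2 : k) • x = 0 := by
    have : (2 : k) • ((1 / 2 : k) • x) = (2 : k) • x := by rw [h]
    rw [smul_smul, mul_one_div_cancel h2, one_smul, two_smul] at this
    rw [h]; simpa using this
  rw [← h, h3]

theorem der_mul_e {d : Module.End k H.J} (hd : d ∈ H.derJ) (i : Fin 3) (x : H.J) :
    d (H.jmul (H.e i) x) = H.jmul (H.e i) (d x) + H.jmul (d (H.e i)) x := by
  have h := LinearMap.congr_fun (H.der_bracket hd (H.e i)) x
  rw [glBracket_even_right (H.jmul_mem_part _ _ (H.e_mem i))] at h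
  rw [← h]
  simp

/-- A derivation applied to `e_i ∘ e_j = 0` and to `e_i ∘ e_i = e_i`, coordinate by coordinate,
constrains `d(e_i)`. This lemma and the next two leave only three free elements of `C`, one for each
pair of idempotents. -/
theorem ιCoord_der_e {d : Module.End k H.J} (hd : d ∈ H.derJ)
    (i j l : Fin 3) (hij : i ≠ j) (hil : i ≠ l) (hjl : j ≠ l) :
    H.ιCoord l (d (H.e i)) = -H.ιCoord l (d (H.e j)) := by
  have h := congrArg (H.ιCoord l) (H.der_mul_e hd i (H.e j))
  rw [jmul_e_e, if_neg hij, map_zero, map_zero, map_add, jmul_e_comm, ιCoord_jmul_e,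
    ιCoord_jmul_e, if_neg hil, if_neg hjl, ← smul_add] at h
  have h' := (smul_eq_zero.1 h.symm).resolve_left half_ne
  exact eq_neg_of_add_eq_zero_right h'

theorem ιCoord_der_e_self {d : Module.End k H.J} (hd : d ∈ H.derJ) (i : Fin 3) :
    H.ιCoord i (d (H.e i)) = 0 := by
  have h := congrArg (H.ιCoord i) (H.der_mul_e hd i (H.e i))
  rwa [jmul_e_e, if_pos rfl, map_add, jmul_e_comm, ιCoord_jmul_e, if_pos rfl, add_zero] at h

theorem eCoord_der_e [Nontrivial C] {d : Module.End k H.J} (hd : d ∈ H.derJ) (i j : Fin 3) :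
    H.eCoord j (d (H.e i)) = 0 := by
  have h := congrArg (H.eCoord j) (H.der_mul_e hd i (H.e i))
  rw [jmul_e_e, if_pos rfl, map_add, jmul_e_comm, eCoord_jmul_e] at h
  -- For `i = j` the equation is `c = c + c`, otherwise it is `c = 0`.
  split_ifs at h
  · simpa using h
  · simpa using h

/-- The coefficients are forced: among the three `D_l`, only `D_i` gives `e_{i+1}` an
`ι_i`-component, namely `½ ι_i(a)`, whence the factor `2`. Subtracting this sum reduces any
derivation to one that kills the `e_j`. -/
theorem der_e_eq [Nontrivial C] {d : Module.End k H.J} (hd : d ∈ H.derJ) (j : Fin 3) :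
    d (H.e j) = ∑ i, H.D i ((2 : k) • H.ιCoord i (d (H.e (i + 1)))) (H.e j) := by
  have h2 : (2 : k) ≠ 0 := NeZero.ne 2
  have d1 := H.D_e_two (j + 1)
  have d2 := H.D_e_one (j + 2)
  rw [fin3_one_two] at d1
  rw [fin3_two_one] at d2
  rw [fin3_sum _ j, D_e, d1, d2, fin3_one_one, fin3_two_one]
  conv_lhs => rw [H.sum_coord (d (H.e j)), fin3_sum (fun i => H.ιJ i _) j]
  rw [H.ιCoord_der_e_self hd, H.ιCoord_der_e hd j (j + 2) (j + 1) (fin3_ne_two j) (fin3_ne_one j)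
    (fin3_one_ne_two j).symm]
  simp only [H.eCoord_der_e hd, zero_smul, Finset.sum_const_zero, map_smul, map_zero, map_neg]
  match_scalars <;> field_simp

/-- A derivation that kills the idempotents `e_i` acts diagonally. -/
theorem der_ι_eq [Nontrivial C] {d : Module.End k H.J} (hd : d ∈ H.derJ) (h0 : ∀ i, d (H.e i) = 0)
    (i : Fin 3) (a : C) : d (H.ιJ i a) = H.ιJ i (H.ιCoord i (d (H.ιJ i a))) := by
  -- Such a `d` commutes with every `L_{e_j}` and hence preserves their joint eigenspaces. On
  -- `ι_i(C)` the eigenvalues are `0` for `j = i` and `½` otherwise, which rules out all other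
  -- components.
  have h : ∀ j x, d (H.jmul (H.e j) x) = H.jmul (H.e j) (d x) := fun j x => by
    rw [H.der_mul_e hd, h0, map_zero, LinearMap.zero_apply, add_zero]
  have hi : H.jmul (H.e i) (d (H.ιJ i a)) = 0 := by
    rw [← h, jmul_e_ι, if_pos rfl, map_zero]
  have hj : ∀ j, j ≠ i → H.jmul (H.e j) (d (H.ιJ i a)) = (1 / 2 : k) • d (H.ιJ i a) := by
    intro j hj
    rw [← h, jmul_e_ι, if_neg hj, map_smul]
  apply J_ext
  · intro j
    rw [eCoord_ι]
    by_cases hji : j = i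
    · subst hji
      have := congrArg (H.eCoord j) hi
      rwa [eCoord_jmul_e, if_pos rfl, map_zero] at this
    · have := congrArg (H.eCoord j) (hj j hji)
      rw [eCoord_jmul_e, if_pos rfl, map_smul] at this
      exact eq_zero_of_eq_half_smul this.symm
  · intro l
    rw [ιCoord_ι]
    split_ifs with hl
    · rw [hl]
    · have := congrArg (H.ιCoord l) hi
      rw [ιCoord_jmul_e, if_neg (Ne.symm hl), map_zero] at this
      exact (smul_eq_zero.1 this).resolve_left half_ne

/-- Converse of `Dtri_mem_derPart`. The coefficient of `e_{i+1}` in the rule on `ι_i(x) ∘ ι_i(y)`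
gives the orthosymplectic condition, with a factor `2` to cancel; the rule on `ι_1(x) ∘ ι_2(y) =
ι_0(x • y)` is triality. -/
theorem mem_triPart_of_der [Nontrivial C] {p : ZMod 2} {d : Module.End k H.J}
    (hd : d ∈ derPart H.jmul p) (h0 : ∀ i, d (H.e i) = 0) :
    ∃ t ∈ H.para.triPart p, d = H.Dtri t := by
  have hι := H.der_ι_eq (derPart_le _ _ hd) h0
  refine ⟨fun i => H.ιCoord i ∘ₗ d ∘ₗ H.ιJ i, ⟨fun i => ⟨?_, ?_⟩, ?_⟩, ?_⟩
  · rw [mem_part_hom]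
    intro q x hx
    exact H.ιCoord_mem (mem_part_hom.1 hd.1 _ _ (H.ιJ_mem hx i)) i
  · intro q x y hx
    have h := hd.2 q _ (H.ιJ i y) (H.ιJ_mem hx i)
    rw [hι i x, hι i y, jmul_ι_self, jmul_ι_self, jmul_ι_self, map_smul, map_add, h0, h0, add_zero,
      smul_zero] at h
    have h' := congrArg (H.eCoord (i + 1)) h
    simp only [map_zero, map_add, map_smul, eCoord_e, fin3_one_ne_two, if_true, if_false,
      smul_eq_mul] at h'
    have h2 : (2 : k) ≠ 0 := NeZero.ne 2
    apply mul_left_cancel₀ h2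
    change 2 * (H.b _ y + sg k (p * q) * H.b x _) = _
    simp only [LinearMap.comp_apply]
    linear_combination -h'
  · intro q x y hx
    have h := hd.2 q _ (H.ιJ 2 y) (H.ιJ_mem hx 1)
    rw [hι 1 x, hι 2 y] at h
    have e1 : ∀ x y, H.jmul (H.ιJ 1 x) (H.ιJ 2 y) = H.ιJ 0 (H.para.mul x y) :=
      H.jmul_ι_succ 1
    rw [e1, e1, e1, hι 0, ← map_smul, ← map_add] at h
    exact H.ιJ_injective 0 h
  · refine J_hom_ext (fun i => ?_) (fun i a => ?_)
    · rw [h0, Dtri_e]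
    · rw [Dtri_ι, hι]
      rfl

theorem exists_of_mem_derPart [Nontrivial C] {p : ZMod 2} {d : Module.End k H.J}
    (hd : d ∈ derPart H.jmul p) :
    ∃ t ∈ H.para.tri, ∃ a : Fin 3 → C, d = H.Dtri t + ∑ i, H.D i (a i) := by
  set a : Fin 3 → C := fun i => (2 : k) • H.ιCoord i (d (H.e (i + 1))) with ha
  have hap : ∀ i, a i ∈ part k C p := fun i => by
    refine Submodule.smul_mem _ _ (H.ιCoord_mem ?_ i)
    have := mem_part_hom.1 hd.1 _ _ (H.e_mem (i + 1))
    rwa [add_zero] at this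
  have hd' : d - ∑ i, H.D i (a i) ∈ derPart H.jmul p :=
    Submodule.sub_mem _ hd (Submodule.sum_mem _ fun i _ => H.D_mem_derPart (hap i) i)
  obtain ⟨t, ht, h⟩ := H.mem_triPart_of_der hd' fun j => by
    rw [LinearMap.sub_apply, H.der_e_eq (derPart_le _ _ hd) j, LinearMap.sum_apply, sub_self]
  exact ⟨t, H.para.triPart_le _ ht, a, by rw [← h]; abel⟩

/-- Every derivation of `J` is of the form `D_{(d₀,d₁,d₂)} + ∑ D_i(a_i)`. -/
theorem exists_of_mem_der [Nontrivial C] {d : Module.End k H.J} (hd : d ∈ H.derJ) :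
    ∃ t ∈ H.para.tri, ∃ a : Fin 3 → C, d = H.Dtri t + ∑ i, H.D i (a i) := by
  obtain ⟨t, ht, a, h⟩ := H.exists_of_mem_derPart (mem_der.1 hd 0)
  obtain ⟨t', ht', a', h'⟩ := H.exists_of_mem_derPart (mem_der.1 hd 1)
  refine ⟨t + t', Submodule.add_mem _ ht ht', a + a', ?_⟩
  rw [← pr_add (k := k) d, h, h', Dtri_add]
  simp only [Pi.add_apply, D_add, Finset.sum_add_distrib]
  abel

theorem D_sum_apply_e (a : Fin 3 → C) (j : Fin 3) : (∑ i, H.D i (a i)) (H.e j) =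
    (1 / 2 : k) • H.ιJ (j + 2) (a (j + 2)) - (1 / 2 : k) • H.ιJ (j + 1) (a (j + 1)) := by
  have d1 := H.D_e_two (j + 1)
  have d2 := H.D_e_one (j + 2)
  rw [fin3_one_two] at d1
  rw [fin3_two_one] at d2
  rw [fin3_sum _ j]
  simp only [LinearMap.add_apply, D_e, d1, d2]
  abel

/-- The triple and the `a_i` are determined by the derivation. -/
theorem eq_zero_of_der_eq_zero {t : Fin 3 → Module.End k C} {a : Fin 3 → C}
    (h : H.Dtri t + ∑ i, H.D i (a i) = 0) : t = 0 ∧ a = 0 := by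
  have ha : a = 0 := by
    funext i
    -- The triple kills `e_{i+1}`, and the `ι_i`-component of the remaining sum there is `½ a_i`.
    have h1 := congrArg (H.ιCoord i) (LinearMap.congr_fun h (H.e (i + 1)))
    rw [LinearMap.add_apply, Dtri_e, D_sum_apply_e, fin3_one_one, fin3_one_two] at h1
    simp only [zero_add, map_sub, map_smul, ιCoord_ι, if_true, if_neg (fin3_ne_two i), smul_zero,
      sub_zero, LinearMap.zero_apply, map_zero] at h1
    exact (smul_eq_zero.1 h1).resolve_left half_ne
  subst ha
  refine ⟨?_, rfl⟩
  have hD : ∀ i, H.D i 0 = 0 := fun i => by simp [D]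
  simp only [Pi.zero_apply, hD, Finset.sum_const_zero, add_zero] at h
  funext i
  ext c
  have h1 := LinearMap.congr_fun h (H.ιJ i c)
  rw [Dtri_ι, LinearMap.zero_apply, ← map_zero (H.ιJ i)] at h1
  exact H.ιJ_injective i h1

/-! ### The structure Lie superalgebra -/

variable {H} in
theorem J_induction {P : H.J → Prop} (hadd : ∀ x y, P x → P y → P (x + y))
    (hsmul : ∀ (c : k) x, P x → P (c • x))
    (he : ∀ i, P (H.e i)) (hι : ∀ i p, ∀ a ∈ part k C p, P (H.ιJ i a)) (x : H.J) : P x := by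
  have hι' : ∀ i a, P (H.ιJ i a) := fun i a =>
    hom_induction (k := k) (P := fun a => P (H.ιJ i a))
      (fun u v hu hv => by rw [map_add]; exact hadd _ _ hu hv) (hι i) a
  rw [H.sum_coord x, Fin.sum_univ_three, Fin.sum_univ_three]
  exact hadd _ _ (hadd _ _ (hadd _ _ (hsmul _ _ (he _)) (hsmul _ _ (he _))) (hsmul _ _ (he _)))
    (hadd _ _ (hadd _ _ (hι' _ _) (hι' _ _)) (hι' _ _))

theorem L_ι_e_bracket_mem (i j : Fin 3) (a : C) :
    glBracket k H.J (H.jmul (H.ιJ i a)) (H.jmul (H.e j)) ∈ H.derJ := by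
  revert j
  refine fin3_forall i ?_ ?_ ?_
  · rw [L_ι_e_bracket]; exact Submodule.zero_mem _
  · rw [L_ι_e_one_bracket]; exact Submodule.smul_mem _ _ (H.D_mem_der _ _)
  · rw [L_ι_e_two_bracket]
    exact Submodule.neg_mem _ (Submodule.smul_mem _ _ (H.D_mem_der _ _))

/-- The brackets `[L_x, L_y]` are derivations. -/
theorem L_bracket_mem (x y : H.J) : glBracket k H.J (H.jmul x) (H.jmul y) ∈ H.derJ := by
  revert x
  refine J_induction (fun x x' hx hx' => ?_) (fun c x hx => ?_) (fun i => ?_) (fun i p a ha => ?_)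
  · rw [map_add, map_add, LinearMap.add_apply]; exact Submodule.add_mem _ hx hx'
  · rw [map_smul, map_smul, LinearMap.smul_apply]; exact Submodule.smul_mem _ _ hx
  all_goals
    revert y
    refine J_induction (fun y y' hy hy' => ?_) (fun c y hy => ?_) ?_ ?_
    · rw [map_add, map_add]; exact Submodule.add_mem _ hy hy'
    · rw [map_smul, map_smul]; exact Submodule.smul_mem _ _ hy
  · intro j
    rw [L_e_bracket]; exact Submodule.zero_mem _
  · intro j q b hb
    rw [glBracket_skew (H.jmul_mem_part _ _ (H.e_mem i)) (H.jmul_mem_part _ _ (H.ιJ_mem hb j))]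
    exact Submodule.neg_mem _ (Submodule.smul_mem _ _ (H.L_ι_e_bracket_mem _ _ _))
  · exact fun j => H.L_ι_e_bracket_mem _ _ _
  · refine fin3_forall i (fun q b hb => ?_) (fun q b hb => ?_) (fun q b hb => ?_)
    · rw [H.L_ι_bracket_self ha hb]
      exact Submodule.smul_mem _ _ (H.Dtri_mem_der (H.rotT i a b).2)
    · rw [H.L_ι_bracket_succ ha hb]
      exact H.D_mem_der _ _
    -- As `i` is the successor of `i + 2`, the pair `(i, i + 2)` is a successor pair in reverse
    -- order.
    · have h := H.L_ι_bracket_succ hb ha (i + 2)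
      rw [fin3_two_one] at h
      rw [glBracket_skew (H.jmul_mem_part _ _ (H.ιJ_mem ha i))
        (H.jmul_mem_part _ _ (H.ιJ_mem hb (i + 2))), h]
      exact Submodule.neg_mem _ (Submodule.smul_mem _ _ (H.D_mem_der _ _))

theorem L_der_bracket_mem {d : Module.End k H.J} (hd : d ∈ H.derJ) (x : H.J) :
    glBracket k H.J (H.jmul x) d ∈ LinearMap.range H.jmul := by
  have key : ∀ p, ∀ d ∈ derPart H.jmul p,
      glBracket k H.J (H.jmul x) d ∈ LinearMap.range H.jmul := by
    intro p d hd
    refine hom_induction (k := k) (P := fun x =>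
      glBracket k H.J (H.jmul x) d ∈ LinearMap.range H.jmul) ?_ ?_ x
    · intro u v hu hv
      rw [map_add, map_add, LinearMap.add_apply]; exact Submodule.add_mem _ hu hv
    intro q x hx
    rw [glBracket_skew (H.jmul_mem_part _ _ hx) hd.1, H.der_bracket (derPart_le _ _ hd)]
    exact Submodule.neg_mem _ (Submodule.smul_mem _ _ (LinearMap.mem_range_self _ _))
  rw [← pr_add (k := k) d, map_add]
  exact Submodule.add_mem _ (key 0 _ (mem_der.1 hd 0)) (key 1 _ (mem_der.1 hd 1))

theorem pr_jmul (p : ZMod 2) (x : H.J) : pr k p (H.jmul x) = H.jmul (pr k p x) :=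
  pr_map_of_even H.jmul_mem_part p x

theorem derJ_le_str : H.derJ ≤ H.str := le_sInf fun _ hN => hN.2.2.1

theorem range_jmul_le_str : LinearMap.range H.jmul ≤ H.str := le_sInf fun _ hN => hN.2.2.2

/-- The sum is graded and closed because `[der J, L_J] ⊆ L_J` and `[L_J, L_J] ⊆ der J`, so
minimality of `str J` applies. -/
theorem str_eq : H.str = H.derJ ⊔ LinearMap.range H.jmul := by
  apply le_antisymm
  · refine sInf_le ⟨?_, ?_, le_sup_left, le_sup_right⟩
    · intro p f hf
      obtain ⟨d, hd, _, ⟨x, rfl⟩, rfl⟩ := Submodule.mem_sup.1 hf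
      rw [map_add, pr_jmul]
      exact Submodule.add_mem_sup (pr_mem_der hd p) (LinearMap.mem_range_self _ _)
    · intro f hf g hg
      obtain ⟨d, hd, _, ⟨x, rfl⟩, rfl⟩ := Submodule.mem_sup.1 hf
      obtain ⟨d', hd', _, ⟨y, rfl⟩, rfl⟩ := Submodule.mem_sup.1 hg
      rw [map_add, map_add, LinearMap.add_apply, LinearMap.add_apply, H.der_bracket hd]
      refine Submodule.add_mem _ (Submodule.add_mem _ ?_ ?_) (Submodule.add_mem _ ?_ ?_)
      · exact Submodule.mem_sup_left (der_closed _ _ hd _ hd')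
      · exact Submodule.mem_sup_right (H.L_der_bracket_mem hd' x)
      · exact Submodule.mem_sup_right (LinearMap.mem_range_self _ _)
      · exact Submodule.mem_sup_left (H.L_bracket_mem x y)
  · exact sup_le H.derJ_le_str H.range_jmul_le_str

/-- `L_{d(1)} = [d, L_1] = [d, I] = 0`, and evaluation at the unit gives `d(1) = 0`. -/
theorem der_apply_one {d : Module.End k H.J} (hd : d ∈ H.derJ) :
    d (H.e 0 + H.e 1 + H.e 2) = 0 := by
  have h := H.der_bracket hd (H.e 0 + H.e 1 + H.e 2)
  rw [jmul_sum_e, glBracket_one_right] at h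
  have h' := H.jmul_apply_sum_e (d (H.e 0 + H.e 1 + H.e 2))
  rw [← h'] 
  rw [← h, LinearMap.zero_apply]

/-- The component in `J` of an element of `der J ⊕ L_J` that vanishes is zero. -/
theorem eq_zero_of_der_add_jmul {d : Module.End k H.J} (hd : d ∈ H.derJ) {x : H.J}
    (h : d + H.jmul x = 0) : d = 0 ∧ x = 0 := by
  -- Evaluation at the unit separates the summands: `d` gives `0` and `L_x` gives `x`.
  have h' := LinearMap.congr_fun h (H.e 0 + H.e 1 + H.e 2)
  rw [LinearMap.add_apply, H.der_apply_one hd, jmul_apply_sum_e, zero_add,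
    LinearMap.zero_apply] at h'
  subst h'
  rw [map_zero, add_zero] at h
  exact ⟨h, rfl⟩

theorem disjoint_derJ : Disjoint H.derJ (LinearMap.range H.jmul) := by
  rw [Submodule.disjoint_def]
  rintro _ hd ⟨x, rfl⟩
  have h := H.eq_zero_of_der_add_jmul hd (x := -x) (by rw [map_neg, add_neg_cancel])
  exact h.1

theorem isLieSuperalgebra_derBracket : IsLieSuperalgebra (derBracket H.jmul) :=
  isLieSuperalgebra_subBracket isLieSuperalgebra_gl _ _ _

theorem isLieSuperalgebra_pstrBracket : IsLieSuperalgebra H.pstrBracket :=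
  isLieSuperalgebra_quotBracket
    (isLieSuperalgebra_subBracket isLieSuperalgebra_gl _ _ H.str_closed) _ _ _ _

end HurwitzSuperalgebra
end Supermagic
end

noncomputable section

namespace Supermagic
namespace SymmetricCompositionSuperalgebra

/-! ### The bracket of `g(S, S')` on generators -/

section Generators

variable {k V V' : Type*} [Field k]
  [AddCommGroup V] [Module k V] [Superspace k V]
  [AddCommGroup V'] [Module k V'] [Superspace k V']
  (S : SymmetricCompositionSuperalgebra k V) (S' : SymmetricCompositionSuperalgebra k V')

theorem prTriL_inTriL (d : S.tri) : prTriL S S' (inTriL S S' d) = d := rfl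
theorem prTriR_inTriL (d : S.tri) : prTriR S S' (inTriL S S' d) = 0 := rfl
theorem prι_inTriL (d : S.tri) (i : Fin 3) : prι S S' i (inTriL S S' d) = 0 := rfl
theorem prTriL_inTriR (d : S'.tri) : prTriL S S' (inTriR S S' d) = 0 := rfl
theorem prTriR_inTriR (d : S'.tri) : prTriR S S' (inTriR S S' d) = d := rfl
theorem prι_inTriR (d : S'.tri) (i : Fin 3) : prι S S' i (inTriR S S' d) = 0 := rfl
theorem prTriL_ι (i : Fin 3) (w : V ⊗[k] V') : prTriL S S' (ι S S' i w) = 0 := rfl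
theorem prTriR_ι (i : Fin 3) (w : V ⊗[k] V') : prTriR S S' (ι S S' i w) = 0 := rfl
theorem prι_ι (i j : Fin 3) (w : V ⊗[k] V') :
    prι S S' j (ι S S' i w) = if j = i then w else 0 := Pi.single_apply i w j

theorem inTriR_add (d d' : S'.tri) :
    inTriR S S' (d + d') = inTriR S S' d + inTriR S S' d' := by
  refine G_ext ?_ ?_ (fun j => ?_) <;>
    simp [prTriL_inTriR, prTriR_inTriR, prι_inTriR]

theorem ι_add (i : Fin 3) (w w' : V ⊗[k] V') :
    ι S S' i (w + w') = ι S S' i w + ι S S' i w' := by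
  refine G_ext ?_ ?_ (fun j => ?_)
  · simp [prTriL_ι]
  · simp [prTriR_ι]
  · rw [map_add, prι_ι, prι_ι, prι_ι]
    split_ifs <;> simp

theorem ι_smul (i : Fin 3) (c : k) (w : V ⊗[k] V') :
    ι S S' i (c • w) = c • ι S S' i w := by
  refine G_ext ?_ ?_ (fun j => ?_)
  · simp [prTriL_ι]
  · simp [prTriR_ι]
  · rw [map_smul, prι_ι, prι_ι]
    split_ifs <;> simp

theorem G_decomp (X : G S S') : X = inTriL S S' (prTriL S S' X) + inTriR S S' (prTriR S S' X) +
    ∑ i, ι S S' i (prι S S' i X) := by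
  refine G_ext ?_ ?_ (fun j => ?_)
  · simp [prTriL_inTriL, prTriL_inTriR, prTriL_ι]
  · simp [prTriR_inTriL, prTriR_inTriR, prTriR_ι]
  · simp [prι_inTriL, prι_inTriR, prι_ι]

variable {S S'} in
/-- An additive property of elements of `g(S, S')` may be tested on generators. -/
theorem G_induction {P : G S S' → Prop} (hadd : ∀ X Y, P X → P Y → P (X + Y))
    (hL : ∀ d, P (inTriL S S' d)) (hR : ∀ p, ∀ d ∈ part k S'.tri p, P (inTriR S S' d))
    (hι : ∀ i x p, ∀ x' ∈ part k V' p, P (ι S S' i (x ⊗ₜ x'))) (X : G S S') : P X := by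
  have hι' : ∀ i w, P (ι S S' i w) := by
    intro i w
    induction w using TensorProduct.induction_on with
    | zero => simpa using hι i 0 0 0 (Submodule.zero_mem _)
    | tmul x x' =>
      refine hom_induction (k := k) (P := fun x' => P (ι S S' i (x ⊗ₜ x'))) ?_ (hι i x) x'
      intro u v hu hv
      rw [TensorProduct.tmul_add, ι_add]
      exact hadd _ _ hu hv
    | add w z hw hz => rw [ι_add]; exact hadd _ _ hw hz
  have hR' : ∀ d, P (inTriR S S' d) :=
    hom_induction (k := k) (fun u v hu hv => by rw [inTriR_add]; exact hadd _ _ hu hv) hR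
  rw [G_decomp S S' X, Fin.sum_univ_three]
  exact hadd _ _ (hadd _ _ (hL _) (hR' _)) (hadd _ _ (hadd _ _ (hι' _ _) (hι' _ _)) (hι' _ _))

theorem mem_part_G {p : ZMod 2} {X : G S S'} : X ∈ part k (G S S') p ↔
    prTriL S S' X ∈ part k S.tri p ∧ prTriR S S' X ∈ part k S'.tri p ∧
      ∀ i, prι S S' i X ∈ part k (V ⊗[k] V') p := by
  constructor
  · intro h
    exact ⟨congrArg (prTriL S S') h, congrArg (prTriR S S') h,
      fun i => congrArg (prι S S' i) h⟩
  · rintro ⟨h1, h2, h3⟩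
    exact G_ext h1 h2 h3

theorem inTriL_mem {p : ZMod 2} {d : S.tri} (hd : d ∈ part k S.tri p) :
    inTriL S S' d ∈ part k (G S S') p :=
  (mem_part_G S S').2 ⟨hd, Submodule.zero_mem _, fun _ => Submodule.zero_mem _⟩

theorem inTriR_mem {p : ZMod 2} {d : S'.tri} (hd : d ∈ part k S'.tri p) :
    inTriR S S' d ∈ part k (G S S') p :=
  (mem_part_G S S').2 ⟨Submodule.zero_mem _, hd, fun _ => Submodule.zero_mem _⟩

theorem ι_mem {p : ZMod 2} {w : V ⊗[k] V'} (hw : w ∈ part k (V ⊗[k] V') p) (i : Fin 3) :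
    ι S S' i w ∈ part k (G S S') p := by
  refine (mem_part_G S S').2 ⟨Submodule.zero_mem _, Submodule.zero_mem _, fun j => ?_⟩
  rw [prι_ι]
  split_ifs
  exacts [hw, Submodule.zero_mem _]

variable [NeZero (2 : k)]

theorem prTriL_gBracket (X Y : G S S') : prTriL S S' (gBracket S S' X Y) =
    S.triBracket (prTriL S S' X) (prTriL S S' Y) +
      ∑ i : Fin 3, (S.θ ^ (i : ℕ)) (tL S S' (prι S S' i X) (prι S S' i Y)) := rfl

theorem prTriR_gBracket (X Y : G S S') : prTriR S S' (gBracket S S' X Y) =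
    S'.triBracket (prTriR S S' X) (prTriR S S' Y) +
      ∑ i : Fin 3, (S'.θ ^ (i : ℕ)) (tR S S' (prι S S' i X) (prι S S' i Y)) := rfl

theorem prι_gBracket (X Y : G S S') (j : Fin 3) : prι S S' j (gBracket S S' X Y) =
    S.actL V' j (prTriL S S' X) (prι S S' j Y) + S'.actR V j (prTriR S S' X) (prι S S' j Y)
      - superflip (S.actL V' j) (prι S S' j X) (prTriL S S' Y)
      - superflip (S'.actR V j) (prι S S' j X) (prTriR S S' Y)
      + mulT S S' (prι S S' (j + 1) X) (prι S S' (j + 2) Y)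
      - superflip (mulT S S') (prι S S' (j + 2) X) (prι S S' (j + 1) Y) := rfl

theorem gBracket_inTriL_inTriL (d d' : S.tri) : gBracket S S' (inTriL S S' d) (inTriL S S' d') =
    inTriL S S' (S.triBracket d d') := by
  refine G_ext ?_ ?_ (fun j => ?_) <;>
    simp [prTriL_gBracket, prTriR_gBracket, prι_gBracket, prTriL_inTriL, prTriR_inTriL, prι_inTriL]

theorem gBracket_inTriR_inTriR (d d' : S'.tri) : gBracket S S' (inTriR S S' d) (inTriR S S' d') =
    inTriR S S' (S'.triBracket d d') := by
  refine G_ext ?_ ?_ (fun j => ?_) <;>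
    simp [prTriL_gBracket, prTriR_gBracket, prι_gBracket, prTriL_inTriR, prTriR_inTriR, prι_inTriR]

theorem gBracket_inTriL_inTriR (d : S.tri) (d' : S'.tri) :
    gBracket S S' (inTriL S S' d) (inTriR S S' d') = 0 := by
  refine G_ext ?_ ?_ (fun j => ?_) <;>
    simp [prTriL_gBracket, prTriR_gBracket, prι_gBracket, prTriL_inTriR, prTriR_inTriR, prι_inTriR,
      prTriL_inTriL, prTriR_inTriL, prι_inTriL]

theorem gBracket_inTriR_inTriL (d : S.tri) (d' : S'.tri) :
    gBracket S S' (inTriR S S' d') (inTriL S S' d) = 0 := by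
  refine G_ext ?_ ?_ (fun j => ?_) <;>
    simp [prTriL_gBracket, prTriR_gBracket, prι_gBracket, prTriL_inTriR, prTriR_inTriR, prι_inTriR,
      prTriL_inTriL, prTriR_inTriL, prι_inTriL]

theorem gBracket_inTriL_ι (d : S.tri) (i : Fin 3) (w : V ⊗[k] V') :
    gBracket S S' (inTriL S S' d) (ι S S' i w) = ι S S' i (S.actL V' i d w) := by
  refine G_ext ?_ ?_ (fun j => ?_) <;>
    simp [prTriL_gBracket, prTriR_gBracket, prι_gBracket, prTriL_inTriL, prTriR_inTriL, prι_inTriL,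
      prTriL_ι, prTriR_ι, prι_ι]
  split_ifs with h
  · rw [h]
  · simp

theorem gBracket_inTriR_ι (d : S'.tri) (i : Fin 3) (w : V ⊗[k] V') :
    gBracket S S' (inTriR S S' d) (ι S S' i w) = ι S S' i (S'.actR V i d w) := by
  refine G_ext ?_ ?_ (fun j => ?_) <;>
    simp [prTriL_gBracket, prTriR_gBracket, prι_gBracket, prTriL_inTriR, prTriR_inTriR, prι_inTriR,
      prTriL_ι, prTriR_ι, prι_ι]
  split_ifs with h
  · rw [h]
  · simp

theorem gBracket_ι_inTriL (d : S.tri) (i : Fin 3) (w : V ⊗[k] V') :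
    gBracket S S' (ι S S' i w) (inTriL S S' d) =
      -ι S S' i (superflip (S.actL V' i) w d) := by
  refine G_ext ?_ ?_ (fun j => ?_) <;>
    simp [prTriL_gBracket, prTriR_gBracket, prι_gBracket, prTriL_inTriL, prTriR_inTriL, prι_inTriL,
      prTriL_ι, prTriR_ι, prι_ι]
  split_ifs with h
  · rw [h]
  · simp

theorem gBracket_ι_inTriR (d : S'.tri) (i : Fin 3) (w : V ⊗[k] V') :
    gBracket S S' (ι S S' i w) (inTriR S S' d) =
      -ι S S' i (superflip (S'.actR V i) w d) := by
  refine G_ext ?_ ?_ (fun j => ?_) <;>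
    simp [prTriL_gBracket, prTriR_gBracket, prι_gBracket, prTriL_inTriR, prTriR_inTriR, prι_inTriR,
      prTriL_ι, prTriR_ι, prι_ι]
  split_ifs with h
  · rw [h]
  · simp

theorem gBracket_ι_self (i : Fin 3) (w z : V ⊗[k] V') :
    gBracket S S' (ι S S' i w) (ι S S' i z) =
      inTriL S S' ((S.θ ^ (i : ℕ)) (tL S S' w z)) +
        inTriR S S' ((S'.θ ^ (i : ℕ)) (tR S S' w z)) := by
  refine G_ext ?_ ?_ (fun j => ?_)
  · simp only [prTriL_gBracket, prTriL_ι, prι_ι, map_add, prTriL_inTriL, prTriL_inTriR, map_zero,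
      zero_add, add_zero]
    rw [Finset.sum_eq_single i]
    · simp
    · intro b _ hb; simp [hb]
    · simp
  · simp only [prTriR_gBracket, prTriR_ι, prι_ι, map_add, prTriR_inTriL, prTriR_inTriR, map_zero,
      zero_add]
    rw [Finset.sum_eq_single i]
    · simp
    · intro b _ hb; simp [hb]
    · simp
  · simp only [prι_gBracket, prTriL_ι, prTriR_ι, prι_ι, map_add, prι_inTriL, prι_inTriR, map_zero,
      LinearMap.zero_apply, sub_zero, zero_add]
    -- A mixed product needs elements at two different places, whereas both arguments are supported
    -- at `i`.
    have h : j + 1 ≠ j + 2 := fin3_one_ne_two j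
    by_cases h1 : j + 1 = i
    · have h2 : j + 2 ≠ i := fun h2 => h (h1.trans h2.symm)
      simp [h2]
    · simp [h1]

theorem gBracket_ι_succ (i : Fin 3) (w z : V ⊗[k] V') :
    gBracket S S' (ι S S' i w) (ι S S' (i + 1) z) = ι S S' (i + 2) (mulT S S' w z) := by
  refine G_ext ?_ ?_ (fun j => ?_)
  · simp only [prTriL_gBracket, prTriL_ι, prι_ι, map_zero, zero_add]
    refine Finset.sum_eq_zero fun j _ => ?_
    by_cases h : j = i
    · subst h; simp [fin3_ne_one]
    · simp [h]
  · simp only [prTriR_gBracket, prTriR_ι, prι_ι, map_zero, zero_add]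
    refine Finset.sum_eq_zero fun j _ => ?_
    by_cases h : j = i
    · subst h; simp [fin3_ne_one]
    · simp [h]
  · simp only [prι_gBracket, prTriL_ι, prTriR_ι, prι_ι, map_zero, LinearMap.zero_apply, sub_zero,
      zero_add]
    fin_cases i <;> fin_cases j <;> simp

theorem gBracket_succ_ι (i : Fin 3) (w z : V ⊗[k] V') :
    gBracket S S' (ι S S' (i + 1) w) (ι S S' i z) =
      -ι S S' (i + 2) (superflip (mulT S S') w z) := by
  refine G_ext ?_ ?_ (fun j => ?_)
  · simp only [prTriL_gBracket, prTriL_ι, prι_ι, map_zero, zero_add, map_neg, neg_zero]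
    refine Finset.sum_eq_zero fun j _ => ?_
    by_cases h : j = i
    · subst h; simp [fin3_ne_one]
    · simp [h]
  · simp only [prTriR_gBracket, prTriR_ι, prι_ι, map_zero, zero_add, map_neg, neg_zero]
    refine Finset.sum_eq_zero fun j _ => ?_
    by_cases h : j = i
    · subst h; simp [fin3_ne_one]
    · simp [h]
  · simp only [prι_gBracket, prTriL_ι, prTriR_ι, prι_ι, map_zero, LinearMap.zero_apply, sub_zero,
      zero_add, map_neg]
    fin_cases i <;> fin_cases j <;> simp

end Generators

/-! ### The case of a purely even first factor -/

section Even

variable {k V V' : Type*} [Field k]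
  [AddCommGroup V] [Module k V] [Superspace k V]
  [AddCommGroup V'] [Module k V'] [Superspace k V']
  (S : SymmetricCompositionSuperalgebra k V) (S' : SymmetricCompositionSuperalgebra k V')

theorem pr_tmul_even {x : V} (hx : x ∈ part k V 0) (p : ZMod 2) (x' : V') :
    pr k p (x ⊗ₜ[k] x') = x ⊗ₜ[k] pr k p x' := by
  change (∑ q, TensorProduct.map (pr k q) (pr k (p + q)) : (V ⊗[k] V') →ₗ[k] _) (x ⊗ₜ x') = _
  rw [sum_parity, LinearMap.add_apply, TensorProduct.map_tmul, TensorProduct.map_tmul,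
    pr_of_mem hx, pr_of_mem hx]
  simp

theorem tmul_mem_even {x : V} (hx : x ∈ part k V 0) {p : ZMod 2} {x' : V'}
    (hx' : x' ∈ part k V' p) : x ⊗ₜ[k] x' ∈ part k (V ⊗[k] V') p := by
  rw [mem_part, pr_tmul_even hx, mem_part.1 hx']

theorem actL_tmul (i : Fin 3) (d : S.tri) (x : V) (x' : V') : S.actL V' i d (x ⊗ₜ x') =
    (d : Fin 3 → Module.End k V) i x ⊗ₜ x' := rfl

/-- When the `S`-factors that occur in the sign exponent are even, all signs are `1` and the sums
over parities recombine. The same happens in `mulT_tmul`, `tL_tmul` and `tR_tmul`. -/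
theorem actR_tmul {x : V} (hx : x ∈ part k V 0) (i : Fin 3) (d : S'.tri) (x' : V') :
    S'.actR V i d (x ⊗ₜ x') = x ⊗ₜ (d : Fin 3 → Module.End k V') i x' := by
  simp only [actR, sum_parity, LinearMap.add_apply, LinearMap.smul_apply, LinearMap.comp_apply,
    TensorProduct.mapBilinear_apply, TensorProduct.map_tmul, pr_of_mem hx, LinearMap.proj_apply,
    Submodule.subtype_apply]
  simp only [if_true, mul_zero, sg_zero, one_smul, one_ne_zero, if_false, TensorProduct.zero_tmul,
    smul_zero, add_zero]
  rw [← TensorProduct.tmul_add, ← LinearMap.add_apply, pr_add]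

theorem mulT_tmul {y : V} (hy : y ∈ part k V 0) (x : V) (x' y' : V') :
    mulT S S' (x ⊗ₜ x') (y ⊗ₜ y') = S.mul x y ⊗ₜ S'.mul x' y' := by
  simp only [mulT, sum_parity, LinearMap.add_apply, LinearMap.smul_apply, 
    TensorProduct.map₂_apply_tmul, TensorProduct.map_tmul, LinearMap.compl₂_apply, LinearMap.comp_apply, pr_of_mem hy]
  simp only [if_true, mul_zero, sg_zero, one_smul, one_ne_zero, if_false, TensorProduct.zero_tmul,
    smul_zero, add_zero, map_zero]
  rw [← TensorProduct.tmul_add, ← LinearMap.add_apply, ← map_add, pr_add]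

variable [NeZero (2 : k)]

theorem tL_tmul {x y : V} (hx : x ∈ part k V 0) (hy : y ∈ part k V 0) (x' y' : V') :
    tL S S' (x ⊗ₜ x') (y ⊗ₜ y') = S'.b x' y' • S.t x y := by
  simp only [tL, sum_parity, LinearMap.add_apply, LinearMap.smul_apply, LinearMap.compr₂_apply,
    TensorProduct.map₂_apply_tmul, TensorProduct.map_tmul, LinearMap.compl₁₂_apply, LinearEquiv.coe_coe,
    TensorProduct.rid_tmul, pr_of_mem hx, pr_of_mem hy]
  simp only [if_true, mul_zero, zero_mul, sg_zero, one_smul, one_ne_zero, if_false,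
    smul_zero, add_zero, map_zero, LinearMap.zero_apply]
  simp only [← add_smul, ← map_add, pr_add]
  rw [← LinearMap.add_apply, ← map_add, pr_add]

theorem tR_tmul {y : V} (hy : y ∈ part k V 0) (x : V) (x' y' : V') :
    tR S S' (x ⊗ₜ x') (y ⊗ₜ y') = S.b x y • S'.t x' y' := by
  simp only [tR, sum_parity, LinearMap.add_apply, LinearMap.smul_apply, LinearMap.compr₂_apply,
    TensorProduct.map₂_apply_tmul, TensorProduct.map_tmul, LinearMap.compl₂_apply, LinearEquiv.coe_coe,
    TensorProduct.lid_tmul, pr_of_mem hy, LinearMap.comp_apply]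
  simp only [if_true, zero_mul, sg_zero, one_smul, one_ne_zero, if_false,
    smul_zero, add_zero, map_zero, zero_smul]
  rw [← smul_add, ← LinearMap.add_apply, ← map_add, pr_add]

end Even

end SymmetricCompositionSuperalgebra
end Supermagic
end

/-! ### A criterion on generators for maps from `g(S, S')` to respect brackets -/

noncomputable section

namespace Supermagic
namespace SymmetricCompositionSuperalgebra

section Criterion

variable {k V V' : Type*} [Field k]
  [AddCommGroup V] [Module k V] [Superspace k V]
  [AddCommGroup V'] [Module k V'] [Superspace k V']
  (S : SymmetricCompositionSuperalgebra k V) (S' : SymmetricCompositionSuperalgebra k V')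

/-- The odd part of `V` is zero, so every endomorphism of `V` is even. -/
theorem tri_even (hV : ∀ x : V, x ∈ part k V 0) (d : S.tri) : d ∈ part k S.tri 0 := by
  have h1 : ∀ x ∈ part k V 1, x = 0 := fun x hx => by
    rw [← mem_part.1 (hV x), pr_of_mem hx, if_neg (by decide)]
  apply Subtype.ext
  change pr k 0 (d : Fin 3 → Module.End k V) = d
  refine mem_part_pi.2 fun i => mem_part_hom.2 fun q x hx => ?_
  rcases parity_cases q with rfl | rfl
  · exact hV _
  · rw [h1 x hx, map_zero]; exact Submodule.zero_mem _

/-- A linear map from `g(S, S')` that respects the brackets of generators up to a subspace does so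
for all brackets. -/
theorem bracket_mem_of_generators [NeZero (2 : k)] (hV : ∀ x : V, x ∈ part k V 0) {L : Type*}
    [AddCommGroup L] [Module k L] [Superspace k L] {br : L →ₗ[k] L →ₗ[k] L}
    (hbr : IsLieSuperalgebra br) (N : Submodule k L) (F : G S S' →ₗ[k] L)
    (hF : ∀ p, ∀ X ∈ part k (G S S') p, F X ∈ part k L p)
    (hLL : ∀ d d', F (inTriL S S' (S.triBracket d d')) -
      br (F (inTriL S S' d)) (F (inTriL S S' d')) ∈ N)
    (hRR : ∀ d d', F (inTriR S S' (S'.triBracket d d')) -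
      br (F (inTriR S S' d)) (F (inTriR S S' d')) ∈ N)
    (hRL : ∀ d d', br (F (inTriR S S' d')) (F (inTriL S S' d)) ∈ N)
    (hLι : ∀ (d : S.tri) (i : Fin 3) x x',
      F (ι S S' i ((d : Fin 3 → Module.End k V) i x ⊗ₜ x')) -
        br (F (inTriL S S' d)) (F (ι S S' i (x ⊗ₜ x'))) ∈ N)
    (hRι : ∀ (d : S'.tri) (i : Fin 3) x x',
      F (ι S S' i (x ⊗ₜ (d : Fin 3 → Module.End k V') i x')) -
        br (F (inTriR S S' d)) (F (ι S S' i (x ⊗ₜ x'))) ∈ N)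
    (hsucc : ∀ (i : Fin 3) x y p q, ∀ x' ∈ part k V' p, ∀ y' ∈ part k V' q,
      F (ι S S' (i + 2) (S.mul x y ⊗ₜ S'.mul x' y')) -
        br (F (ι S S' i (x ⊗ₜ x'))) (F (ι S S' (i + 1) (y ⊗ₜ y'))) ∈ N)
    (hself : ∀ (i : Fin 3) x y p q, ∀ x' ∈ part k V' p, ∀ y' ∈ part k V' q,
      F (inTriL S S' (S'.b x' y' • (S.θ ^ (i : ℕ)) (S.t x y))) +
          F (inTriR S S' (S.b x y • (S'.θ ^ (i : ℕ)) (S'.t x' y'))) -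
        br (F (ι S S' i (x ⊗ₜ x'))) (F (ι S S' i (y ⊗ₜ y'))) ∈ N)
    (X Y : G S S') : F (gBracket S S' X Y) - br (F X) (F Y) ∈ N := by
  -- Interchanges the arguments for homogeneous pairs, so that one order of each pair suffices.
  -- Skew-symmetry of the bracket of `g(S, S')` is not yet available, so it is an assumption for
  -- each pair, met below from the definition of the bracket.
  have hsw : ∀ p q X Y, X ∈ part k (G S S') p → Y ∈ part k (G S S') q →
      gBracket S S' X Y = -(sg k (p * q) • gBracket S S' Y X) →
      F (gBracket S S' Y X) - br (F Y) (F X) ∈ N → F (gBracket S S' X Y) - br (F X) (F Y) ∈ N := by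
    intro p q X Y hX hY hXY h
    rw [hXY, hbr.skew p q _ _ (hF p X hX) (hF q Y hY), map_neg, map_smul]
    convert Submodule.smul_mem N (-sg k (p * q)) h using 1
    module
  have hd : ∀ d, inTriL S S' d ∈ part k (G S S') 0 := fun d => inTriL_mem S S' (S.tri_even hV d)
  have hw : ∀ i x {p x'}, x' ∈ part k V' p → ι S S' i (x ⊗ₜ x') ∈ part k (G S S') p :=
    fun i x p x' hx' => ι_mem S S' (tmul_mem_even (hV x) hx') i
  have rLR : ∀ d p, ∀ d' ∈ part k S'.tri p,
      F (gBracket S S' (inTriR S S' d') (inTriL S S' d)) -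
        br (F (inTriR S S' d')) (F (inTriL S S' d)) ∈ N := by
    intro d p d' _
    rw [gBracket_inTriR_inTriL, map_zero, zero_sub]
    exact Submodule.neg_mem _ (hRL d d')
  have rLι : ∀ d i x x', F (gBracket S S' (inTriL S S' d) (ι S S' i (x ⊗ₜ x'))) -
        br (F (inTriL S S' d)) (F (ι S S' i (x ⊗ₜ x'))) ∈ N := by
    intro d i x x'
    rw [gBracket_inTriL_ι, actL_tmul]
    exact hLι d i x x'
  have rRι : ∀ d i x x', F (gBracket S S' (inTriR S S' d) (ι S S' i (x ⊗ₜ x'))) -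
        br (F (inTriR S S' d)) (F (ι S S' i (x ⊗ₜ x'))) ∈ N := by
    intro d i x x'
    rw [gBracket_inTriR_ι, actR_tmul S' (hV x)]
    exact hRι d i x x'
  have rsucc : ∀ (i : Fin 3) x y p q, ∀ x' ∈ part k V' p, ∀ y' ∈ part k V' q,
      F (gBracket S S' (ι S S' i (x ⊗ₜ x')) (ι S S' (i + 1) (y ⊗ₜ y'))) -
        br (F (ι S S' i (x ⊗ₜ x'))) (F (ι S S' (i + 1) (y ⊗ₜ y'))) ∈ N := by
    intro i x y p q x' hx' y' hy'
    rw [gBracket_ι_succ, mulT_tmul S S' (hV y)]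
    exact hsucc i x y p q x' hx' y' hy'
  have rpred : ∀ (i : Fin 3) x y p q, ∀ x' ∈ part k V' p, ∀ y' ∈ part k V' q,
      F (gBracket S S' (ι S S' (i + 1) (x ⊗ₜ x')) (ι S S' i (y ⊗ₜ y'))) -
        br (F (ι S S' (i + 1) (x ⊗ₜ x'))) (F (ι S S' i (y ⊗ₜ y'))) ∈ N := by
    intro i x y p q x' hx' y' hy'
    refine hsw p q _ _ (hw _ x hx') (hw _ y hy') ?_ (rsucc i y x q p y' hy' x' hx')
    rw [gBracket_succ_ι, gBracket_ι_succ,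
      superflip_hom _ (tmul_mem_even (hV x) hx') (tmul_mem_even (hV y) hy'), ι_smul]
  have hadd : ∀ X, ∀ Y Y', F (gBracket S S' X Y) - br (F X) (F Y) ∈ N →
      F (gBracket S S' X Y') - br (F X) (F Y') ∈ N →
      F (gBracket S S' X (Y + Y')) - br (F X) (F (Y + Y')) ∈ N := by
    intro X Y Y' h h'
    convert Submodule.add_mem N h h' using 1
    simp only [map_add]; abel
  revert X
  refine G_induction (fun X X' h h' => ?_) (fun d => ?_) (fun p d' hd' => ?_)
    (fun i x p x' hx' => ?_)
  · convert Submodule.add_mem N h h' using 1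
    simp only [map_add, LinearMap.add_apply]; abel
  · revert Y
    refine G_induction (hadd _) (fun e => ?_) (fun q e' he' => ?_) (fun j y q y' hy' => ?_)
    · rw [gBracket_inTriL_inTriL]; exact hLL d e
    · refine hsw 0 q _ _ (hd d) (inTriR_mem S S' he') ?_ (rLR d q e' he')
      rw [gBracket_inTriL_inTriR, gBracket_inTriR_inTriL, smul_zero, neg_zero]
    · exact rLι d j y y'
  · revert Y
    refine G_induction (hadd _) (fun e => ?_) (fun q e' he' => ?_) (fun j y q y' hy' => ?_)
    · exact rLR e p d' hd'
    · rw [gBracket_inTriR_inTriR]; exact hRR d' e'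
    · exact rRι d' j y y'
  · revert Y
    refine G_induction (hadd _) (fun e => ?_) (fun q e' he' => ?_) (fun j y q y' hy' => ?_)
    · refine hsw p 0 _ _ (hw i x hx') (hd e) ?_ (rLι e i x x')
      rw [gBracket_ι_inTriL, gBracket_inTriL_ι,
        superflip_hom _ (tmul_mem_even (hV x) hx') (S.tri_even hV e), ι_smul]
    · refine hsw p q _ _ (hw i x hx') (inTriR_mem S S' he') ?_ (rRι e' i x x')
      rw [gBracket_ι_inTriR, gBracket_inTriR_ι,
        superflip_hom _ (tmul_mem_even (hV x) hx') he', ι_smul]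
    · revert j
      refine fin3_forall i ?_ ?_ ?_
      · rw [gBracket_ι_self, tL_tmul S S' (hV x) (hV y), tR_tmul S S' (hV y), map_smul, map_smul,
          map_add]
        exact hself i x y p q x' hx' y' hy'
      · exact rsucc i x y p q x' hx' y' hy'
      -- The pair `(i, i + 2)` is `((i + 2) + 1, i + 2)`.
      · have h := rpred (i + 2) x y p q x' hx' y' hy'
        rwa [fin3_two_one] at h

end Criterion

end SymmetricCompositionSuperalgebra
end Supermagic
end

noncomputable section

namespace Supermagic

/-! ### The algebras `S₁` and `S₂` -/

section SplitAlgebras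

variable (k : Type*) [Field k] [NeZero (2 : k)]

theorem S₁_b (x y : k) : (S₁ k).b x y = 2 * (x * y) := rfl

theorem S₁_mul (x y : k) : (S₁ k).mul x y = x * y := by
  have hb : ∀ x, (hurwitzField k).bar x = x := fun x => by
    rw [HurwitzSuperalgebra.bar_apply]
    change (2 * (x * 1)) * 1 - x = x
    ring
  change (hurwitzField k).bar x * (hurwitzField k).bar y = x * y
  rw [hb, hb]

/-- Each `d_i` is a scalar `c`, and skewness at `(1, 1)` with `b(1, 1) = 2` reads `4 c = 0`. -/
theorem S₁_tri (d : (S₁ k).tri) : d = 0 := by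
  have h2 : (2 : k) ≠ 0 := NeZero.ne 2
  have hd := (S₁ k).mem_tri.1 d.2 0
  have he : pr k 0 (d : Fin 3 → Module.End k k) = d :=
    congrArg Subtype.val (SymmetricCompositionSuperalgebra.tri_even _ (field_mem k) d)
  rw [he] at hd
  apply Subtype.ext
  funext i
  apply LinearMap.ext_ring
  have h := (hd.1 i).2 0 1 1 (field_mem k 1)
  rw [S₁_b, S₁_b, zero_mul, sg_zero] at h
  have h4 : (2 : k) * 2 ≠ 0 := mul_ne_zero h2 h2
  change (d : Fin 3 → Module.End k k) i 1 = 0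
  apply mul_left_cancel₀ h4
  linear_combination h

theorem S₂_b (x y : k × k) : (S₂ k).b x y = x.1 * y.2 + x.2 * y.1 := rfl

theorem S₂_mul (x y : k × k) : (S₂ k).mul x y = (x.2 * y.2, x.1 * y.1) := by
  have hb : ∀ x, (hurwitzSplit k).bar x = (x.2, x.1) := fun x => by
    rw [HurwitzSuperalgebra.bar_apply]
    change (x.1 * 1 + x.2 * 1) • (1 : k × k) - x = _
    ext <;> simp
  change (hurwitzSplit k).bar x * (hurwitzSplit k).bar y = _
  rw [hb, hb]
  rfl

theorem S₂_r (x y : k × k) : (S₂ k).r x y = (x.2 * y.2, x.1 * y.1) := by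
  rw [(S₂ k).r_apply (field_sq_mem k x) (field_sq_mem k y), mul_zero, sg_zero, one_smul, S₂_mul,
    mul_comm y.2, mul_comm y.1]

theorem S₂_σ (x y z : k × k) :
    (S₂ k).σ x y z = (x.1 * z.2 + x.2 * z.1) • y - (y.1 * z.2 + y.2 * z.1) • x := by
  rw [(S₂ k).σ_apply (field_sq_mem k x) (field_sq_mem k y) (field_sq_mem k z), S₂_b, S₂_b]
  simp [sg_zero]

theorem sigmaS₂_apply (x : k × k) : sigmaS₂ k x = (x.1, -x.2) := by
  have h2 : (2 : k) ≠ 0 := NeZero.ne 2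
  rw [sigmaS₂, LinearMap.smul_apply, S₂_σ]
  ext <;> simp [uElt] <;> field_simp <;> ring

/-- The coefficients `α_i` of an element `(α₀ σ, α₁ σ, α₂ σ)` of `tri(S₂)`. -/
def triCoeff (i : Fin 3) : (S₂ k).tri →ₗ[k] k :=
  LinearMap.fst k k k ∘ₗ LinearMap.applyₗ (1, 0) ∘ₗ LinearMap.proj i ∘ₗ (S₂ k).tri.subtype

theorem triCoeff_apply (i : Fin 3) (d : (S₂ k).tri) :
    triCoeff k i d = ((d : Fin 3 → Module.End k (k × k)) i (1, 0)).1 := rfl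

/-- The orthogonal Lie algebra of a hyperbolic plane is spanned by `σ = diag(1, -1)`: skewness on
the isotropic basis `(1,0)`, `(0,1)` kills the off-diagonal entries and makes the diagonal ones
opposite. -/
theorem tri_S₂_eq (d : (S₂ k).tri) :
    (d : Fin 3 → Module.End k (k × k)) = fun i => triCoeff k i d • sigmaS₂ k := by
  have h2 : (2 : k) ≠ 0 := NeZero.ne 2
  have hd := (S₂ k).mem_tri.1 d.2 0
  have he : pr k 0 (d : Fin 3 → Module.End k (k × k)) = d :=
    congrArg Subtype.val (SymmetricCompositionSuperalgebra.tri_even _ (field_sq_mem k) d)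
  rw [he] at hd
  funext i
  have ho : ∀ x y, (S₂ k).b ((d : Fin 3 → Module.End k (k × k)) i x) y +
      (S₂ k).b x ((d : Fin 3 → Module.End k (k × k)) i y) = 0 := fun x y => by
    have h := (hd.1 i).2 0 x y (field_sq_mem k x)
    rwa [zero_mul, sg_zero, one_mul] at h
  have h1 := ho (1, 0) (1, 0)
  have h3 := ho (0, 1) (0, 1)
  have h4 := ho (1, 0) (0, 1)
  simp only [S₂_b] at h1 h3 h4
  ext <;> simp only [LinearMap.comp_apply, LinearMap.inl_apply, LinearMap.inr_apply,
    LinearMap.smul_apply, sigmaS₂_apply, triCoeff_apply, Prod.smul_fst, Prod.smul_snd, smul_eq_mul]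
  · ring
  · apply mul_left_cancel₀ h2
    linear_combination h1
  · apply mul_left_cancel₀ h2
    linear_combination h3
  · linear_combination h4

theorem triCoeff_sum (d : (S₂ k).tri) :
    triCoeff k 0 d + triCoeff k 1 d + triCoeff k 2 d = 0 := by
  have hd := (S₂ k).mem_tri.1 d.2 0
  have he : pr k 0 (d : Fin 3 → Module.End k (k × k)) = d :=
    congrArg Subtype.val (SymmetricCompositionSuperalgebra.tri_even _ (field_sq_mem k) d)
  rw [he] at hd
  -- Since `(1,0) • (1,0) = (0,1)` and `σ(0,1) = -(0,1)`, the triality rule becomes `-α₀ = α₁ + α₂`.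
  have h := congrArg Prod.snd (hd.2 0 (1, 0) (1, 0) (field_sq_mem k _))
  rw [tri_S₂_eq] at h
  simp [S₂_mul, sigmaS₂_apply, sg_zero] at h
  linear_combination -h

theorem mem_tri_S₂ (d : Fin 3 → Module.End k (k × k)) : d ∈ (S₂ k).tri ↔
    ∃ α : Fin 3 → k, α 0 + α 1 + α 2 = 0 ∧ d = fun i => α i • sigmaS₂ k := by
  constructor
  · intro hd
    exact ⟨fun i => triCoeff k i ⟨d, hd⟩, triCoeff_sum k ⟨d, hd⟩, tri_S₂_eq k ⟨d, hd⟩⟩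
  · rintro ⟨α, hα, rfl⟩
    refine (S₂ k).triPart_le 0 ⟨fun i => ⟨mem_part_hom.2 fun q x hx => ?_, fun q x y hx => ?_⟩,
      fun q x y hx => ?_⟩
    · rcases field_sq_odd k hx with rfl | rfl
      · exact field_sq_mem k _
      · rw [map_zero]; exact Submodule.zero_mem _
    · simp only [LinearMap.smul_apply, sigmaS₂_apply, S₂_b, zero_mul, sg_zero, Prod.smul_fst,
        Prod.smul_snd, smul_eq_mul]
      ring
    · simp only [LinearMap.smul_apply, sigmaS₂_apply, S₂_mul, zero_mul, sg_zero, one_smul]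
      ext <;> simp only [Prod.smul_fst, Prod.smul_snd, smul_eq_mul, Prod.fst_add, Prod.snd_add]
      · linear_combination (x.2 * y.2) * hα
      · linear_combination (-(x.1 * y.1)) * hα

theorem triCoeff_of_eq {d : (S₂ k).tri} {α : Fin 3 → k}
    (h : (d : Fin 3 → Module.End k (k × k)) = fun i => α i • sigmaS₂ k) (i : Fin 3) :
    triCoeff k i d = α i := by
  rw [triCoeff_apply, h]
  simp [sigmaS₂_apply]

theorem tri_S₂_apply (d : (S₂ k).tri) (i : Fin 3) (x : k × k) :
    (d : Fin 3 → Module.End k (k × k)) i x = triCoeff k i d • (x.1, -x.2) := by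
  rw [tri_S₂_eq, LinearMap.smul_apply, sigmaS₂_apply]

theorem triCoeff_bracket (d d' : (S₂ k).tri) (i : Fin 3) :
    triCoeff k i ((S₂ k).triBracket d d') = 0 := by
  change (glBracket k (k × k) ((d : Fin 3 → Module.End k (k × k)) i)
    ((d' : Fin 3 → Module.End k (k × k)) i) (1, 0)).1 = 0
  have he : (d' : Fin 3 → Module.End k (k × k)) ∈ part k (Fin 3 → Module.End k (k × k)) 0 :=
    congrArg Subtype.val (SymmetricCompositionSuperalgebra.tri_even _ (field_sq_mem k) d')
  rw [glBracket_even_right (mem_part_pi.1 he i)]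
  simp only [LinearMap.sub_apply, Module.End.mul_apply, tri_S₂_apply]
  simp
  ring

theorem triCoeff_ext {d d' : (S₂ k).tri} (h : ∀ i, triCoeff k i d = triCoeff k i d') : d = d' := by
  apply Subtype.ext
  rw [tri_S₂_eq, tri_S₂_eq]
  simp only [h]

/-- Only the coefficients at the places `1` and `2` of `t_{x,y}` are needed, because the diagonal
element attached to a triple is written with `α₁` and `α₂`. -/
theorem triCoeff_t_one (x y : k × k) :
    triCoeff k 1 ((S₂ k).t x y) = (1 / 2 : k) * (x.1 * y.2 - x.2 * y.1) := by
  have h2 : (2 : k) ≠ 0 := NeZero.ne 2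
  change ((((1 / 2 : k) * (S₂ k).b x y) • 1 - (S₂ k).r x * (S₂ k).l y : Module.End k (k × k))
    (1, 0)).1 = _
  simp only [LinearMap.sub_apply, LinearMap.smul_apply, Module.End.mul_apply, Module.End.one_apply,
    S₂_r, SymmetricCompositionSuperalgebra.l_apply, S₂_mul, S₂_b]
  simp
  field_simp
  ring

theorem triCoeff_t_two (x y : k × k) :
    triCoeff k 2 ((S₂ k).t x y) = (1 / 2 : k) * (x.1 * y.2 - x.2 * y.1) := by
  have h2 : (2 : k) ≠ 0 := NeZero.ne 2
  change ((((1 / 2 : k) * (S₂ k).b x y) • 1 - (S₂ k).l x * (S₂ k).r y : Module.End k (k × k))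
    (1, 0)).1 = _
  simp only [LinearMap.sub_apply, LinearMap.smul_apply, Module.End.mul_apply, Module.End.one_apply,
    S₂_r, SymmetricCompositionSuperalgebra.l_apply, S₂_mul, S₂_b]
  simp
  field_simp
  ring

theorem triCoeff_θ (d : (S₂ k).tri) (i : Fin 3) :
    triCoeff k i (((S₂ k).θ ^ (i : ℕ)) d) = triCoeff k 0 d ∧
    triCoeff k (i + 1) (((S₂ k).θ ^ (i : ℕ)) d) = triCoeff k 1 d ∧
    triCoeff k (i + 2) (((S₂ k).θ ^ (i : ℕ)) d) = triCoeff k 2 d := by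
  obtain ⟨h0, h1, h2⟩ := (S₂ k).θ_pow_apply d i
  simp only [triCoeff_apply, h0, h1, h2, and_self]

variable (C : Type*) [AddCommGroup C] [Module k C]

/-- The component `a` of `1 ⊗ a + u ⊗ b`. -/
def oneCoord : ((k × k) ⊗[k] C) →ₗ[k] C :=
  TensorProduct.lift ((LinearMap.lsmul k C).comp
    ((1 / 2 : k) • (LinearMap.fst k k k + LinearMap.snd k k k)))

/-- The component `b` of `1 ⊗ a + u ⊗ b`. -/
def uCoord : ((k × k) ⊗[k] C) →ₗ[k] C :=
  TensorProduct.lift ((LinearMap.lsmul k C).comp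
    ((1 / 2 : k) • (LinearMap.fst k k k - LinearMap.snd k k k)))

variable {C}

theorem oneCoord_tmul (x : k × k) (a : C) :
    oneCoord k C (x ⊗ₜ a) = ((1 / 2 : k) * (x.1 + x.2)) • a := rfl

theorem uCoord_tmul (x : k × k) (a : C) :
    uCoord k C (x ⊗ₜ a) = ((1 / 2 : k) * (x.1 - x.2)) • a := rfl

theorem eq_oneCoord_add_uCoord (w : (k × k) ⊗[k] C) :
    w = 1 ⊗ₜ oneCoord k C w + uElt k ⊗ₜ uCoord k C w := by
  have h2 : (2 : k) ≠ 0 := NeZero.ne 2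
  induction w using TensorProduct.induction_on with
  | zero => simp
  | tmul x a =>
    rw [oneCoord_tmul, uCoord_tmul, ← TensorProduct.smul_tmul, ← TensorProduct.smul_tmul,
      ← TensorProduct.add_tmul]
    congr 1
    ext <;> simp [uElt] <;> field_simp <;> ring
  | add w z hw hz =>
    rw [map_add, map_add, TensorProduct.tmul_add, TensorProduct.tmul_add]
    conv_lhs => rw [hw, hz]
    abel

theorem oneCoord_one_tmul (a : C) : oneCoord k C (1 ⊗ₜ a) = a := by
  have h2 : (2 : k) ≠ 0 := NeZero.ne 2
  rw [oneCoord_tmul]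
  simp [one_add_one_eq_two, h2]

theorem oneCoord_u_tmul (a : C) : oneCoord k C (uElt k ⊗ₜ a) = 0 := by
  rw [oneCoord_tmul]
  simp [uElt]

theorem uCoord_one_tmul (a : C) : uCoord k C (1 ⊗ₜ a) = 0 := by
  rw [uCoord_tmul]
  simp

theorem uCoord_u_tmul (a : C) : uCoord k C (uElt k ⊗ₜ a) = a := by
  have h2 : (2 : k) ≠ 0 := NeZero.ne 2
  rw [uCoord_tmul]
  simp [uElt, one_add_one_eq_two, h2]

variable [Superspace k C]

theorem oneCoord_mem {p : ZMod 2} {w : (k × k) ⊗[k] C} (hw : w ∈ part k ((k × k) ⊗[k] C) p) :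
    oneCoord k C w ∈ part k C p := by
  refine map_mem_part_of_pr (f := oneCoord k C) (fun p w => ?_) hw
  induction w using TensorProduct.induction_on with
  | zero => simp
  | tmul x a =>
    rw [SymmetricCompositionSuperalgebra.pr_tmul_even (field_sq_mem k x), oneCoord_tmul,
      oneCoord_tmul, map_smul]
  | add w z hw hz => rw [map_add, map_add, map_add, map_add, hw, hz]

theorem uCoord_mem {p : ZMod 2} {w : (k × k) ⊗[k] C} (hw : w ∈ part k ((k × k) ⊗[k] C) p) :
    uCoord k C w ∈ part k C p := by
  refine map_mem_part_of_pr (f := uCoord k C) (fun p w => ?_) hw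
  induction w using TensorProduct.induction_on with
  | zero => simp
  | tmul x a =>
    rw [SymmetricCompositionSuperalgebra.pr_tmul_even (field_sq_mem k x), uCoord_tmul,
      uCoord_tmul, map_smul]
  | add w z hw hz => rw [map_add, map_add, map_add, map_add, hw, hz]

theorem lid_mem {p : ZMod 2} {w : k ⊗[k] C} (hw : w ∈ part k (k ⊗[k] C) p) :
    TensorProduct.lid k C w ∈ part k C p := by
  refine map_mem_part_of_pr (f := (TensorProduct.lid k C).toLinearMap) (fun p w => ?_) hw
  induction w using TensorProduct.induction_on with
  | zero => simp
  | tmul x a =>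
    rw [SymmetricCompositionSuperalgebra.pr_tmul_even (field_mem k x)]
    simp
  | add w z hw hz => rw [map_add, map_add, map_add, map_add, hw, hz]

end SplitAlgebras

end Supermagic
end

noncomputable section

namespace Supermagic
namespace HurwitzSuperalgebra

open SymmetricCompositionSuperalgebra

variable {k C : Type*} [Field k] [NeZero (2 : k)] [AddCommGroup C] [Module k C] [Superspace k C]
  (H : HurwitzSuperalgebra k C)

/-! ### The isomorphism `g(S₁, S) → der J` -/

/-- `a ↦ D_i(a)` as a linear map. -/
def DLin (i : Fin 3) : C →ₗ[k] Module.End k H.J where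
  toFun := H.D i
  map_add' := H.D_add i
  map_smul' := H.D_smul i

theorem DLin_apply (i : Fin 3) (a : C) : H.DLin i a = H.D i a := by
  rw [DLin, LinearMap.coe_mk, AddHom.coe_mk]

/-- `d ↦ D_d` as a linear map on `tri(S)`. -/
def DtriLin : H.para.tri →ₗ[k] Module.End k H.J where
  toFun d := H.Dtri d
  map_add' _ _ := H.Dtri_add _ _
  map_smul' _ _ := H.Dtri_smul _ _

theorem DtriLin_apply (d : H.para.tri) : H.DtriLin d = H.Dtri d := by
  rw [DtriLin, LinearMap.coe_mk, AddHom.coe_mk]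

theorem Dtri_mem_part {p : ZMod 2} {d : H.para.tri} (hd : d ∈ part k H.para.tri p) :
    H.Dtri d ∈ part k (Module.End k H.J) p := by
  have he : (d : Fin 3 → Module.End k C) ∈ part k (Fin 3 → Module.End k C) p :=
    congrArg Subtype.val hd
  exact H.Dtri_mem (mem_part_pi.1 he)

/-- The linear map underlying `g(S₁, S) → der J`. -/
def toDer : (S₁ k).G H.para →ₗ[k] Module.End k H.J :=
  H.DtriLin ∘ₗ (S₁ k).prTriR H.para +
    ∑ i, H.DLin i ∘ₗ (TensorProduct.lid k C).toLinearMap ∘ₗ (S₁ k).prι H.para i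

theorem toDer_apply (X : (S₁ k).G H.para) : H.toDer X = H.Dtri ((S₁ k).prTriR H.para X) +
    ∑ i, H.D i (TensorProduct.lid k C ((S₁ k).prι H.para i X)) := by
  simp only [toDer, LinearMap.add_apply, LinearMap.sum_apply, LinearMap.comp_apply, DLin_apply,
    DtriLin_apply, LinearEquiv.coe_coe]

theorem D_zero (i : Fin 3) : H.D i 0 = 0 := by
  rw [← zero_smul k (0 : C), D_smul, zero_smul]

theorem Dtri_zero : H.Dtri 0 = 0 := map_zero H.DtriLin

theorem toDer_inTriL (d : (S₁ k).tri) : H.toDer ((S₁ k).inTriL H.para d) = 0 := by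
  rw [toDer_apply, prTriR_inTriL]
  simp [prι_inTriL, D_zero, Dtri_zero]

theorem toDer_inTriR (d : H.para.tri) : H.toDer ((S₁ k).inTriR H.para d) = H.Dtri d := by
  rw [toDer_apply, prTriR_inTriR]
  simp [prι_inTriR, D_zero]

theorem toDer_ι (i : Fin 3) (x : k) (a : C) :
    H.toDer ((S₁ k).ι H.para i (x ⊗ₜ a)) = x • H.D i a := by
  rw [toDer_apply, prTriR_ι, Finset.sum_eq_single i]
  · simp [prι_ι, D_smul, Dtri_zero]
  · intro j _ hj
    simp [prι_ι, hj, D_zero]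
  · simp

theorem toDer_mem_part (p : ZMod 2) (X : (S₁ k).G H.para)
    (hX : X ∈ part k ((S₁ k).G H.para) p) : H.toDer X ∈ part k (Module.End k H.J) p := by
  obtain ⟨_, h2, h3⟩ := (mem_part_G _ _).1 hX
  rw [toDer_apply]
  exact Submodule.add_mem _ (H.Dtri_mem_part h2)
    (Submodule.sum_mem _ fun i _ => H.D_mem (lid_mem k (h3 i)) i)

theorem toDer_mem_der (X : (S₁ k).G H.para) : H.toDer X ∈ H.derJ := by
  rw [toDer_apply]
  exact Submodule.add_mem _ (H.Dtri_mem_der (Subtype.property _))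
    (Submodule.sum_mem _ fun i _ => H.D_mem_der i _)

attribute [local irreducible] D Dtri toDer

/-- The criterion with the zero subspace. As `tri(S₁) = 0`, only brackets among the `D_d` and the
`D_i(a)` remain, and these were computed above. -/
theorem toDer_bracket (X Y : (S₁ k).G H.para) :
    H.toDer ((S₁ k).gBracket H.para X Y) = glBracket k H.J (H.toDer X) (H.toDer Y) := by
  rw [← sub_eq_zero, ← Submodule.mem_bot k]
  refine bracket_mem_of_generators (S₁ k) H.para (field_mem k) (br := glBracket k H.J)
    isLieSuperalgebra_gl ⊥ H.toDer H.toDer_mem_part ?_ ?_ ?_ ?_ ?_ ?_ ?_ X Y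
  · intro d d'
    simp [toDer_inTriL]
  · intro d d'
    rw [toDer_inTriR, toDer_inTriR, toDer_inTriR, Dtri_bracket_Dtri, Submodule.mem_bot, sub_eq_zero]
    rfl
  · intro d d'
    simp [toDer_inTriL]
  · intro d i x x'
    rw [S₁_tri k d, toDer_inTriL, toDer_ι]
    simp
  · intro d i x x'
    rw [toDer_inTriR, toDer_ι, toDer_ι, map_smul, H.Dtri_bracket_D d.2]
    simp
  · intro i x y p q a ha b hb
    rw [toDer_ι, toDer_ι, toDer_ι, map_smul, map_smul, LinearMap.smul_apply,
      H.D_bracket_succ ha hb, S₁_mul, Submodule.mem_bot, sub_eq_zero, smul_smul, mul_comm y]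
    rfl
  -- The form of `S₁` is `b(x, y) = 2 x y`, which accounts for the factor `2` in `D_bracket_self`.
  · intro i x y p q a ha b hb
    rw [toDer_ι, toDer_ι, toDer_inTriL, toDer_inTriR, map_smul, map_smul, LinearMap.smul_apply,
      H.D_bracket_self ha hb, S₁_b, zero_add, Submodule.mem_bot, sub_eq_zero, Submodule.coe_smul,
      Dtri_smul]
    change _ • H.Dtri (H.rotT i a b) = _
    module

theorem toDer_injective : Function.Injective H.toDer := by
  rw [injective_iff_map_eq_zero]
  intro X hX
  rw [toDer_apply] at hX
  obtain ⟨h1, h2⟩ := H.eq_zero_of_der_eq_zero hX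
  refine G_ext ?_ ?_ (fun i => ?_)
  · rw [S₁_tri k (prTriL _ _ X), map_zero]
  · rw [map_zero]
    exact Subtype.ext h1
  · rw [map_zero]
    exact (TensorProduct.lid k C).map_eq_zero_iff.1 (congrFun h2 i)

theorem exists_toDer_eq [Nontrivial C] {d : Module.End k H.J} (hd : d ∈ H.derJ) :
    ∃ X, H.toDer X = d := by
  obtain ⟨t, ht, a, rfl⟩ := H.exists_of_mem_der hd
  refine ⟨(S₁ k).mkG H.para 0 ⟨t, ht⟩ fun i => 1 ⊗ₜ a i, ?_⟩
  rw [toDer_apply, prTriR_mkG]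
  simp [prι_mkG]

/-- The map `g(S₁, S) → der J`. -/
def toDerJ : (S₁ k).G H.para →ₗ[k] der H.jmul :=
  H.toDer.codRestrict (der H.jmul) H.toDer_mem_der

theorem coe_toDerJ (X : (S₁ k).G H.para) : (H.toDerJ X : Module.End k H.J) = H.toDer X := by
  rw [toDerJ, LinearMap.codRestrict_apply]

attribute [local irreducible] toDerJ

theorem toDerJ_bijective [Nontrivial C] : Function.Bijective H.toDerJ := by
  constructor
  · intro X Y h
    exact H.toDer_injective (by rw [← coe_toDerJ, h, coe_toDerJ])
  · rintro ⟨d, hd⟩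
    obtain ⟨X, hX⟩ := H.exists_toDer_eq hd
    exact ⟨X, Subtype.ext (by rw [coe_toDerJ, hX])⟩

theorem toDerJ_mem_part (p : ZMod 2) (X : (S₁ k).G H.para)
    (hX : X ∈ part k ((S₁ k).G H.para) p) : H.toDerJ X ∈ part k (der H.jmul) p := by
  apply Subtype.ext
  have h := H.toDer_mem_part p X hX
  rw [← coe_toDerJ] at h
  exact h

theorem toDerJ_bracket (X Y : (S₁ k).G H.para) :
    H.toDerJ ((S₁ k).gBracket H.para X Y) =
      derBracket H.jmul (H.toDerJ X) (H.toDerJ Y) := by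
  apply Subtype.ext
  rw [coe_toDerJ, toDer_bracket, ← coe_toDerJ, ← coe_toDerJ]
  rfl

/-- The linear equivalence underlying the isomorphism `g(S₁, S) → der J`. -/
def derEquiv [Nontrivial C] : (S₁ k).G H.para ≃ₗ[k] der H.jmul :=
  LinearEquiv.ofBijective H.toDerJ H.toDerJ_bijective

/-- The isomorphism `Φ : g(S₁, S) → der J`. -/
def derIso [Nontrivial C] : LieSuperIso ((S₁ k).gBracket H.para) (derBracket H.jmul) :=
  ⟨H.derEquiv, H.toDerJ_mem_part, H.toDerJ_bracket⟩

theorem derIso_apply [Nontrivial C] (X : (S₁ k).G H.para) :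
    (H.derIso.toLinearEquiv X : Module.End k H.J) = H.toDer X :=
  H.coe_toDerJ X

/-! ### The isomorphism `g(S₂, S) → pstr J` -/

/-- The element `2 (α₂ e₁ - α₁ e₂)` of `J` for the triple `(α₀ σ, α₁ σ, α₂ σ)`. -/
def diagElt : (S₂ k).tri →ₗ[k] H.J :=
  (2 : k) • ((triCoeff k 2).smulRight (H.e 1) - (triCoeff k 1).smulRight (H.e 2))

theorem diagElt_apply (d : (S₂ k).tri) :
    H.diagElt d = (2 : k) • (triCoeff k 2 d • H.e 1 - triCoeff k 1 d • H.e 2) := rfl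

theorem jmul_diagElt (d : (S₂ k).tri) : H.jmul (H.diagElt d) =
    (2 : k) • (triCoeff k 2 d • H.jmul (H.e 1) - triCoeff k 1 d • H.jmul (H.e 2)) := by
  rw [diagElt_apply]; simp only [map_smul, map_sub]

/-- The element of `J` whose multiplication operator is a component of the image of an element of
`g(S₂, S)`. -/
def multPart : (S₂ k).G H.para →ₗ[k] H.J :=
  H.diagElt ∘ₗ (S₂ k).prTriL H.para + ∑ i, H.ιJ i ∘ₗ uCoord k C ∘ₗ (S₂ k).prι H.para i

/-- The derivation that is a component of the image of an element of `g(S₂, S)`. -/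
def derComp : (S₂ k).G H.para →ₗ[k] Module.End k H.J :=
  H.DtriLin ∘ₗ (S₂ k).prTriR H.para + ∑ i, H.DLin i ∘ₗ oneCoord k C ∘ₗ (S₂ k).prι H.para i

/-- A lift `g(S₂, S) → str J` of the isomorphism with `pstr J`. -/
def toStr : (S₂ k).G H.para →ₗ[k] Module.End k H.J := H.derComp + H.jmul ∘ₗ H.multPart

theorem multPart_apply (X : (S₂ k).G H.para) :
    H.multPart X = H.diagElt ((S₂ k).prTriL H.para X) +
      ∑ i, H.ιJ i (uCoord k C ((S₂ k).prι H.para i X)) := by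
  rw [multPart, LinearMap.add_apply, LinearMap.sum_apply]
  rfl

theorem derComp_apply (X : (S₂ k).G H.para) :
    H.derComp X = H.Dtri ((S₂ k).prTriR H.para X) +
      ∑ i, H.D i (oneCoord k C ((S₂ k).prι H.para i X)) := by
  simp only [derComp, LinearMap.add_apply, LinearMap.sum_apply, LinearMap.comp_apply, DLin_apply,
    DtriLin_apply]

theorem toStr_apply (X : (S₂ k).G H.para) :
    H.toStr X = H.derComp X + H.jmul (H.multPart X) := rfl

theorem toStr_inTriL (d : (S₂ k).tri) :
    H.toStr ((S₂ k).inTriL H.para d) = H.jmul (H.diagElt d) := by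
  rw [toStr_apply, derComp_apply, multPart_apply, prTriR_inTriL, prTriL_inTriL]
  simp [prι_inTriL, D_zero, Dtri_zero]

theorem toStr_inTriR (d : H.para.tri) : H.toStr ((S₂ k).inTriR H.para d) = H.Dtri d := by
  rw [toStr_apply, derComp_apply, multPart_apply, prTriR_inTriR, prTriL_inTriR]
  simp [prι_inTriR, D_zero]

theorem toStr_ι (i : Fin 3) (x : k × k) (a : C) : H.toStr ((S₂ k).ι H.para i (x ⊗ₜ a)) =
    ((1 / 2 : k) * (x.1 + x.2)) • H.D i a + ((1 / 2 : k) * (x.1 - x.2)) • H.jmul (H.ιJ i a) := by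
  rw [toStr_apply, derComp_apply, multPart_apply, prTriR_ι, prTriL_ι,
    Finset.sum_eq_single i, Finset.sum_eq_single i]
  · rw [prι_ι, if_pos rfl, oneCoord_tmul, uCoord_tmul, D_smul]
    simp only [map_zero, zero_add, map_smul, ZeroMemClass.coe_zero, Dtri_zero]
  · intro j _ hj
    rw [prι_ι, if_neg hj, map_zero, map_zero]
  · simp
  · intro j _ hj
    rw [prι_ι, if_neg hj, map_zero, D_zero]
  · simp

attribute [local irreducible] toStr

theorem diagElt_mem_part {p : ZMod 2} {d : (S₂ k).tri} (hd : d ∈ part k (S₂ k).tri p) :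
    H.diagElt d ∈ part k H.J p := by
  rcases parity_cases p with rfl | rfl
  · exact Submodule.smul_mem _ _ (Submodule.sub_mem _ (Submodule.smul_mem _ _ (H.e_mem 1))
      (Submodule.smul_mem _ _ (H.e_mem 2)))
  · have h0 := (S₂ k).tri_even (field_sq_mem k) d
    have : d = 0 := by rw [← mem_part.1 h0, pr_of_mem hd, if_neg (by decide)]
    rw [this, map_zero]
    exact Submodule.zero_mem _

theorem toStr_mem_part (p : ZMod 2) (X : (S₂ k).G H.para)
    (hX : X ∈ part k ((S₂ k).G H.para) p) : H.toStr X ∈ part k (Module.End k H.J) p := by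
  obtain ⟨h1, h2, h3⟩ := (mem_part_G _ _).1 hX
  rw [toStr_apply, derComp_apply, multPart_apply]
  refine Submodule.add_mem _ (Submodule.add_mem _ (H.Dtri_mem_part h2)
    (Submodule.sum_mem _ fun i _ => H.D_mem (oneCoord_mem k (h3 i)) i))
    (H.jmul_mem_part _ _ (Submodule.add_mem _ (H.diagElt_mem_part h1)
      (Submodule.sum_mem _ fun i _ => H.ιJ_mem (uCoord_mem k (h3 i)) i)))

theorem derComp_mem_der (X : (S₂ k).G H.para) : H.derComp X ∈ H.derJ := by
  rw [derComp_apply]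
  exact Submodule.add_mem _ (H.Dtri_mem_der (Subtype.property _))
    (Submodule.sum_mem _ fun i _ => H.D_mem_der i _)

theorem jmul_mem_str (x : H.J) : H.jmul x ∈ H.str :=
  H.range_jmul_le_str (LinearMap.mem_range_self _ _)

theorem toStr_mem_str (X : (S₂ k).G H.para) : H.toStr X ∈ H.str := by
  rw [toStr_apply]
  exact Submodule.add_mem _ (H.derJ_le_str (H.derComp_mem_der X)) (H.jmul_mem_str _)

/-- Because `α₀ + α₁ + α₂ = 0`, the three cyclic expressions for the diagonal element differ by
multiples of the unit of `J`. This yields the three formulas of the theorem and allows the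
expression adapted to a given `i` to be used. -/
theorem jmul_diagElt_sub_mem (d : (S₂ k).tri) (i : Fin 3) : H.jmul (H.diagElt d) -
    (2 : k) • H.jmul (triCoeff k (i + 2) d • H.e (i + 1) - triCoeff k (i + 1) d • H.e (i + 2)) ∈
      Submodule.span k {(1 : Module.End k H.J)} := by
  have h := triCoeff_sum k d
  have h1 : triCoeff k 0 d = -triCoeff k 1 d - triCoeff k 2 d := by linear_combination h
  have key : ∀ c : k, ∀ x : H.J, H.diagElt d - (2 : k) • x = c • (H.e 0 + H.e 1 + H.e 2) →
      H.jmul (H.diagElt d) - (2 : k) • H.jmul x ∈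
        Submodule.span k {(1 : Module.End k H.J)} := by
    intro c x hx
    rw [← map_smul, ← map_sub, hx, map_smul, jmul_sum_e]
    exact Submodule.smul_mem _ _ (Submodule.mem_span_singleton_self _)
  fin_cases i
  · refine key 0 _ ?_
    rw [diagElt_apply, zero_smul]
    exact sub_self _
  -- In the difference `e_0` and `e_1` have coefficient `2 α₂`, and `e_2` has `-2 (α₀ + α₁) = 2 α₂`.
  · refine key ((2 : k) * triCoeff k 2 d) _ ?_
    rw [diagElt_apply]
    change _ - (2 : k) • (triCoeff k 0 d • H.e 2 - triCoeff k 2 d • H.e 0) = _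
    rw [h1]
    module
  · refine key (-(2 : k) * triCoeff k 1 d) _ ?_
    rw [diagElt_apply]
    change _ - (2 : k) • (triCoeff k 1 d • H.e 0 - triCoeff k 0 d • H.e 1) = _
    rw [h1]
    module

theorem L_e_bracket_D (i j : Fin 3) (a : C) :
    glBracket k H.J (H.jmul (H.e j)) (H.D i a) = -H.jmul (H.D i a (H.e j)) := by
  rw [← D_bracket_e]
  refine hom_induction (k := k) (P := fun a => glBracket k H.J (H.jmul (H.e j)) (H.D i a) =
    -glBracket k H.J (H.D i a) (H.jmul (H.e j))) ?_ ?_ a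
  · intro u v hu hv
    simp only [D_add, map_add, LinearMap.add_apply, hu, hv]; abel
  · intro p a ha
    rw [glBracket_skew (H.jmul_mem_part _ _ (H.e_mem j)) (H.D_mem ha i), zero_mul, sg_zero,
      one_smul]

theorem L_e_bracket_ι (i j : Fin 3) (a : C) :
    glBracket k H.J (H.jmul (H.e j)) (H.jmul (H.ιJ i a)) =
      -glBracket k H.J (H.jmul (H.ιJ i a)) (H.jmul (H.e j)) := by
  refine hom_induction (k := k) (P := fun a =>
    glBracket k H.J (H.jmul (H.e j)) (H.jmul (H.ιJ i a)) =
      -glBracket k H.J (H.jmul (H.ιJ i a)) (H.jmul (H.e j))) ?_ ?_ a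
  · intro u v hu hv
    simp only [map_add, LinearMap.add_apply, hu, hv]; abel
  · intro p a ha
    rw [glBracket_skew (H.jmul_mem_part _ _ (H.e_mem j)) (H.jmul_mem_part _ _ (H.ιJ_mem ha i)),
      zero_mul, sg_zero, one_smul]

theorem bracket_span_one_left {f f' g : Module.End k H.J}
    (h : f - f' ∈ Submodule.span k {(1 : Module.End k H.J)}) :
    glBracket k H.J f g = glBracket k H.J f' g := by
  obtain ⟨c, hc⟩ := Submodule.mem_span_singleton.1 h
  rw [← sub_eq_zero, ← LinearMap.sub_apply, ← map_sub, ← hc, map_smul, LinearMap.smul_apply,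
    glBracket_one_left, smul_zero]

/-- Brackets ignore scalars, so the diagonal element may be written with `e_{i+1}` and `e_{i+2}`,
where the values of `D_i(a)` are known. Together with `diagElt_bracket_ι` it shows that the element
exchanges `D_i(a)` and `L_{ι_i(a)}` with coefficient `α_i`, just as `α_i σ` exchanges `1` and `u`.
-/
theorem diagElt_bracket_D (d : (S₂ k).tri) (i : Fin 3) (a : C) :
    glBracket k H.J (H.jmul (H.diagElt d)) (H.D i a) = triCoeff k i d • H.jmul (H.ιJ i a) := by
  have h2 : (2 : k) ≠ 0 := NeZero.ne 2
  have h : triCoeff k i d = -triCoeff k (i + 1) d - triCoeff k (i + 2) d := by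
    have h := triCoeff_sum k d
    rw [← Fin.sum_univ_three (f := fun i => triCoeff k i d), fin3_sum _ i] at h
    linear_combination h
  rw [H.bracket_span_one_left (H.jmul_diagElt_sub_mem d i)]
  simp only [map_smul, map_sub, LinearMap.smul_apply, LinearMap.sub_apply, L_e_bracket_D,
    D_e_one, D_e_two, map_neg, h]
  match_scalars <;> field_simp <;> ring

theorem diagElt_bracket_ι (d : (S₂ k).tri) (i : Fin 3) (a : C) :
    glBracket k H.J (H.jmul (H.diagElt d)) (H.jmul (H.ιJ i a)) = triCoeff k i d • H.D i a := by
  have h2 : (2 : k) ≠ 0 := NeZero.ne 2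
  have h : triCoeff k i d = -triCoeff k (i + 1) d - triCoeff k (i + 2) d := by
    have h := triCoeff_sum k d
    rw [← Fin.sum_univ_three (f := fun i => triCoeff k i d), fin3_sum _ i] at h
    linear_combination h
  rw [H.bracket_span_one_left (H.jmul_diagElt_sub_mem d i)]
  simp only [map_smul, map_sub, LinearMap.smul_apply, LinearMap.sub_apply, L_e_bracket_ι,
    L_ι_e_one_bracket, L_ι_e_two_bracket, h]
  match_scalars <;> field_simp <;> ring

theorem L_ι_bracket_D_succ {p q : ZMod 2} {a b : C} (ha : a ∈ part k C p) (hb : b ∈ part k C q)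
    (i : Fin 3) : glBracket k H.J (H.jmul (H.ιJ i a)) (H.D (i + 1) b) =
      -H.jmul (H.ιJ (i + 2) (H.para.l a b)) := by
  have h := H.D_ι_two (i + 1) b a
  rw [fin3_one_two, fin3_one_one, H.para.r_comm ha hb, map_smul] at h
  rw [glBracket_skew (H.jmul_mem_part _ _ (H.ιJ_mem ha i)) (H.D_mem hb (i + 1)),
    H.der_bracket (H.D_mem_der _ _), h, map_smul, smul_smul]
  rcases sg_cases k (p * q) with e | e <;> simp [e]

theorem L_ι_bracket_D_self {p q : ZMod 2} {a b : C} (ha : a ∈ part k C p) (hb : b ∈ part k C q)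
    (i : Fin 3) : glBracket k H.J (H.jmul (H.ιJ i a)) (H.D i b) =
      -((2 * H.b a b) • H.jmul (H.e (i + 2) - H.e (i + 1))) := by
  rw [glBracket_skew (H.jmul_mem_part _ _ (H.ιJ_mem ha i)) (H.D_mem hb i),
    H.der_bracket (H.D_mem_der _ _), D_ι, map_smul, H.b_symm _ _ _ _ ha hb, smul_smul]
  congr 2
  ring

/-- The lift respects the brackets of all generators exactly, except for two elements of the same
`ι_i(S₂ ⊗ S)`. There the diagonal element comes out in the form adapted to `i`, and its difference
from the chosen form `diagElt` is a scalar. -/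
theorem toStr_bracket (X Y : (S₂ k).G H.para) :
    H.toStr ((S₂ k).gBracket H.para X Y) - glBracket k H.J (H.toStr X) (H.toStr Y) ∈
      Submodule.span k {(1 : Module.End k H.J)} := by
  have h2 : (2 : k) ≠ 0 := NeZero.ne 2
  have hz : ∀ {f g : Module.End k H.J}, f = g → f - g ∈
      Submodule.span k {(1 : Module.End k H.J)} := fun {f g} h => by
    rw [h, sub_self]; exact Submodule.zero_mem _
  refine bracket_mem_of_generators (S₂ k) H.para (field_sq_mem k) (br := glBracket k H.J)
    isLieSuperalgebra_gl _ H.toStr H.toStr_mem_part ?_ ?_ ?_ ?_ ?_ ?_ ?_ X Y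
  · intro d d'
    apply hz
    rw [toStr_inTriL, toStr_inTriL, toStr_inTriL, jmul_diagElt, jmul_diagElt, jmul_diagElt]
    simp [triCoeff_bracket, L_e_bracket]
  · intro d d'
    apply hz
    rw [toStr_inTriR, toStr_inTriR, toStr_inTriR, Dtri_bracket_Dtri]
    rfl
  · intro d d'
    rw [toStr_inTriL, toStr_inTriR, jmul_diagElt]
    simp [H.Dtri_bracket_L_e d'.2]
  · intro d i x a
    apply hz
    rw [toStr_inTriL, toStr_ι, toStr_ι, map_add, map_smul, map_smul, diagElt_bracket_D,
      diagElt_bracket_ι, tri_S₂_apply]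
    simp only [Prod.smul_fst, Prod.smul_snd, smul_eq_mul]
    module
  · intro d i x a
    apply hz
    rw [toStr_inTriR, toStr_ι, toStr_ι, map_add, map_smul, map_smul, H.Dtri_bracket_D d.2,
      H.Dtri_bracket_L_ι d.2]
  · intro i x y p q a ha b hb
    apply hz
    rw [toStr_ι, toStr_ι, toStr_ι]
    simp only [map_add, map_smul, LinearMap.add_apply, LinearMap.smul_apply,
      H.D_bracket_succ ha hb, H.L_ι_bracket_succ ha hb, H.L_ι_bracket_D_succ ha hb,
      H.der_bracket (H.D_mem_der i a), D_ι_one, map_neg, S₂_mul]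
    change _ • H.D (i + 2) (H.para.l a b) + _ • H.jmul (H.ιJ (i + 2) (H.para.l a b)) = _
    match_scalars <;> field_simp <;> ring
  · intro i x y p q a ha b hb
    obtain ⟨t0, t1, t2⟩ := triCoeff_θ k ((S₂ k).t x y) i
    -- The defect of the bracket is precisely this multiple of the defect between the two forms of
    -- the diagonal element.
    have h := Submodule.smul_mem _ (H.b a b)
      (H.jmul_diagElt_sub_mem (((S₂ k).θ ^ (i : ℕ)) ((S₂ k).t x y)) i)
    rw [t1, t2, triCoeff_t_one, triCoeff_t_two] at h
    convert h using 1
    rw [toStr_inTriL, toStr_inTriR, toStr_ι, toStr_ι]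
    simp only [map_add, map_smul, map_sub, LinearMap.add_apply, LinearMap.smul_apply,
      H.D_bracket_self ha hb, H.L_ι_bracket_self ha hb, H.L_ι_bracket_D_self ha hb,
      H.der_bracket (H.D_mem_der i a), D_ι, S₂_b, Submodule.coe_smul, Dtri_smul, para_b]
    change _ + _ • H.Dtri (H.rotT i a b) - _ = _
    match_scalars <;> field_simp <;> ring

/-- If the image is `c I`, moving `c I = L_{c 1}` into the multiplication part and using directness
of `der J ⊕ L_J` makes both components vanish; all coordinates of `X` are then read off. -/
theorem eq_zero_of_toStr_mem_span_one {X : (S₂ k).G H.para} [Nontrivial C]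
    (h : H.toStr X ∈ Submodule.span k {(1 : Module.End k H.J)}) : X = 0 := by
  have h2 : (2 : k) ≠ 0 := NeZero.ne 2
  obtain ⟨c, hc⟩ := Submodule.mem_span_singleton.1 h
  have h0 : H.derComp X + H.jmul (H.multPart X - c • (H.e 0 + H.e 1 + H.e 2)) = 0 := by
    rw [map_sub, map_smul, jmul_sum_e, hc, toStr_apply]
    abel
  obtain ⟨hd, hx⟩ := H.eq_zero_of_der_add_jmul (H.derComp_mem_der X) h0
  rw [derComp_apply] at hd
  obtain ⟨ht, ha⟩ := H.eq_zero_of_der_eq_zero hd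
  have hα : ∀ i, H.eCoord i (H.multPart X - c • (H.e 0 + H.e 1 + H.e 2)) = 0 := fun i => by
    rw [hx, map_zero]
  have hβ : ∀ i, H.ιCoord i (H.multPart X - c • (H.e 0 + H.e 1 + H.e 2)) = 0 := fun i => by
    rw [hx, map_zero]
  simp only [multPart_apply, diagElt_apply, map_sub, map_add, map_smul, map_sum, eCoord_e, eCoord_ι,
    ιCoord_e, ιCoord_ι, smul_zero, add_zero, sub_zero, zero_add, Finset.sum_const_zero,
    Finset.sum_ite_eq, Finset.mem_univ, if_true] at hα hβ
  -- `diagElt` has no `e_0`-component, so the coefficient of `e_0` gives `c = 0`; those of `e_1` and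
  -- `e_2` then give `α₂ = α₁ = 0`, and `α₀ = 0` follows from the sum.
  have e0 := hα 0
  have e1 := hα 1
  have e2 := hα 2
  simp at e0 e1 e2
  subst e0
  simp [h2] at e1 e2
  have hsum := triCoeff_sum k (prTriL _ _ X)
  rw [e1, e2, add_zero, add_zero] at hsum
  refine G_ext ?_ ?_ (fun i => ?_)
  · rw [map_zero]
    refine triCoeff_ext k fun i => ?_
    rw [map_zero]
    fin_cases i
    exacts [hsum, e2, e1]
  · rw [map_zero]
    exact Subtype.ext ht
  · rw [map_zero, eq_oneCoord_add_uCoord k (prι _ _ i X), hβ i, show oneCoord k C _ = 0 from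
      congrFun ha i]
    simp

theorem exists_toStr_sub_mem [Nontrivial C] {f : Module.End k H.J} (hf : f ∈ H.str) :
    ∃ X, H.toStr X - f ∈ Submodule.span k {(1 : Module.End k H.J)} := by
  have h2 : (2 : k) ≠ 0 := NeZero.ne 2
  rw [str_eq] at hf
  obtain ⟨d, hd, _, ⟨x, rfl⟩, rfl⟩ := Submodule.mem_sup.1 hf
  obtain ⟨t, ht, a, rfl⟩ := H.exists_of_mem_der hd
  -- Subtracting `x₀` times the unit, where `x₀, x₁, x₂` are the diagonal coefficients, leaves `(x₁
  -- - x₀) e_1 + (x₂ - x₀) e_2`. Comparison with `2 (α₂ e_1 - α₁ e_2)` determines `α₁` and `α₂`, and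
  -- `α₀` is minus their sum.
  let α : Fin 3 → k := ![(1 / 2 : k) * (H.eCoord 2 x - H.eCoord 1 x),
    (1 / 2 : k) * (H.eCoord 0 x - H.eCoord 2 x), (1 / 2 : k) * (H.eCoord 1 x - H.eCoord 0 x)]
  have hα : α 0 + α 1 + α 2 = 0 := by
    change (1 / 2 : k) * (H.eCoord 2 x - H.eCoord 1 x) +
      (1 / 2 : k) * (H.eCoord 0 x - H.eCoord 2 x) + (1 / 2 : k) * (H.eCoord 1 x - H.eCoord 0 x) = 0
    ring
  let δ : (S₂ k).tri := ⟨fun i => α i • sigmaS₂ k, (mem_tri_S₂ k _).2 ⟨α, hα, rfl⟩⟩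
  have hδ : ∀ i, triCoeff k i δ = α i := triCoeff_of_eq k rfl
  refine ⟨(S₂ k).mkG H.para δ ⟨t, ht⟩ fun i => 1 ⊗ₜ a i + uElt k ⊗ₜ H.ιCoord i x, ?_⟩
  have hx : (2 : k) • (α 2 • H.e 1 - α 1 • H.e 2) + ∑ i, H.ιJ i (H.ιCoord i x) - x =
      (-H.eCoord 0 x) • (H.e 0 + H.e 1 + H.e 2) := by
    have e1 : α 1 = (1 / 2 : k) * (H.eCoord 0 x - H.eCoord 2 x) := rfl
    have e2 : α 2 = (1 / 2 : k) * (H.eCoord 1 x - H.eCoord 0 x) := rfl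
    rw [e1, e2, sub_eq_iff_eq_add]
    conv_rhs => arg 2; rw [H.sum_coord x]
    rw [Fin.sum_univ_three (f := fun i => H.eCoord i x • H.e i)]
    match_scalars <;> field_simp <;> ring
  rw [Submodule.mem_span_singleton]
  refine ⟨-H.eCoord 0 x, ?_⟩
  rw [toStr_apply, derComp_apply, multPart_apply, prTriL_mkG, prTriR_mkG, diagElt_apply, hδ, hδ,
    ← jmul_sum_e, ← map_smul, ← hx, map_sub]
  simp only [prι_mkG, map_add, oneCoord_one_tmul, oneCoord_u_tmul, uCoord_one_tmul,
    uCoord_u_tmul, add_zero, zero_add]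
  abel

end HurwitzSuperalgebra
end Supermagic
end

/-! ### Passage to the quotient by the scalars, and the theorem -/

noncomputable section

namespace Supermagic
namespace HurwitzSuperalgebra

open SymmetricCompositionSuperalgebra

variable {k C : Type*} [Field k] [NeZero (2 : k)] [AddCommGroup C] [Module k C] [Superspace k C]
  (H : HurwitzSuperalgebra k C)

attribute [local irreducible] D Dtri toDer toStr

/-- The linear map underlying `g(S₂, S) → pstr J`. -/
def toPstr : (S₂ k).G H.para →ₗ[k] H.pstr :=
  H.scalars.mkQ ∘ₗ H.toStr.codRestrict H.str H.toStr_mem_str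

theorem toPstr_apply (X : (S₂ k).G H.para) :
    H.toPstr X = Submodule.Quotient.mk ⟨H.toStr X, H.toStr_mem_str X⟩ := rfl

theorem isClass_toPstr {f : Module.End k H.J} {X : (S₂ k).G H.para} (hf : f ∈ H.str)
    (h : H.toStr X - f ∈ Submodule.span k {(1 : Module.End k H.J)}) :
    H.IsClass f (H.toPstr X) := by
  refine ⟨hf, ?_⟩
  rw [toPstr_apply, Submodule.Quotient.eq]
  exact h

theorem isClass_toPstr_of_eq {f : Module.End k H.J} {X : (S₂ k).G H.para} (h : H.toStr X = f) :
    H.IsClass f (H.toPstr X) := by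
  refine H.isClass_toPstr (h ▸ H.toStr_mem_str X) ?_
  rw [h, sub_self]
  exact Submodule.zero_mem _

theorem toPstr_bijective [Nontrivial C] : Function.Bijective H.toPstr := by
  constructor
  · rw [injective_iff_map_eq_zero]
    intro X hX
    rw [toPstr_apply, Submodule.Quotient.mk_eq_zero] at hX
    exact H.eq_zero_of_toStr_mem_span_one hX
  · intro ξ
    induction ξ using Submodule.Quotient.induction_on with
    | H f =>
      obtain ⟨X, hX⟩ := H.exists_toStr_sub_mem f.2
      refine ⟨X, ?_⟩
      rw [toPstr_apply, Submodule.Quotient.eq]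
      exact hX

theorem toPstr_mem_part (p : ZMod 2) (X : (S₂ k).G H.para)
    (hX : X ∈ part k ((S₂ k).G H.para) p) : H.toPstr X ∈ part k H.pstr p := by
  have h : pr k p (⟨H.toStr X, H.toStr_mem_str X⟩ : H.str) = ⟨H.toStr X, H.toStr_mem_str X⟩ :=
    Subtype.ext (H.toStr_mem_part p X hX)
  rw [mem_part, toPstr_apply]
  exact congrArg (Submodule.Quotient.mk (p := H.scalars)) h

theorem toPstr_bracket (X Y : (S₂ k).G H.para) :
    H.toPstr ((S₂ k).gBracket H.para X Y) = H.pstrBracket (H.toPstr X) (H.toPstr Y) := by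
  have h : H.pstrBracket (H.toPstr X) (H.toPstr Y) = Submodule.Quotient.mk (H.strBracket
      ⟨H.toStr X, H.toStr_mem_str X⟩ ⟨H.toStr Y, H.toStr_mem_str Y⟩) := rfl
  rw [h, toPstr_apply, Submodule.Quotient.eq]
  exact H.toStr_bracket X Y

/-- The isomorphism `Φ₂ : g(S₂, S) → pstr J`. -/
def pstrIso [Nontrivial C] : LieSuperIso ((S₂ k).gBracket H.para) H.pstrBracket :=
  ⟨LinearEquiv.ofBijective H.toPstr H.toPstr_bijective, H.toPstr_mem_part, H.toPstr_bracket⟩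

theorem oneCoord_rTensor (w : k ⊗[k] C) : oneCoord k C
    (LinearMap.rTensor C (LinearMap.toSpanSingleton k (k × k) 1) w) = TensorProduct.lid k C w := by
  have h2 : (2 : k) ≠ 0 := NeZero.ne 2
  induction w using TensorProduct.induction_on with
  | zero => simp
  | tmul x a =>
    rw [LinearMap.rTensor_tmul, LinearMap.toSpanSingleton_apply, oneCoord_tmul,
      TensorProduct.lid_tmul]
    congr 1
    simp only [Prod.smul_fst, Prod.smul_snd, Prod.fst_one, Prod.snd_one, smul_eq_mul, mul_one]
    field_simp
    ring
  | add v w hv hw => rw [map_add, map_add, hv, hw, map_add]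

theorem uCoord_rTensor (w : k ⊗[k] C) : uCoord k C
    (LinearMap.rTensor C (LinearMap.toSpanSingleton k (k × k) 1) w) = 0 := by
  induction w using TensorProduct.induction_on with
  | zero => simp
  | tmul x a =>
    rw [LinearMap.rTensor_tmul, LinearMap.toSpanSingleton_apply, uCoord_tmul]
    simp
  | add v w hv hw => rw [map_add, map_add, hv, hw, add_zero]

/-- The inclusion lands in `1 ⊗ C`, where the `u`-coordinate vanishes. So `Φ₂` extends `Φ` already
at the level of endomorphisms, before scalars are factored out. -/
theorem toStr_inclusion (X : (S₁ k).G H.para) : H.toStr (inclusion H.para X) = H.toDer X := by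
  rw [toStr_apply, derComp_apply, multPart_apply, toDer_apply, inclusion, prTriL_mkG, prTriR_mkG]
  simp [prι_mkG, oneCoord_rTensor, uCoord_rTensor]

theorem isClass_diag (α : Fin 3 → k) (d : (S₂ k).tri)
    (hd : (d : Fin 3 → Module.End k (k × k)) = fun i => α i • sigmaS₂ k) (i : Fin 3) :
    H.IsClass ((2 : k) • H.jmul (α (i + 2) • H.e (i + 1) - α (i + 1) • H.e (i + 2)))
      (H.toPstr ((S₂ k).inTriL H.para d)) := by
  refine H.isClass_toPstr (Submodule.smul_mem _ _ (H.jmul_mem_str _)) ?_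
  have h := H.jmul_diagElt_sub_mem d i
  rwa [triCoeff_of_eq k hd, triCoeff_of_eq k hd, ← toStr_inTriL] at h

theorem isClass_ι (i : Fin 3) (α β : k) (a : C) :
    H.IsClass (α • H.D i a + β • H.jmul (H.ιJ i a))
      (H.toPstr ((S₂ k).ι H.para i ((α • 1 + β • uElt k) ⊗ₜ a))) := by
  have h2 : (2 : k) ≠ 0 := NeZero.ne 2
  apply isClass_toPstr_of_eq
  rw [toStr_ι]
  congr 2 <;> simp [uElt] <;> field_simp <;> ring

end HurwitzSuperalgebra
end Supermagic
end

theorem theorem3p1 {k C : Type*} [Field k] [NeZero (2 : k)] [AddCommGroup C] [Module k C]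
    [Superspace k C] [FiniteDimensional k C] [Nontrivial C] (H : HurwitzSuperalgebra k C) :
    -- `g(S₁, S)`, `der J`, `g(S₂, S)` and `pstr J` are Lie superalgebras, for `S = H.para`
    IsLieSuperalgebra ((S₁ k).gBracket H.para) ∧ IsLieSuperalgebra (derBracket H.jmul) ∧
    IsLieSuperalgebra ((S₂ k).gBracket H.para) ∧ IsLieSuperalgebra H.pstrBracket ∧
    -- `str J = der J ⊕ L_J`
    H.str = H.derJ ⊔ LinearMap.range H.jmul ∧ Disjoint H.derJ (LinearMap.range H.jmul) ∧
    -- `tri(S₂)` consists of the triples `(α₀ σ, α₁ σ, α₂ σ)` with `α₀ + α₁ + α₂ = 0`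
    (∀ d, d ∈ (S₂ k).tri ↔
      ∃ α : Fin 3 → k, α 0 + α 1 + α 2 = 0 ∧ d = fun i => α i • sigmaS₂ k) ∧
    -- the isomorphism `Φ`
    ∃ Φ : LieSuperIso ((S₁ k).gBracket H.para) (derBracket H.jmul),
      (∀ d : H.para.tri, (Φ.toLinearEquiv ((S₁ k).inTriR H.para d) : Module.End k H.J) =
        H.Dtri d) ∧
      (∀ i a, (Φ.toLinearEquiv ((S₁ k).ι H.para i (1 ⊗ₜ a)) : Module.End k H.J) = H.D i a) ∧
      -- its extension `Φ₂`
      ∃ Φ₂ : LieSuperIso ((S₂ k).gBracket H.para) H.pstrBracket,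
        (∀ x, H.IsClass (Φ.toLinearEquiv x) (Φ₂.toLinearEquiv (inclusion H.para x))) ∧
        (∀ d : H.para.tri,
          H.IsClass (H.Dtri d) (Φ₂.toLinearEquiv ((S₂ k).inTriR H.para d))) ∧
        (∀ (α : Fin 3 → k) (d : (S₂ k).tri), α 0 + α 1 + α 2 = 0 →
          (d : Fin 3 → Module.End k (k × k)) = (fun i => α i • sigmaS₂ k) →
          H.IsClass ((2 : k) • H.jmul (α 2 • H.e 1 - α 1 • H.e 2))
            (Φ₂.toLinearEquiv ((S₂ k).inTriL H.para d)) ∧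
          H.IsClass ((2 : k) • H.jmul (α 1 • H.e 0 - α 0 • H.e 1))
            (Φ₂.toLinearEquiv ((S₂ k).inTriL H.para d)) ∧
          H.IsClass ((2 : k) • H.jmul (α 0 • H.e 2 - α 2 • H.e 0))
            (Φ₂.toLinearEquiv ((S₂ k).inTriL H.para d))) ∧
        (∀ (i : Fin 3) (α β : k) (a : C),
          H.IsClass (α • H.D i a + β • H.jmul (H.ιJ i a))
            (Φ₂.toLinearEquiv ((S₂ k).ι H.para i ((α • 1 + β • uElt k) ⊗ₜ a)))) := by
  -- The axioms for `g(S₁, S)` and `g(S₂, S)` are transported back from `der J` and `pstr J`. There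
  -- is no circularity: an isomorphism in the sense of `LieSuperIso` only preserves parities and
  -- brackets.
  refine ⟨H.derIso.isLieSuperalgebra H.isLieSuperalgebra_derBracket,
    H.isLieSuperalgebra_derBracket, H.pstrIso.isLieSuperalgebra H.isLieSuperalgebra_pstrBracket,
    H.isLieSuperalgebra_pstrBracket, H.str_eq, H.disjoint_derJ, mem_tri_S₂ k, H.derIso,
    fun d => ?_, fun i a => ?_, H.pstrIso, fun x => ?_, fun d => ?_, fun α d _ hd => ⟨?_, ?_, ?_⟩,
    fun i α β a => ?_⟩
  · rw [HurwitzSuperalgebra.derIso_apply, HurwitzSuperalgebra.toDer_inTriR]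
  · rw [HurwitzSuperalgebra.derIso_apply, HurwitzSuperalgebra.toDer_ι, one_smul]
  · exact H.isClass_toPstr_of_eq (H.toStr_inclusion x)
  · exact H.isClass_toPstr_of_eq (H.toStr_inTriR d)
  -- The shifts `0`, `2`, `1` produce the expressions in `(e_1, e_2)`, `(e_0, e_1)` and `(e_2,
  -- e_0)`.
  · exact H.isClass_diag α d hd 0
  · exact H.isClass_diag α d hd 2
  · exact H.isClass_diag α d hd 1
  · exact H.isClass_ι i α β a
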